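/- For a finite graph $G$ let $c_k(G)$ be the number of spanning trees of $G$ with maximum degree at most $k$. For integers $k\ge 3$ put $$f_k = 1-\frac1e\sum_{i=0}^{k-3}\frac1{i!},\qquad g_k=\frac{2}{e\,(k-1)!},$$ and let $z_3=0.0494$, $z_4=0.1527$, and $$z_k=\bigl(1-(k+1)(f_k+g_k)\bigr)^{g_k}(1-g_k)^{1-g_k}g_k^{\,g_k}\qquad(k\ge 5),$$ where the base $1-(k+1)(f_k+g_k)$ is positive for every $k\ge5$. Then the following hold. (1) For every $k\ge 3$ we have $z_k>0$, and there is a function $\varepsilon_k:\mathbb N\to\mathbb R$ with $\varepsilon_k(n)\to 0$ as $n\to\infty$ such that for all $n$ and $r$, every connected $n$-vertex $r$-regular graph $G$ with $r\ge \frac{n}{k+1}$ satisfies $$c_k(G)^{1/n}\ \ge\ (1-\varepsilon_k(n))\, r\, z_k .$$ (2) $z_k\to 1$ as $k\to\infty$, and the convergence is faster than exponential: $1-z_k=O\!\left(\frac{k\ln k}{(k-1)!}\right)$. -/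

import Mathlib

open Filter Topology Asymptotics

namespace BoundedDegreeTrees

open Classical in
/-- `c_k(G)`: the number of spanning trees of `G` with maximum degree at most `k`. A spanning tree is
a subgraph of `G` on the whole vertex set which is a tree. -/
noncomputable def numSpanningTrees {V : Type*} [Fintype V] (G : SimpleGraph V) (k : ℕ) : ℕ :=
  {T : SimpleGraph V | T ≤ G ∧ T.IsTree ∧ T.maxDegree ≤ k}.ncard

/-- `f_k = 1 - (1/e) * ∑_{i=0}^{k-3} 1/i!`, used for `k ≥ 3` (so the range is `0, …, k-3`). -/
noncomputable def f (k : ℕ) : ℝ :=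
  1 - 1 / Real.exp 1 * ∑ i ∈ Finset.range (k - 2), 1 / (i.factorial : ℝ)

/-- `g_k = 2 / (e * (k-1)!)`, used for `k ≥ 3`. -/
noncomputable def g (k : ℕ) : ℝ :=
  2 / (Real.exp 1 * ((k - 1).factorial : ℝ))

/-- The constant `z_k`, used for `k ≥ 3`; the powers are real powers. -/
noncomputable def z (k : ℕ) : ℝ :=
  if k = 3 then 0.0494
  else if k = 4 then 0.1527
  else (1 - ((k : ℝ) + 1) * (f k + g k)) ^ g k * (1 - g k) ^ (1 - g k) * g k ^ g k

end BoundedDegreeTrees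

/-! Write n for the number of vertices; the hypothesis says n ≤ (k+1) r. Choosing a neighbour φ v of
every vertex v gives r ^ n maps, and the edges v - φ v nearly form a spanning tree if φ has few
cycles. The vertex v has degree at most its in-degree plus one. So it suffices to produce about (r
z_k) ^ n maps with few cycles and in-degrees at most k - 1, and to turn each into a spanning tree of
maximum degree at most k by changing O(√n) edges. Each tree then comes from only n ^ O(√n) maps
(`card_le_mul_numSpanningTrees`), a factor whose n-th root tends to 1.

Bounding in-degrees. For a random φ an in-degree is binomial with mean 1, almost Poisson. A
first-moment bound shows that a positive proportion of the maps have total excess at most g n, where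
g is g_k for k ≥ 4 and g_4 for k = 3, and few short cycles (`eventually_card_isGood_ge`). The m
surplus vertices of such a map are redirected injectively to neighbours of in-degree at most k - 2.
At least `slack k` * r targets are available at every step, while a result has at most binom(n, m) r
^ m preimages (`exists_redirected_family`). This leaves about r ^ n * slack ^ m / binom(n, m) maps,
and the entropy bound for binom(n, m) gives z_k (`pow_z_mul_choose_le`). Redirecting the last edge
of a short cycle destroys it in many ways, so most redirected maps still have few short cycles; long
cycles are few in any case.

Connecting up. Deleting the out-edges at O(√n) vertices leaves a graph whose components contain
roots, each root with a free slot. Roots are joined greedily to available vertices of other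
components until only O(1) components outside the reserve remain (`exists_greedy_merge`). These may
lie in parts of G joined by few edges, so a reserve is prepared in advance. The vertices split into
at most k + 1 clusters inside which any two vertices are joined robustly, by iterated large common
neighbourhoods (`exists_clusters`, `exists_graph_clusters`). Small hitting sets for those
neighbourhoods supply disjoint routes. At most k edges of G, with all degrees at most k - 1, connect
the clusters (`exists_cluster_links`). Unused reserve vertices are attached as leaves by Hall's
theorem, and any spanning tree of the resulting connected graph is taken.

Part (2) is an elementary estimate of log z_k, whose main term is g_k log g_k. -/

namespace BoundedDegreeTrees

/-! ### Clusters in a ladder of symmetric relations -/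

section Clusters
open Classical in
/-- A ladder of ever weaker symmetric relations, each one containing the pairs with many common
neighbours in the previous one, has a late term that contains an equivalence relation with few and
large classes. -/
theorem exists_clusters {V : Type*} [Fintype V] (L : ℕ → V → V → Prop)
    (hsymm : ∀ j u v, L j u v → L j v u) (hrefl : ∀ v, L 0 v v)
    (hmono : ∀ j u v, L j u v → L (j + 1) u v) (K : ℕ) (hK : 0 < K) (θ Δ : ℝ)
    (hindep : ∀ D : Finset V, (∀ u ∈ D, ∀ v ∈ D, u ≠ v → ¬ L 0 u v) → D.card ≤ K)
    (hdeg : ∀ v, Δ ≤ (Finset.univ.filter (fun u => L 0 v u)).card)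
    (hcommon : ∀ j u v, θ ≤ (Finset.univ.filter (fun p => L j u p ∧ L j p v)).card →
      L (j + 1) u v)
    (hθΔ : 2 * K * K * θ ≤ Δ) (hθ : 0 < θ) :
    ∃ cl : V → V, (∀ u v, cl u = cl v → L (2 * K + 3) u v) ∧
      (Finset.univ.image cl).card ≤ K ∧
      ∀ v, Δ / (2 * K) ≤ (Finset.univ.filter (fun u => cl u = cl v)).card := by
  have hmono' : ∀ i j, i ≤ j → ∀ u v, L i u v → L j u v := by
    intro i j hij
    induction hij with
    | refl => exact fun u v h => h
    | step _ ih => exact fun u v h => hmono _ _ _ (ih u v h)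
  have hK1 : (1 : ℝ) ≤ K := by exact_mod_cast hK
  have hΔθ : θ ≤ Δ / (2 * K) := by
    rw [le_div_iff₀ (by positivity)]
    nlinarith [mul_le_mul_of_nonneg_right hK1 hθ.le]
  let I : ℕ → Finset (Finset V) := fun j =>
    Finset.univ.filter (fun D => ∀ u ∈ D, ∀ v ∈ D, u ≠ v → ¬ L j u v)
  let c : ℕ → ℕ := fun j => (I j).sup Finset.card
  have hmemI : ∀ j D, D ∈ I j ↔ ∀ u ∈ D, ∀ v ∈ D, u ≠ v → ¬ L j u v := by
    intro j D; simp [I]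
  have hIc : ∀ j D, D ∈ I j → D.card ≤ c j := fun j D h => Finset.le_sup (f := Finset.card) h
  have hImono : ∀ i j, i ≤ j → I j ⊆ I i := by
    intro i j hij D hD
    rw [hmemI] at hD ⊢
    exact fun u hu v hv huv h => hD u hu v hv huv (hmono' i j hij u v h)
  have hcmono : ∀ i j, i ≤ j → c j ≤ c i := fun i j hij => Finset.sup_mono (hImono i j hij)
  have hcK : c 0 ≤ K := Finset.sup_le fun D hD => hindep D ((hmemI 0 D).1 hD)
  -- `c` is the independence number of the relations; it does not increase and starts at most at
  -- `K`, so it cannot drop in each of `K + 1` successive blocks of two levels. The set `D` below is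
  -- then a maximum independent set at levels `j`, `j + 1` and `j + 2` at once: maximality at `j`
  -- makes every vertex close to some centre in `D`, while independence at `j + 2` keeps the centres
  -- far apart.
  obtain ⟨j, hjK, hj⟩ : ∃ j, j ≤ 2 * K ∧ c j = c (j + 2) := by
    by_contra! hcon
    have : ∀ i, i ≤ K + 1 → c (2 * i) + i ≤ K := by
      intro i
      induction i with
      | zero => intro _; simpa using hcK
      | succ i ih =>
        intro hi
        have h1 := ih (by omega)
        have h2 := hcon (2 * i) (by omega)
        have h3 := hcmono (2 * i) (2 * i + 2) (by omega)
        have h4 : 2 * (i + 1) = 2 * i + 2 := by ring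
        rw [h4]
        omega
    have := this (K + 1) le_rfl
    omega
  obtain ⟨D, hDI, hDc⟩ : ∃ D ∈ I (j + 2), D.card = c (j + 2) := by
    have hne : (I (j + 2)).Nonempty := ⟨∅, by rw [hmemI]; simp⟩
    obtain ⟨D, hD, h⟩ := Finset.exists_mem_eq_sup (I (j + 2)) hne Finset.card
    exact ⟨D, hD, h.symm⟩
  have hDj : D.card = c j := by rw [hDc, hj]
  have hDK : D.card ≤ K := by
    rw [hDj]; exact (hcmono 0 j (Nat.zero_le _)).trans hcK
  have hD2 := (hmemI _ _).1 hDI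
  have hrefl' : ∀ i v, L i v v := fun i v => hmono' 0 i (Nat.zero_le _) v v (hrefl v)
  have hnear : ∀ v, ∃ d ∈ D, L j v d := by
    intro v
    by_contra! hcon
    have hvD : v ∉ D := fun h => hcon v h (hrefl' j v)
    have : insert v D ∈ I j := by
      rw [hmemI]
      intro a ha b hb hab hL
      rw [Finset.mem_insert] at ha hb
      rcases ha with rfl | ha
      · rcases hb with rfl | hb
        · exact hab rfl
        · exact hcon b hb hL
      · rcases hb with rfl | hb
        · exact hcon a ha (hsymm _ _ _ hL)
        · exact hD2 a ha b hb hab (hmono' j (j + 2) (by omega) _ _ hL)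
    have h := hIc j _ this
    rw [Finset.card_insert_of_notMem hvD] at h
    omega
  have hsmall : ∀ d ∈ D, ∀ d' ∈ D, d ≠ d' →
      ((Finset.univ.filter (fun p => L (j + 1) d p ∧ L (j + 1) p d')).card : ℝ) < θ := by
    intro d hd d' hd' hne
    by_contra! hcon
    exact hD2 d hd d' hd' hne (hcommon (j + 1) d d' hcon)
  have hassign : ∀ v, ∃ d ∈ D,
      Δ / K ≤ ((Finset.univ.filter (fun p => L 0 v p ∧ L j p d)).card : ℝ) := by
    intro v
    by_contra! hcon
    have hDne : D.Nonempty := by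
      obtain ⟨d, hd, -⟩ := hnear v
      exact ⟨d, hd⟩
    have h1 : (Finset.univ.filter (fun u => L 0 v u)) ⊆
        D.biUnion (fun d => Finset.univ.filter (fun p => L 0 v p ∧ L j p d)) := by
      intro p hp
      obtain ⟨d, hd, h⟩ := hnear p
      simp only [Finset.mem_filter, Finset.mem_univ, true_and] at hp
      simp only [Finset.mem_biUnion, Finset.mem_filter, Finset.mem_univ, true_and]
      exact ⟨d, hd, hp, h⟩
    have h2 : ((Finset.univ.filter (fun u => L 0 v u)).card : ℝ) ≤
        ∑ d ∈ D, ((Finset.univ.filter (fun p => L 0 v p ∧ L j p d)).card : ℝ) := by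
      exact_mod_cast (Finset.card_le_card h1).trans Finset.card_biUnion_le
    have h3 := Finset.sum_lt_sum_of_nonempty hDne hcon
    have h4 := hdeg v
    rw [Finset.sum_const, nsmul_eq_mul] at h3
    have h5 : (D.card : ℝ) ≤ K := by exact_mod_cast hDK
    have hΔ0 : 0 ≤ Δ / K := by
      have : 0 ≤ Δ := le_trans (by positivity) hθΔ
      positivity
    have h6 : (D.card : ℝ) * (Δ / K) ≤ K * (Δ / K) := mul_le_mul_of_nonneg_right h5 hΔ0
    have h7 : (K : ℝ) * (Δ / K) = Δ := by field_simp
    linarith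
  choose cl hclD hcl using hassign
  -- The pure neighbours of `v`: close to the centre of `v` and to no other centre. Impure ones lie
  -- in the common neighbourhoods of two centres, each smaller than `θ`, so at least half of the `Δ
  -- / K` neighbours survive.
  let P : V → Finset V := fun v => Finset.univ.filter
    (fun p => L 0 v p ∧ L j p (cl v) ∧ ∀ d ∈ D, d ≠ cl v → ¬ L (j + 1) p d)
  have hPcard : ∀ v, Δ / (2 * K) ≤ ((P v).card : ℝ) := by
    intro v
    have h1 : Finset.univ.filter (fun p => L 0 v p ∧ L j p (cl v)) ⊆ P v ∪
        (D.erase (cl v)).biUnion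
          (fun d => Finset.univ.filter (fun p => L (j + 1) (cl v) p ∧ L (j + 1) p d)) := by
      intro p hp
      simp only [Finset.mem_filter, Finset.mem_univ, true_and] at hp
      simp only [P, Finset.mem_union, Finset.mem_biUnion, Finset.mem_filter, Finset.mem_univ,
        true_and, Finset.mem_erase]
      by_cases h : ∀ d ∈ D, d ≠ cl v → ¬ L (j + 1) p d
      · exact Or.inl ⟨hp.1, hp.2, h⟩
      · push Not at h
        obtain ⟨d, hd, hne, hL⟩ := h
        exact Or.inr ⟨d, ⟨hne, hd⟩, hsymm _ _ _ (hmono _ _ _ hp.2), hL⟩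
    have h2 : ((Finset.univ.filter (fun p => L 0 v p ∧ L j p (cl v))).card : ℝ) ≤ (P v).card +
        ∑ d ∈ D.erase (cl v), ((Finset.univ.filter
          (fun p => L (j + 1) (cl v) p ∧ L (j + 1) p d)).card : ℝ) := by
      exact_mod_cast (Finset.card_le_card h1).trans ((Finset.card_union_le _ _).trans
        (Nat.add_le_add_left Finset.card_biUnion_le _))
    have h3 : ∑ d ∈ D.erase (cl v), ((Finset.univ.filter
          (fun p => L (j + 1) (cl v) p ∧ L (j + 1) p d)).card : ℝ) ≤
        (D.erase (cl v)).card • θ := by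
      apply Finset.sum_le_card_nsmul
      intro d hd
      rw [Finset.mem_erase] at hd
      exact (hsmall _ (hclD v) d hd.2 hd.1.symm).le
    have h4 : ((D.erase (cl v)).card : ℝ) ≤ K := by
      exact_mod_cast (Finset.card_le_card (Finset.erase_subset _ _)).trans hDK
    rw [nsmul_eq_mul] at h3
    have h5 := mul_le_mul_of_nonneg_right h4 hθ.le
    have h6 := hcl v
    have h7 : (K : ℝ) * θ ≤ Δ / (2 * K) := by
      rw [le_div_iff₀ (by positivity)]
      nlinarith
    have h8 : Δ / K = Δ / (2 * K) + Δ / (2 * K) := by field_simp; ring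
    linarith
  have hmemP : ∀ v p, p ∈ P v ↔
      (L 0 v p ∧ L j p (cl v) ∧ ∀ d ∈ D, d ≠ cl v → ¬ L (j + 1) p d) := by
    intro v p; simp [P]
  have hpure : ∀ u v p q, cl u = cl v → p ∈ P u → q ∈ P v → L (j + 1) p q := by
    intro u v p q huv hp hq
    by_contra hcon
    rw [hmemP] at hp hq
    have hpq : p ≠ q := fun h => hcon (h ▸ hrefl' _ p)
    have hqp : ¬ L (j + 1) q p := fun h => hcon (hsymm _ _ _ h)
    have hpD : p ∉ D.erase (cl v) := fun h => by
      rw [Finset.mem_erase] at h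
      exact hp.2.2 p h.2 (huv ▸ h.1) (hrefl' _ p)
    have hqD : q ∉ D.erase (cl v) := fun h => by
      rw [Finset.mem_erase] at h
      exact hq.2.2 q h.2 h.1 (hrefl' _ q)
    -- Exchange argument: were `p` and `q` unrelated at level `j + 1`, replacing their common centre
    -- in `D` by both of them would give an independent set larger than the maximum there.
    have hmem : insert p (insert q (D.erase (cl v))) ∈ I (j + 1) := by
      rw [hmemI]
      intro a ha b hb hab hL
      simp only [Finset.mem_insert, Finset.mem_erase] at ha hb
      rcases ha with rfl | rfl | ha
      · rcases hb with rfl | rfl | hb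
        · exact hab rfl
        · exact hcon hL
        · exact hp.2.2 b hb.2 (huv ▸ hb.1) hL
      · rcases hb with rfl | rfl | hb
        · exact hqp hL
        · exact hab rfl
        · exact hq.2.2 b hb.2 hb.1 hL
      · rcases hb with rfl | rfl | hb
        · exact hp.2.2 a ha.2 (huv ▸ ha.1) (hsymm _ _ _ hL)
        · exact hq.2.2 a ha.2 ha.1 (hsymm _ _ _ hL)
        · exact hD2 a ha.2 b hb.2 hab (hmono _ _ _ hL)
    have h1 := hIc _ _ hmem
    rw [Finset.card_insert_of_notMem (by simp only [Finset.mem_insert, not_or]; exact ⟨hpq, hpD⟩),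
      Finset.card_insert_of_notMem hqD, Finset.card_erase_of_mem (hclD v)] at h1
    have h2 := hcmono j (j + 1) (by omega)
    have h3 : 0 < D.card := Finset.card_pos.2 ⟨_, hclD v⟩
    omega
  -- Pure neighbours of a class are related at `j + 1`; passing through `P u` relates them to the
  -- vertices of the class at `j + 2`, and passing through `P v` relates those vertices to each
  -- other at `j + 3`.
  have hone : ∀ u v p, cl u = cl v → p ∈ P v → L (j + 2) p u := by
    intro u v p huv hp
    apply hcommon
    refine hΔθ.trans ((hPcard u).trans ?_)
    norm_cast
    apply Finset.card_le_card
    intro q hq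
    simp only [Finset.mem_filter, Finset.mem_univ, true_and]
    exact ⟨hpure v u p q huv.symm hp hq,
      hmono' 0 _ (Nat.zero_le _) _ _ (hsymm _ _ _ ((hmemP u q).1 hq).1)⟩
  refine ⟨cl, ?_, ?_, ?_⟩
  · intro u v huv
    apply hmono' (j + 3) _ (by omega)
    apply hcommon
    refine hΔθ.trans ((hPcard v).trans ?_)
    norm_cast
    apply Finset.card_le_card
    intro p hp
    simp only [Finset.mem_filter, Finset.mem_univ, true_and]
    exact ⟨hsymm _ _ _ (hone u v p huv hp), hone v v p rfl hp⟩
  · refine (Finset.card_le_card ?_).trans hDK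
    intro d hd
    simp only [Finset.mem_image, Finset.mem_univ, true_and] at hd
    obtain ⟨v, rfl⟩ := hd
    exact hclD v
  · intro v
    refine (hPcard v).trans ?_
    norm_cast
    apply Finset.card_le_card
    intro p hp
    simp only [Finset.mem_filter, Finset.mem_univ, true_and]
    -- A pure neighbour `p` of `v` belongs to the class of `v`: otherwise the many neighbours of `p`
    -- near its own centre relate `p` to that centre at level `j + 1`, against purity.
    by_contra hne
    refine ((hmemP v p).1 hp).2.2 (cl p) (hclD p) hne ?_
    apply hcommon
    have h1 : Δ / (2 * K) ≤ Δ / K := by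
      have : 0 ≤ Δ := le_trans (by positivity) hθΔ
      apply div_le_div_of_nonneg_left this (by positivity)
      linarith
    refine hΔθ.trans (h1.trans ((hcl p).trans ?_))
    norm_cast
    apply Finset.card_le_card
    intro q hq
    simp only [Finset.mem_filter, Finset.mem_univ, true_and] at hq ⊢
    exact ⟨hmono' 0 _ (Nat.zero_le _) _ _ hq.1, hq.2⟩

end Clusters

/-! ### Degrees and paths as subgraphs -/

section Degrees
variable {V : Type*}

/-- The degree of a vertex, without a decidability assumption. -/
noncomputable def deg (F : SimpleGraph V) (v : V) : ℕ := (F.neighborSet v).ncard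

theorem deg_sup_le (F F' : SimpleGraph V) (v : V) : deg (F ⊔ F') v ≤ deg F v + deg F' v := by
  have : (F ⊔ F').neighborSet v = F.neighborSet v ∪ F'.neighborSet v := by
    ext x; simp
  rw [deg, this]
  exact Set.ncard_union_le _ _

theorem deg_eq_zero_of (F : SimpleGraph V) (v : V) (h : ∀ x, ¬ F.Adj v x) : deg F v = 0 := by
  have : F.neighborSet v = ∅ := by ext x; simp [h]
  rw [deg, this, Set.ncard_empty]

theorem deg_edge_eq_zero {u w x : V} (h1 : x ≠ u) (h2 : x ≠ w) :
    deg (SimpleGraph.edge u w) x = 0 := by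
  apply deg_eq_zero_of
  intro y
  simp only [SimpleGraph.edge_adj]
  grind

variable [Finite V]

theorem deg_mono {F F' : SimpleGraph V} (h : F ≤ F') (v : V) : deg F v ≤ deg F' v :=
  Set.ncard_le_ncard (fun _ hx => h hx) (Set.toFinite _)

theorem not_adj_of_deg_eq_zero {F : SimpleGraph V} {v : V} (h : deg F v = 0) (x : V) :
    ¬ F.Adj v x := by
  intro hx
  rw [deg, Set.ncard_eq_zero (Set.toFinite _)] at h
  have : x ∈ F.neighborSet v := hx
  simp [h] at this

theorem deg_edge_le_one (u w x : V) : deg (SimpleGraph.edge u w) x ≤ 1 := by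
  rw [deg, Set.ncard_le_one (Set.toFinite _)]
  intro a ha b hb
  simp only [SimpleGraph.mem_neighborSet, SimpleGraph.edge_adj] at ha hb
  grind

/-- The edges of a path as a graph with its degree accounting: a link costs one slot at each end and
at most two at inner vertices. When the two ends coincide the graph is empty. -/
theorem exists_pathGraph {G : SimpleGraph V} {u v : V} (p : G.Walk u v) (hp : p.IsPath) :
    ∃ P : SimpleGraph V, P ≤ G ∧ P.Reachable u v ∧ deg P u ≤ 1 ∧ deg P v ≤ 1 ∧
      (∀ x, deg P x ≤ 2) ∧ (∀ x, x ∉ p.support → deg P x = 0) ∧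
      (∀ x ∈ p.support, P.Reachable x u) := by
  induction p with
  | nil =>
    refine ⟨⊥, bot_le, SimpleGraph.Reachable.refl _, ?_, ?_, ?_, ?_, ?_⟩
    · rw [deg_eq_zero_of] <;> simp
    · rw [deg_eq_zero_of] <;> simp
    · intro x; rw [deg_eq_zero_of] <;> simp
    · intro x _; rw [deg_eq_zero_of]; simp
    · intro x hx
      simp only [SimpleGraph.Walk.support_nil, List.mem_singleton] at hx
      rw [hx]
  | @cons u w v h q ih =>
    rw [SimpleGraph.Walk.cons_isPath_iff] at hp
    obtain ⟨P, hPG, hr, hw, hv, h2, h0, hs⟩ := ih hp.1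
    have hPu : deg P u = 0 := h0 u hp.2
    have hadj : (SimpleGraph.edge u w).Adj u w := by
      rw [SimpleGraph.edge_adj]; exact ⟨Or.inl ⟨rfl, rfl⟩, h.ne⟩
    have huw : (P ⊔ SimpleGraph.edge u w).Reachable u w :=
      SimpleGraph.Adj.reachable (Or.inr hadj)
    have hle : P ≤ P ⊔ SimpleGraph.edge u w := le_sup_left
    have huv : u ≠ v := fun e => hp.2 (e ▸ q.end_mem_support)
    refine ⟨P ⊔ SimpleGraph.edge u w, sup_le hPG ?_, huw.trans (hr.mono hle), ?_, ?_, ?_, ?_, ?_⟩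
    · rw [SimpleGraph.edge_le_iff]; exact Or.inr h
    · have := deg_sup_le P (SimpleGraph.edge u w) u
      have := deg_edge_le_one u w u
      omega
    · have h3 := deg_sup_le P (SimpleGraph.edge u w) v
      by_cases hwv : w = v
      · subst hwv
        have hq : q = SimpleGraph.Walk.nil := by
          cases q with
          | nil => rfl
          | cons h' q' =>
            exfalso
            rw [SimpleGraph.Walk.cons_isPath_iff] at hp
            exact hp.1.2 q'.end_mem_support
        have h4 := deg_edge_le_one u w w
        by_cases hd : deg P w = 0
        · omega
        · have hnb : (P.neighborSet w).ncard ≠ 0 := hd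
          obtain ⟨x, hx⟩ : (P.neighborSet w).Nonempty := by
            rw [← Set.ncard_pos (Set.toFinite _)]; omega
          have hxw : x ∉ q.support := by
            rw [hq]
            simp only [SimpleGraph.Walk.support_nil, List.mem_singleton]
            exact (SimpleGraph.Adj.ne hx).symm
          exact absurd (SimpleGraph.Adj.symm hx) (not_adj_of_deg_eq_zero (h0 x hxw) w)
      · rw [deg_edge_eq_zero huv.symm (Ne.symm hwv)] at h3
        omega
    · intro x
      have h3 := deg_sup_le P (SimpleGraph.edge u w) x
      have h4 := deg_edge_le_one u w x
      by_cases hxu : x = u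
      · subst hxu; omega
      · by_cases hxw : x = w
        · subst hxw; omega
        · rw [deg_edge_eq_zero hxu hxw] at h3
          have := h2 x
          omega
    · intro x hx
      simp only [SimpleGraph.Walk.support_cons, List.mem_cons, not_or] at hx
      have h3 := deg_sup_le P (SimpleGraph.edge u w) x
      have hxw : x ≠ w := fun e => hx.2 (e ▸ q.start_mem_support)
      rw [deg_edge_eq_zero hx.1 hxw, h0 x hx.2] at h3
      omega
    · intro x hx
      simp only [SimpleGraph.Walk.support_cons, List.mem_cons] at hx
      rcases hx with rfl | hx
      · exact SimpleGraph.Reachable.refl _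
      · exact ((hs x hx).mono hle).trans huw.symm
end Degrees

/-! ### Small hitting sets for dense families -/

section Hitting

open Classical in
/-- A family of dense sets has a small set meeting all but few of its members. -/
theorem exists_almost_hittingSet {V : Type*} [Fintype V] [Nonempty V] (θ : ℝ) (hθ1 : θ ≤ 1)
    (h : ℕ) (𝓕 : Finset (Finset V)) (h𝓕 : ∀ A ∈ 𝓕, θ * Fintype.card V ≤ A.card) :
    ∃ H : Finset V, H.card ≤ h ∧
      ((𝓕.filter (fun A => Disjoint A H)).card : ℝ) ≤ (1 - θ) ^ h * 𝓕.card := by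
  induction h with
  | zero => exact ⟨∅, by simp, by simp⟩
  | succ h ih =>
    obtain ⟨H, hH, hle⟩ := ih
    set 𝓖 := 𝓕.filter (fun A => Disjoint A H) with h𝓖
    have hcount : ∑ v : V, ((𝓖.filter (fun A => v ∈ A)).card : ℝ) = ∑ A ∈ 𝓖, (A.card : ℝ) := by
      norm_cast
      have := Finset.sum_card_bipartiteAbove_eq_sum_card_bipartiteBelow
        (s := (Finset.univ : Finset V)) (t := 𝓖) (fun v A => v ∈ A)
      simpa [Finset.bipartiteAbove, Finset.bipartiteBelow] using this
    have hsum : ∑ v : V, θ * (𝓖.card : ℝ) ≤ ∑ v : V, ((𝓖.filter (fun A => v ∈ A)).card : ℝ) := by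
      rw [hcount, Finset.sum_const, nsmul_eq_mul, Finset.card_univ]
      calc (Fintype.card V : ℝ) * (θ * 𝓖.card) = 𝓖.card • (θ * Fintype.card V) := by
            rw [nsmul_eq_mul]; ring
        _ ≤ _ := Finset.card_nsmul_le_sum _ _ _
            (fun A hA => h𝓕 A (Finset.mem_filter.1 hA).1)
    -- By averaging, some vertex lies in a proportion at least `θ` of the sets not yet hit.
    obtain ⟨v, -, hv⟩ := Finset.exists_le_of_sum_le Finset.univ_nonempty hsum
    refine ⟨insert v H, (Finset.card_insert_le _ _).trans (by omega), ?_⟩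
    have h1 : 𝓕.filter (fun A => Disjoint A (insert v H)) = 𝓖.filter (fun A => v ∉ A) := by
      ext A
      simp only [h𝓖, Finset.mem_filter, Finset.disjoint_insert_right]
      tauto
    have h2 := Finset.card_filter_add_card_filter_not (s := 𝓖) (fun A => v ∈ A)
    have h3 : ((𝓖.filter (fun A => v ∈ A)).card : ℝ) + (𝓖.filter (fun A => v ∉ A)).card =
        𝓖.card := by exact_mod_cast h2
    rw [h1, pow_succ]
    calc ((𝓖.filter (fun A => v ∉ A)).card : ℝ) ≤ (1 - θ) * 𝓖.card := by linarith
      _ ≤ (1 - θ) * ((1 - θ) ^ h * 𝓕.card) := mul_le_mul_of_nonneg_left hle (by linarith)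
      _ = _ := by ring

open Classical in
/-- A family of dense sets has many disjoint small hitting sets, outside a given small set. -/
theorem exists_disjoint_hittingSets {V : Type*} [Fintype V] [Nonempty V] (θ : ℝ) (hθ1 : θ ≤ 1)
    (h M : ℕ) (𝓕 : Finset (Finset V)) (h𝓕 : ∀ A ∈ 𝓕, 2 * θ * Fintype.card V ≤ A.card)
    (hsmall : (1 - θ) ^ h * 𝓕.card < 1) (X : Finset V)
    (hX : (X.card : ℝ) + M * h ≤ θ * Fintype.card V) :
    ∃ H : ℕ → Finset V, (∀ i < M, (H i).card ≤ h) ∧ (∀ i < M, Disjoint (H i) X) ∧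
      (∀ i < M, ∀ j < M, i ≠ j → Disjoint (H i) (H j)) ∧
      ∀ i < M, ∀ A ∈ 𝓕, ∃ v ∈ A, v ∈ H i := by
  induction M with
  | zero => exact ⟨fun _ => ∅, by simp, by simp, by simp, by simp⟩
  | succ M ih =>
    have hh : (0 : ℝ) ≤ h := Nat.cast_nonneg _
    push_cast at hX
    obtain ⟨H, hc, hd, hdd, hh⟩ := ih (by linarith)
    set Y := X ∪ (Finset.range M).biUnion H with hY
    have hYc : (Y.card : ℝ) ≤ θ * Fintype.card V := by
      have h1 : ((Finset.range M).biUnion H).card ≤ M * h := by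
        refine Finset.card_biUnion_le.trans ?_
        calc ∑ i ∈ Finset.range M, (H i).card ≤ ∑ i ∈ Finset.range M, h :=
              Finset.sum_le_sum (fun i hi => hc i (Finset.mem_range.1 hi))
          _ = M * h := by simp
      have h2 : Y.card ≤ X.card + M * h := (Finset.card_union_le _ _).trans (by omega)
      have h3 : (Y.card : ℝ) ≤ X.card + M * h := by exact_mod_cast h2
      linarith
    -- Density `2 * θ` is assumed so that density `θ` remains after removing `Y`, the forbidden set
    -- and the hitting sets already chosen.
    obtain ⟨K, hK, hKle⟩ := exists_almost_hittingSet θ hθ1 h (𝓕.image (fun A => A \ Y)) (by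
      intro A hA
      rw [Finset.mem_image] at hA
      obtain ⟨B, hB, rfl⟩ := hA
      have h1 := h𝓕 B hB
      have h2 : (B.card : ℝ) ≤ (B \ Y).card + Y.card := by
        exact_mod_cast Finset.card_le_card_sdiff_add_card
      linarith)
    have hK0 : (((𝓕.image (fun A => A \ Y)).filter (fun A => Disjoint A K)).card : ℝ) < 1 := by
      refine hKle.trans_lt (lt_of_le_of_lt ?_ hsmall)
      apply mul_le_mul_of_nonneg_left _ (pow_nonneg (by linarith) _)
      exact_mod_cast Finset.card_image_le
    have hK1 : ∀ A ∈ 𝓕, ∃ v ∈ A, v ∈ K \ Y := by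
      intro A hA
      by_contra! hcon
      have h1 : A \ Y ∈ (𝓕.image (fun A => A \ Y)).filter (fun A => Disjoint A K) := by
        rw [Finset.mem_filter]
        refine ⟨Finset.mem_image_of_mem _ hA, ?_⟩
        rw [Finset.disjoint_left]
        intro v hv hvK
        rw [Finset.mem_sdiff] at hv
        exact hcon v hv.1 (Finset.mem_sdiff.2 ⟨hvK, hv.2⟩)
      have h2 : 1 ≤ ((𝓕.image (fun A => A \ Y)).filter (fun A => Disjoint A K)).card :=
        Finset.card_pos.2 ⟨_, h1⟩
      have h3 : (1 : ℝ) ≤ ((𝓕.image (fun A => A \ Y)).filter (fun A => Disjoint A K)).card := by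
        exact_mod_cast h2
      linarith
    have hKY : ∀ i < M, Disjoint (K \ Y) (H i) := by
      intro i hi
      rw [Finset.disjoint_left]
      intro v hv hvH
      rw [Finset.mem_sdiff] at hv
      exact hv.2 (Finset.mem_union_right _ (Finset.mem_biUnion.2 ⟨i, Finset.mem_range.2 hi, hvH⟩))
    refine ⟨Function.update H M (K \ Y), ?_, ?_, ?_, ?_⟩
    · intro i hi
      by_cases hiM : i = M
      · subst hiM
        simpa using (Finset.card_le_card Finset.sdiff_subset).trans hK
      · rw [Function.update_of_ne hiM]; exact hc i (by omega)
    · intro i hi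
      by_cases hiM : i = M
      · subst hiM
        simp only [Function.update_self]
        exact Finset.disjoint_of_subset_right Finset.subset_union_left Finset.sdiff_disjoint
      · rw [Function.update_of_ne hiM]; exact hd i (by omega)
    · intro i hi j hj hij
      by_cases hiM : i = M
      · subst hiM
        rw [Function.update_self, Function.update_of_ne hij.symm]
        exact hKY j (by omega)
      · rw [Function.update_of_ne hiM]
        by_cases hjM : j = M
        · subst hjM
          rw [Function.update_self]
          exact (hKY i (by omega)).symm
        · rw [Function.update_of_ne hjM]
          exact hdd i (by omega) j (by omega) hij
    · intro i hi
      by_cases hiM : i = M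
      · subst hiM
        rw [Function.update_self]; exact hK1
      · rw [Function.update_of_ne hiM]; exact hh i (by omega)
end Hitting

/-! ### Robust connection through hitting sets -/

section Robust
open Classical in
/-- `robust G θ j`: adjacency, closed off `j` times under having at least `θ` common neighbours. -/
def robust {V : Type*} [Fintype V] (G : SimpleGraph V) (θ : ℝ) : ℕ → V → V → Prop
  | 0 => G.Adj
  | j + 1 => fun u v => robust G θ j u v ∨
      θ ≤ (Finset.univ.filter (fun p => robust G θ j u p ∧ robust G θ j p v)).card

variable {V : Type*} [Fintype V] (G : SimpleGraph V) (θ : ℝ)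

theorem robust_symm (j : ℕ) (u v : V) (h : robust G θ j u v) : robust G θ j v u := by
  classical
  induction j generalizing u v with
  | zero => exact SimpleGraph.Adj.symm h
  | succ j ih =>
    rcases h with h | h
    · exact Or.inl (ih _ _ h)
    · right
      refine h.trans ?_
      norm_cast
      apply Finset.card_le_card
      intro p hp
      simp only [Finset.mem_filter, Finset.mem_univ, true_and] at hp ⊢
      exact ⟨ih _ _ hp.2, ih _ _ hp.1⟩

open Classical in
/-- The dense common neighbourhoods that witness robust relations up to level `J`. -/
noncomputable def denseFamily (J : ℕ) : Finset (Finset V) :=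
  ((Finset.range J ×ˢ (Finset.univ : Finset (V × V))).image (fun x =>
    Finset.univ.filter (fun p => robust G θ x.1 x.2.1 p ∧ robust G θ x.1 p x.2.2))).filter
      (fun A => θ ≤ A.card)

theorem card_denseFamily_le (J : ℕ) :
    (denseFamily G θ J).card ≤ J * Fintype.card V ^ 2 := by
  classical
  refine (Finset.card_filter_le _ _).trans (Finset.card_image_le.trans ?_)
  rw [Finset.card_product, Finset.card_range, Finset.card_univ, Fintype.card_prod, sq]

/-- Unfolding the recursion, each use of a large common neighbourhood is replaced by a point of `H`
in it. That neighbourhood is in the dense family, so one and the same `H` serves all pairs. -/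
theorem exists_walk_of_robust (J : ℕ) (H : Finset V)
    (hH : ∀ A ∈ denseFamily G θ J, ∃ v ∈ A, v ∈ H) (j : ℕ) (hj : j ≤ J) (u v : V)
    (h : robust G θ j u v) : ∃ p : G.Walk u v, ∀ x ∈ p.support, x = u ∨ x = v ∨ x ∈ H := by
  classical
  induction j generalizing u v with
  | zero =>
    have h' : G.Adj u v := h
    refine ⟨SimpleGraph.Walk.cons h' SimpleGraph.Walk.nil, ?_⟩
    intro x hx
    simp only [SimpleGraph.Walk.support_cons,
      SimpleGraph.Walk.support_nil, List.mem_cons, List.not_mem_nil, or_false] at hx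
    tauto
  | succ j ih =>
    rcases h with h | h
    · exact ih (by omega) u v h
    · obtain ⟨p, hp, hpH⟩ := hH (Finset.univ.filter
        (fun p => robust G θ j u p ∧ robust G θ j p v)) (by
          rw [denseFamily, Finset.mem_filter]
          refine ⟨Finset.mem_image.2 ⟨(j, u, v), ?_, rfl⟩, h⟩
          simp only [Finset.mem_product, Finset.mem_range, Finset.mem_univ, and_true]
          omega)
      simp only [Finset.mem_filter, Finset.mem_univ, true_and] at hp
      obtain ⟨q1, h1⟩ := ih (by omega) u p hp.1
      obtain ⟨q2, h2⟩ := ih (by omega) p v hp.2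
      refine ⟨q1.append q2, ?_⟩
      intro x hx
      rw [SimpleGraph.Walk.mem_support_append_iff] at hx
      rcases hx with hx | hx
      · rcases h1 x hx with h | h | h
        · exact Or.inl h
        · exact Or.inr (Or.inr (h ▸ hpH))
        · exact Or.inr (Or.inr h)
      · rcases h2 x hx with h | h | h
        · exact Or.inr (Or.inr (h ▸ hpH))
        · exact Or.inr (Or.inl h)
        · exact Or.inr (Or.inr h)

/-- Robustly related vertices are joined by a path through any hitting set. -/
theorem exists_linkGraph (J : ℕ) (H : Finset V)
    (hH : ∀ A ∈ denseFamily G θ J, ∃ v ∈ A, v ∈ H) (u v : V)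
    (h : robust G θ J u v) :
    ∃ P : SimpleGraph V, P ≤ G ∧ P.Reachable u v ∧ deg P u ≤ 1 ∧ deg P v ≤ 1 ∧
      (∀ x, deg P x ≤ 2) ∧ (∀ x, x ≠ u → x ≠ v → x ∉ H → deg P x = 0) ∧
      (∀ x, deg P x ≠ 0 → P.Reachable x u) := by
  classical
  obtain ⟨p, hp⟩ := exists_walk_of_robust G θ J H hH J le_rfl u v h
  obtain ⟨P, hPG, hr, hu, hv, h2, h0, hs⟩ := exists_pathGraph p.bypass p.bypass_isPath
  refine ⟨P, hPG, hr, hu, hv, h2, ?_, ?_⟩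
  · intro x hxu hxv hxH
    apply h0
    intro hx
    have := hp x (p.support_bypass_subset_support hx)
    tauto
  · intro x hx
    apply hs
    by_contra hcon
    exact hx (h0 x hcon)
end Robust

/-! ### Clusters of a dense regular graph -/

section GraphClusters
-- Double counting over `k + 2` vertices of `D`: if a vertex `w` is adjacent to x of them, then x ≤
-- x(x - 1) + 1. Summing over `w` gives (k+2) r ≤ (k+2)(k+1) θ + n, which contradicts n ≤ (k+1) r
-- when θ is this small.
open Classical in
theorem card_le_of_few_common {V : Type*} [Fintype V] (G : SimpleGraph V) (k r : ℕ) (θ : ℝ)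
    (hreg : ∀ v, (Finset.univ.filter (fun u => G.Adj v u)).card = r)
    (hn : Fintype.card V ≤ (k + 1) * r) (hθ : ((k : ℝ) + 2) * (k + 1) * θ < r)
    (D : Finset V) (hD : ∀ u ∈ D, ∀ v ∈ D, u ≠ v →
      ((Finset.univ.filter (fun w => G.Adj u w ∧ G.Adj w v)).card : ℝ) ≤ θ) :
    D.card ≤ k + 1 := by
  by_contra! hcon
  obtain ⟨E, hED, hEc⟩ := Finset.exists_subset_card_eq (show k + 2 ≤ D.card by omega)
  let x : V → ℕ := fun w => (E.filter (fun d => G.Adj d w)).card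
  have h1 : ∑ w, x w = (k + 2) * r := by
    have := Finset.sum_card_bipartiteAbove_eq_sum_card_bipartiteBelow
        (s := E) (t := (Finset.univ : Finset V)) (fun d w => G.Adj d w)
    simp only [Finset.bipartiteAbove, Finset.bipartiteBelow] at this
    calc ∑ w, x w = ∑ d ∈ E, (Finset.univ.filter (fun w => G.Adj d w)).card := this.symm
      _ = ∑ d ∈ E, r := Finset.sum_congr rfl (fun d _ => hreg d)
      _ = _ := by simp [hEc]
  have h2 : ∑ w, x w * (x w - 1) =
      ∑ e ∈ E.offDiag, (Finset.univ.filter (fun w => G.Adj e.1 w ∧ G.Adj w e.2)).card := by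
    have := Finset.sum_card_bipartiteAbove_eq_sum_card_bipartiteBelow
        (s := E.offDiag) (t := (Finset.univ : Finset V))
          (fun e w => G.Adj e.1 w ∧ G.Adj w e.2)
    simp only [Finset.bipartiteAbove, Finset.bipartiteBelow] at this
    rw [this]
    apply Finset.sum_congr rfl
    intro w _
    have h3 : E.offDiag.filter (fun e => G.Adj e.1 w ∧ G.Adj w e.2) =
        (E.filter (fun d => G.Adj d w)).offDiag := by
      ext e
      simp only [Finset.mem_filter, Finset.mem_offDiag, G.adj_comm w]
      tauto
    rw [h3, Finset.offDiag_card, Nat.mul_sub, mul_one]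
  have h3 : (∑ e ∈ E.offDiag,
      ((Finset.univ.filter (fun w => G.Adj e.1 w ∧ G.Adj w e.2)).card : ℝ)) ≤
      E.offDiag.card • θ := by
    apply Finset.sum_le_card_nsmul
    intro e he
    rw [Finset.mem_offDiag] at he
    exact hD _ (hED he.1) _ (hED he.2.1) he.2.2
  have h4 : E.offDiag.card = (k + 2) * (k + 1) := by
    rw [Finset.offDiag_card, hEc, ← Nat.mul_sub_one]; rfl
  have h5 : ∑ w, x w ≤ ∑ w, x w * (x w - 1) + Fintype.card V := by
    have : Fintype.card V = ∑ w : V, 1 := by simp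
    rw [this, ← Finset.sum_add_distrib]
    apply Finset.sum_le_sum
    intro w _
    rcases x w with _ | _ | m
    · simp
    · simp
    · simp only [Nat.add_sub_cancel]; nlinarith
  rw [h1, h2] at h5
  have h6 : (((k + 2) * r : ℕ) : ℝ) ≤ (∑ e ∈ E.offDiag,
      ((Finset.univ.filter (fun w => G.Adj e.1 w ∧ G.Adj w e.2)).card : ℝ)) +
      Fintype.card V := by exact_mod_cast h5
  have h7 : (Fintype.card V : ℝ) ≤ ((k : ℝ) + 1) * r := by exact_mod_cast hn
  rw [h4, nsmul_eq_mul] at h3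
  push_cast at h3 h6
  linarith

-- The ladder starts at level 1 of `robust`, since adjacency is not reflexive whereas a vertex has r
-- ≥ θ common neighbours with itself. Independent sets at level 1 have at most k + 1 elements by the
-- previous count.
open Classical in
theorem exists_graph_clusters {V : Type*} [Fintype V] (G : SimpleGraph V) (k r : ℕ)
    (hr : 0 < r) (hreg : ∀ v, (Finset.univ.filter (fun u => G.Adj v u)).card = r)
    (hn : Fintype.card V ≤ (k + 1) * r) :
    ∃ cl : V → V, (∀ u v, cl u = cl v →
        robust G ((r : ℝ) / (2 * (k + 2) ^ 2)) (2 * (k + 1) + 4) u v) ∧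
      (Finset.univ.image cl).card ≤ k + 1 ∧
      ∀ v, (r : ℝ) / (2 * (k + 1)) ≤ (Finset.univ.filter (fun u => cl u = cl v)).card := by
  set θ : ℝ := (r : ℝ) / (2 * (k + 2) ^ 2) with hθdef
  have hr' : (0 : ℝ) < r := by exact_mod_cast hr
  have hk : (0 : ℝ) ≤ k := Nat.cast_nonneg k
  have hθ : 0 < θ := by positivity
  have hθr : 2 * ((k : ℝ) + 2) ^ 2 * θ = r := by rw [hθdef]; field_simp
  have hle : θ ≤ r := by nlinarith [sq_nonneg (k : ℝ)]
  obtain ⟨cl, h1, h2, h3⟩ := exists_clusters (fun j => robust G θ (j + 1))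
    (fun j u v h => robust_symm G θ _ u v h)
    (fun v => Or.inr (by
      have : Finset.univ.filter (fun p => robust G θ 0 v p ∧ robust G θ 0 p v) =
          Finset.univ.filter (fun u => G.Adj v u) := by
        ext p
        rw [Finset.mem_filter, Finset.mem_filter]
        exact ⟨fun h => ⟨h.1, h.2.1⟩, fun h => ⟨h.1, h.2, G.adj_symm h.2⟩⟩
      rw [this, hreg]
      exact hle))
    (fun j u v h => Or.inl h) (k + 1) (Nat.succ_pos k) θ r
    (fun D hD => card_le_of_few_common G k r θ hreg hn (by nlinarith) D
      (fun u hu v hv huv => by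
        have := hD u hu v hv huv
        by_contra! hcon
        exact this (Or.inr hcon.le)))
    (fun v => by
      rw [← hreg v]
      norm_cast
      apply Finset.card_le_card
      intro u hu
      simp only [Finset.mem_filter, Finset.mem_univ, true_and] at hu ⊢
      exact Or.inl hu)
    (fun j u v h => Or.inr h)
    (by push_cast; nlinarith) hθ
  refine ⟨cl, fun u v h => ?_, h2, fun v => ?_⟩
  · exact h1 u v h
  · have := h3 v
    push_cast at this
    exact this
end GraphClusters

/-! ### Edges of G connecting the clusters -/

section ClusterEdges
variable {V : Type*}

/-- The graph joining vertices of the same cluster. -/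
def clusterGraph (cl : V → V) : SimpleGraph V where
  Adj u v := u ≠ v ∧ cl u = cl v
  symm := ⟨fun _ _ h => ⟨h.1.symm, h.2.symm⟩⟩
  loopless := ⟨fun _ h => h.1 rfl⟩

theorem clusterGraph_reachable {cl : V → V} {u v : V} (h : cl u = cl v) :
    (clusterGraph cl).Reachable u v := by
  by_cases huv : u = v
  · rw [huv]
  · exact SimpleGraph.Adj.reachable ⟨huv, h⟩

open Classical in
/-- A set of fewer edges than clusters suffices to connect the clusters. -/
theorem exists_cluster_edges [Fintype V] (G : SimpleGraph V) (hG : G.Connected) (cl : V → V) :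
    ∃ E : Finset (Sym2 V), (∀ e ∈ E, e ∈ G.edgeSet) ∧
      E.card + 1 ≤ (Finset.univ.image cl).card ∧
      (clusterGraph cl ⊔ SimpleGraph.fromEdgeSet (E : Set (Sym2 V))).Preconnected := by
  let ι := Set.range cl
  let f : V → ι := fun v => ⟨cl v, v, rfl⟩
  -- The quotient of `G` by the clusters is connected; each edge of a spanning tree of it is lifted
  -- to one edge of `G`.
  let Q : SimpleGraph ι :=
    { Adj := fun i j => i ≠ j ∧ ∃ u v, f u = i ∧ f v = j ∧ G.Adj u v
      symm := ⟨fun i j ⟨h, u, v, hu, hv, huv⟩ => ⟨h.symm, v, u, hv, hu, huv.symm⟩⟩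
      loopless := ⟨fun _ h => h.1 rfl⟩ }
  have hf : Function.Surjective f := by
    rintro ⟨_, v, rfl⟩
    exact ⟨v, rfl⟩
  have hstep : ∀ u v, G.Reachable u v → Q.Reachable (f u) (f v) := by
    rintro u v ⟨p⟩
    induction p with
    | nil => rfl
    | @cons u w v h q ih =>
      by_cases huw : f u = f w
      · rw [huw]; exact ih
      · exact (SimpleGraph.Adj.reachable (show Q.Adj _ _ from ⟨huw, u, w, rfl, rfl, h⟩)).trans ih
  have hQ : Q.Connected := by
    obtain ⟨v0⟩ := hG.nonempty
    have : Nonempty ι := ⟨f v0⟩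
    refine ⟨fun i j => ?_⟩
    obtain ⟨u, rfl⟩ := hf i
    obtain ⟨v, rfl⟩ := hf j
    exact hstep u v (hG.preconnected u v)
  obtain ⟨T, hTQ, hT⟩ := hQ.exists_isTree_le
  have hrep : ∀ e : Sym2 ι, e ∈ T.edgeSet → ∃ e' : Sym2 V, e' ∈ G.edgeSet ∧ e'.map f = e := by
    intro e
    induction e with
    | _ i j =>
      intro he
      obtain ⟨-, u, v, hu, hv, huv⟩ := hTQ he
      exact ⟨s(u, v), huv, by rw [Sym2.map_mk, hu, hv]⟩
  have hrep' : ∃ rep : Sym2 ι → Sym2 V, ∀ e ∈ T.edgeSet,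
      rep e ∈ G.edgeSet ∧ (rep e).map f = e := by
    obtain ⟨v0⟩ := hG.nonempty
    refine ⟨fun e => if h : e ∈ T.edgeSet then (hrep e h).choose else s(v0, v0), ?_⟩
    intro e he
    simp only [dif_pos he]
    exact (hrep e he).choose_spec
  obtain ⟨rep, hrep'⟩ := hrep'
  have hrepG := fun e he => (hrep' e he).1
  have hrepf := fun e he => (hrep' e he).2
  refine ⟨T.edgeFinset.image rep, ?_, ?_, ?_⟩
  · intro e he
    rw [Finset.mem_image] at he
    obtain ⟨e', he', rfl⟩ := he
    exact hrepG e' (SimpleGraph.mem_edgeFinset.1 he')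
  · have h1 := hT.card_edgeFinset
    have h2 : Fintype.card ι = (Finset.univ.image cl).card := by
      rw [← Set.toFinset_card, Set.toFinset_range]
    have h3 : (T.edgeFinset.image rep).card ≤ T.edgeFinset.card := Finset.card_image_le
    omega
  · set K := clusterGraph cl ⊔
      SimpleGraph.fromEdgeSet ((T.edgeFinset.image rep : Finset _) : Set (Sym2 V)) with hK
    have hcl : ∀ u v, f u = f v → K.Reachable u v := fun u v h =>
      (clusterGraph_reachable (congrArg Subtype.val h)).mono le_sup_left
    have hT' : ∀ i j, T.Reachable i j → ∀ u v, f u = i → f v = j → K.Reachable u v := by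
      rintro i j ⟨p⟩
      induction p with
      | nil => exact fun u v hu hv => hcl u v (hu.trans hv.symm)
      | @cons i l j h q ih =>
        intro u v hu hv
        have hmem : s(i, l) ∈ T.edgeSet := h
        have h1 := hrepf _ hmem
        have h2 := hrepG _ hmem
        have h3 : rep s(i, l) ∈ T.edgeFinset.image rep :=
          Finset.mem_image_of_mem _ (SimpleGraph.mem_edgeFinset.2 hmem)
        generalize rep s(i, l) = e at h1 h2 h3
        induction e with
        | _ a b =>
          have hadj : K.Adj a b := by
            right
            rw [SimpleGraph.fromEdgeSet_adj]
            exact ⟨h3, SimpleGraph.Adj.ne h2⟩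
          rw [Sym2.map_mk, Sym2.eq_iff] at h1
          rcases h1 with ⟨ha, hb⟩ | ⟨ha, hb⟩
          · exact (hcl u a (hu.trans ha.symm)).trans (hadj.reachable.trans (ih b v hb hv))
          · exact (hcl u b (hu.trans hb.symm)).trans (hadj.symm.reachable.trans (ih a v ha hv))
    exact fun u v => hT' _ _ (hT.connected.preconnected (f u) (f v)) u v rfl rfl

end ClusterEdges

/-! ### Connecting the clusters with small degrees -/

section ClusterLinks
variable {V : Type*}

open Classical in
theorem deg_fromEdgeSet_le [Fintype V] (E : Finset (Sym2 V)) (v : V) :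
    deg (SimpleGraph.fromEdgeSet (E : Set (Sym2 V))) v ≤ (E.filter (fun e => v ∈ e)).card := by
  have h : (SimpleGraph.fromEdgeSet (E : Set (Sym2 V))).neighborSet v =
      ((Finset.univ.filter (fun w => s(v, w) ∈ E ∧ v ≠ w) : Finset V) : Set V) := by
    ext w; simp
  rw [deg, h, Set.ncard_coe_finset]
  refine Finset.card_le_card_of_injOn (fun w => s(v, w)) ?_ ?_
  · intro w hw
    simp at hw
    simp [hw.1]
  · exact fun a _ b _ hab => Sym2.congr_right.1 hab

/-- The star with centre `x` and leaves `A`. -/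
def starGraph (x : V) (A : Finset V) : SimpleGraph V where
  Adj u v := u ≠ v ∧ ((u = x ∧ v ∈ A) ∨ (v = x ∧ u ∈ A))
  symm := ⟨fun _ _ h => ⟨h.1.symm, h.2.symm⟩⟩
  loopless := ⟨fun _ h => h.1 rfl⟩

theorem deg_starGraph_center [Finite V] (x : V) (A : Finset V) :
    deg (starGraph x A) x ≤ A.card := by
  rw [deg, ← Set.ncard_coe_finset]
  apply Set.ncard_le_ncard _ (Set.toFinite _)
  rintro v ⟨h, h' | h'⟩
  · exact h'.2
  · exact absurd h'.1.symm h

theorem deg_starGraph_of_ne [Finite V] {x v : V} (A : Finset V) (h : v ≠ x) :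
    deg (starGraph x A) v ≤ 1 := by
  rw [deg, Set.ncard_le_one (Set.toFinite _)]
  rintro a ⟨_, ha⟩ b ⟨_, hb⟩
  grind

open Classical in
/-- When all edges between clusters share a vertex there are at most `k` clusters. -/
theorem exists_edge_avoiding [Fintype V] (G : SimpleGraph V) (k r : ℕ)
    (hreg : ∀ v, (Finset.univ.filter (fun u => G.Adj v u)).card = r)
    (hn : Fintype.card V ≤ (k + 1) * r) (cl : V → V)
    (hcl : (Finset.univ.image cl).card = k + 1)
    (hsize : ∀ v, ∃ u, u ≠ v ∧ cl u = cl v) (x : V) :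
    ∃ y z, G.Adj y z ∧ cl y ≠ cl z ∧ y ≠ x ∧ z ≠ x := by
  by_contra! hcon
  have hcl' : ∀ y z, G.Adj y z → y ≠ x → z ≠ x → cl y = cl z := by
    intro y z h hy hz
    by_contra hne
    exact hz (hcon y z h hne hy)
  let S : V → Finset V := fun j => Finset.univ.filter (fun u => cl u = j)
  have hsub : ∀ u, u ≠ x → insert u ((Finset.univ.filter (fun w => G.Adj u w)).erase x) ⊆
      S (cl u) := by
    intro u hu w hw
    simp only [Finset.mem_insert, Finset.mem_erase, Finset.mem_filter, Finset.mem_univ,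
      true_and] at hw
    simp only [S, Finset.mem_filter, Finset.mem_univ, true_and]
    rcases hw with rfl | ⟨hw, h⟩
    · rfl
    · exact (hcl' u w h hu hw).symm
  -- If no crossing edge avoids `x`, a vertex `u ≠ x` of a cluster has its whole neighbourhood,
  -- except perhaps `x`, in that cluster. So every cluster has at least `r` vertices, and that of
  -- `x` one more: over `k + 1` clusters this exceeds `(k + 1) * r`.
  have hge : ∀ j ∈ Finset.univ.image cl, r + (if j = cl x then 1 else 0) ≤ (S j).card := by
    intro j hj
    obtain ⟨v, -, rfl⟩ := Finset.mem_image.1 hj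
    obtain ⟨u, hu, huv⟩ : ∃ u, u ≠ x ∧ cl u = cl v := by
      by_cases h : v = x
      · subst h; exact hsize v
      · exact ⟨v, h, rfl⟩
    rw [← huv]
    have hns : u ∉ (Finset.univ.filter (fun w => G.Adj u w)).erase x := by simp
    split_ifs with h
    · have h1 : insert u (Finset.univ.filter (fun w => G.Adj u w)) ⊆ S (cl u) := by
        intro w hw
        by_cases hwx : w = x
        · subst hwx; simp [S, h]
        · apply hsub u hu
          rw [Finset.mem_insert] at hw ⊢
          rw [Finset.mem_erase]
          tauto
      have h2 := Finset.card_le_card h1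
      rwa [Finset.card_insert_of_notMem (by simp), hreg] at h2
    · have h2 := Finset.card_le_card (hsub u hu)
      rw [Finset.card_insert_of_notMem hns] at h2
      have h3 := Finset.pred_card_le_card_erase (s := Finset.univ.filter (fun w => G.Adj u w))
        (a := x)
      rw [hreg] at h3
      omega
  have hsum : ∑ j ∈ Finset.univ.image cl, (S j).card = Fintype.card V := by
    have := Finset.card_eq_sum_card_image cl (Finset.univ : Finset V)
    rw [Finset.card_univ] at this
    exact this.symm
  have h1 := Finset.sum_le_sum hge
  rw [hsum, Finset.sum_add_distrib, Finset.sum_const, hcl,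
    Finset.sum_ite_eq' (Finset.univ.image cl) (cl x), if_pos (by simp), smul_eq_mul] at h1
  omega

open Classical in
/-- The clusters can be connected by few edges of `G` with small maximum degree. -/
theorem exists_cluster_links [Fintype V] (G : SimpleGraph V) (hG : G.Connected) (k r : ℕ)
    (hk : 3 ≤ k) (hreg : ∀ v, (Finset.univ.filter (fun u => G.Adj v u)).card = r)
    (hn : Fintype.card V ≤ (k + 1) * r) (cl : V → V)
    (hcl : (Finset.univ.image cl).card ≤ k + 1)
    (hsize : ∀ v, ∃ u, u ≠ v ∧ cl u = cl v) :
    ∃ L : SimpleGraph V, L ≤ G ∧ (∀ v, deg L v + 1 ≤ k) ∧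
      (clusterGraph cl ⊔ L).Preconnected ∧
      ∃ S : Finset V, S.card ≤ 2 * k ∧ ∀ v, v ∉ S → deg L v = 0 := by
  obtain ⟨E, hEG, hEc, hE⟩ := exists_cluster_edges G hG cl
  by_cases hbad : ∀ v, deg (SimpleGraph.fromEdgeSet (E : Set (Sym2 V))) v + 1 ≤ k
  · refine ⟨_, ?_, hbad, hE, E.biUnion (fun e => Finset.univ.filter (fun v => v ∈ e)), ?_, ?_⟩
    · intro u v h
      rw [SimpleGraph.fromEdgeSet_adj] at h
      exact hEG _ h.1
    · refine Finset.card_biUnion_le.trans ?_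
      calc ∑ e ∈ E, (Finset.univ.filter (fun v => v ∈ e)).card ≤ ∑ e ∈ E, 2 := by
            apply Finset.sum_le_sum
            intro e _
            induction e with
            | _ a b =>
              refine (Finset.card_le_card (t := {a, b}) ?_).trans Finset.card_le_two
              intro v hv
              simpa using hv
        _ ≤ _ := by simp; omega
    · intro v hv
      have h := deg_fromEdgeSet_le E v
      have h0 : E.filter (fun e => v ∈ e) = ∅ := by
        rw [Finset.filter_eq_empty_iff]
        intro e he hve
        apply hv
        rw [Finset.mem_biUnion]
        exact ⟨e, he, by simpa using hve⟩
      rw [h0] at h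
      simpa using h
  · push Not at hbad
    -- There are at most `k` edges, so a vertex `x` on `k` of them makes `E` a star at `x` with
    -- exactly `k + 1` clusters. One leaf of the star is dropped, and its cluster is attached by a
    -- crossing edge `y z` avoiding `x`. Then `x` has degree at most `k - 1`, and every other vertex
    -- at most `2 ≤ k - 1`.
    obtain ⟨x, hx⟩ := hbad
    have h1 := deg_fromEdgeSet_le E x
    have h2 : (E.filter (fun e => x ∈ e)).card ≤ E.card := Finset.card_filter_le _ _
    have hcl' : (Finset.univ.image cl).card = k + 1 := by omega
    have hall : ∀ e ∈ E, x ∈ e := by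
      have h3 : E.filter (fun e => x ∈ e) = E :=
        Finset.eq_of_subset_of_card_le (Finset.filter_subset _ _) (by omega)
      intro e he
      rw [← h3] at he
      exact (Finset.mem_filter.1 he).2
    have hleaf' : ∀ u, (clusterGraph cl ⊔ SimpleGraph.fromEdgeSet (E : Set (Sym2 V))).Reachable
        u x → cl u ≠ cl x → ∃ l, cl l = cl u ∧ G.Adj x l := by
      rintro u ⟨p⟩
      induction p with
      | nil => exact fun h => absurd rfl h
      | @cons u w v h q ih =>
        intro hne
        rcases h with h | h
        · obtain ⟨l, hl, hxl⟩ := ih hx h1 h2 hall (h.2 ▸ hne)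
          exact ⟨l, hl.trans h.2.symm, hxl⟩
        · rw [SimpleGraph.fromEdgeSet_adj] at h
          have h4 := hall _ h.1
          rw [Sym2.mem_iff] at h4
          rcases h4 with h4 | h4
          · exact absurd (congrArg cl h4.symm) hne
          · refine ⟨u, rfl, ?_⟩
            rw [h4]
            exact G.adj_symm (hEG _ h.1)
    have hleaf : ∀ j, ∃ l, j ∈ (Finset.univ.image cl).erase (cl x) → cl l = j ∧ G.Adj x l := by
      intro j
      by_cases hj : j ∈ (Finset.univ.image cl).erase (cl x)
      · rw [Finset.mem_erase, Finset.mem_image] at hj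
        obtain ⟨hne, u, -, rfl⟩ := hj
        obtain ⟨l, hl⟩ := hleaf' u (hE u x) hne
        exact ⟨l, fun _ => hl⟩
      · exact ⟨x, fun h => absurd h hj⟩
    choose l hl using hleaf
    obtain ⟨y, z, hyz, hclyz, hyx, hzx, hclz⟩ : ∃ y z, G.Adj y z ∧ cl y ≠ cl z ∧ y ≠ x ∧ z ≠ x ∧
        cl z ≠ cl x := by
      obtain ⟨y, z, h, hne, hy, hz⟩ := exists_edge_avoiding G k r hreg hn cl hcl' hsize x
      by_cases hclz : cl z = cl x
      · exact ⟨z, y, h.symm, hne.symm, hz, hy, fun h' => hne (h'.trans hclz.symm)⟩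
      · exact ⟨y, z, h, hne, hy, hz, hclz⟩
    set J := ((Finset.univ.image cl).erase (cl x)).erase (cl z) with hJ
    have hJc : J.card + 1 = k := by
      rw [hJ, Finset.card_erase_of_mem, Finset.card_erase_of_mem, hcl']
      · omega
      · simp
      · simp [hclz]
    set A := J.image l with hA
    have hAc : A.card + 1 ≤ k := by
      have : A.card ≤ J.card := Finset.card_image_le
      omega
    have hlx : ∀ j ∈ J, cl (l j) = j ∧ G.Adj x (l j) := fun j hj => hl j (Finset.mem_erase.1 hj).2
    refine ⟨starGraph x A ⊔ SimpleGraph.edge y z, sup_le ?_ ?_, ?_, ?_, A ∪ {x, y, z}, ?_, ?_⟩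
    · rintro u v ⟨-, ⟨rfl, hv⟩ | ⟨rfl, hv⟩⟩
      · obtain ⟨j, hj, rfl⟩ := Finset.mem_image.1 hv
        exact (hlx j hj).2
      · obtain ⟨j, hj, rfl⟩ := Finset.mem_image.1 hv
        exact (hlx j hj).2.symm
    · rw [SimpleGraph.edge_le_iff]; exact Or.inr hyz
    · intro v
      have h3 := deg_sup_le (starGraph x A) (SimpleGraph.edge y z) v
      by_cases hv : v = x
      · subst hv
        rw [deg_edge_eq_zero hyx.symm hzx.symm] at h3
        have := deg_starGraph_center v A
        omega
      · have := deg_starGraph_of_ne A hv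
        have := deg_edge_le_one y z v
        omega
    · set K := clusterGraph cl ⊔ (starGraph x A ⊔ SimpleGraph.edge y z) with hK
      have hc : ∀ u v, cl u = cl v → K.Reachable u v := fun u v h =>
        (clusterGraph_reachable h).mono le_sup_left
      have hmost : ∀ u, cl u ≠ cl z → K.Reachable u x := by
        intro u hu
        by_cases hux : cl u = cl x
        · exact hc u x hux
        · have hj : cl u ∈ J := by simp [hJ, hu, hux]
          refine (hc u (l (cl u)) (hlx _ hj).1.symm).trans (SimpleGraph.Adj.reachable ?_)
          refine Or.inr (Or.inl ⟨(hlx _ hj).2.ne.symm, Or.inr ⟨rfl, ?_⟩⟩)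
          exact Finset.mem_image_of_mem _ hj
      have hallr : ∀ u, K.Reachable u x := by
        intro u
        by_cases hu : cl u = cl z
        · refine (hc u z hu).trans (SimpleGraph.Reachable.trans (SimpleGraph.Adj.reachable ?_)
            (hmost y hclyz))
          refine Or.inr (Or.inr ?_)
          rw [SimpleGraph.edge_adj]
          exact ⟨Or.inr ⟨rfl, rfl⟩, hyz.ne.symm⟩
        · exact hmost u hu
      exact fun u v => (hallr u).trans (hallr v).symm
    · have h3 := Finset.card_union_le A {x, y, z}
      have h4 : ({x, y, z} : Finset V).card ≤ 3 := Finset.card_le_three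
      omega
    · intro v hv
      simp only [Finset.mem_union, Finset.mem_insert, Finset.mem_singleton, not_or] at hv
      have h3 := deg_sup_le (starGraph x A) (SimpleGraph.edge y z) v
      rw [deg_edge_eq_zero hv.2.2.1 hv.2.2.2] at h3
      have h4 : deg (starGraph x A) v = 0 := by
        apply deg_eq_zero_of
        rintro w ⟨-, h | h⟩
        · exact hv.2.1 h.1
        · exact hv.1 h.2
      omega
end ClusterLinks

/-! ### Merging components without exceeding the degree bound -/

section Merging
variable {V : Type*}

open Classical in
/-- The degree of a vertex, increased by one for the roots `Z`, which keep a free slot. -/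
noncomputable def load (F : SimpleGraph V) (Z : Finset V) (v : V) : ℕ :=
  deg F v + if v ∈ Z then 1 else 0

theorem deg_le_load (F : SimpleGraph V) (Z : Finset V) (v : V) : deg F v ≤ load F Z v :=
  Nat.le_add_right _ _

open Classical in
/-- Components with few vertices are merged greedily. -/
theorem exists_greedy_merge [Fintype V] (G : SimpleGraph V) (k a : ℕ) (Q : Finset V) (m : ℕ)
    (F : SimpleGraph V) (Z : Finset V) (hZ : Z.card ≤ m) (hFG : F ≤ G)
    (hload : ∀ v, load F Z v ≤ k) (hreach : ∀ v, ∃ z ∈ Z, F.Reachable v z) (hQZ : Q ⊆ Z)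
    (hQ : ∀ q ∈ Q, deg F q = 0)
    (havail : ∀ w, a + m ≤ (Finset.univ.filter
      (fun x => G.Adj w x ∧ x ∉ Q ∧ load F Z x + 1 ≤ k)).card) :
    ∃ (F' : SimpleGraph V) (Z' : Finset V), F ≤ F' ∧ F' ≤ G ∧ (∀ v, load F' Z' v ≤ k) ∧
      (∀ v, ∃ z ∈ Z', F'.Reachable v z) ∧ Q ⊆ Z' ∧ (∀ q ∈ Q, deg F' q = 0) ∧
      a * (Z' \ Q).card ≤ Fintype.card V ∧
      (∀ w, a ≤ (Finset.univ.filter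
        (fun x => G.Adj w x ∧ x ∉ Q ∧ load F' Z' x + 1 ≤ k)).card) ∧
      (F'.edgeSet \ F.edgeSet).ncard ≤ m := by
  induction m generalizing F Z with
  | zero =>
    have hZ0 : Z = ∅ := Finset.card_eq_zero.1 (Nat.le_zero.1 hZ)
    subst hZ0
    exact ⟨F, ∅, le_rfl, hFG, hload, hreach, hQZ, hQ, by simp, havail, by simp⟩
  | succ m ih =>
    -- A root spends its free slot on an edge to another component and stops being a root, so its
    -- load does not grow. Only the load of `w` grows, so each step makes at most one vertex
    -- unavailable; this is why `a + m` available neighbours are assumed.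
    by_cases h1 : ∃ ρ ∈ Z, ρ ∉ Q ∧ ∃ w, G.Adj ρ w ∧ w ∉ Q ∧ load F Z w + 1 ≤ k ∧
        ¬ F.Reachable w ρ
    · obtain ⟨ρ, hρZ, hρQ, w, hadj, hwQ, hwl, hwr⟩ := h1
      have hwρ : w ≠ ρ := hadj.ne.symm
      set F1 := F ⊔ SimpleGraph.edge ρ w with hF1
      set Z1 := Z.erase ρ with hZ1
      have hle : F ≤ F1 := le_sup_left
      have hadj1 : F1.Adj ρ w := by
        right; rw [SimpleGraph.edge_adj]; exact ⟨Or.inl ⟨rfl, rfl⟩, hwρ.symm⟩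
      have hother : ∀ v, v ≠ ρ → v ≠ w → deg F1 v ≤ deg F v := by
        intro v h h'
        have := deg_sup_le F (SimpleGraph.edge ρ w) v
        rwa [deg_edge_eq_zero h h', add_zero] at this
      have hone : ∀ v, deg F1 v ≤ deg F v + 1 := by
        intro v
        have h1 : deg F1 v ≤ _ := deg_sup_le F (SimpleGraph.edge ρ w) v
        have := deg_edge_le_one ρ w v
        omega
      have hload1 : ∀ v, v ≠ w → load F1 Z1 v ≤ load F Z v := by
        intro v hvw
        by_cases hvρ : v = ρ
        · subst hvρ
          have := hone v
          simp only [load, hZ1, Finset.mem_erase, ne_eq, not_true_eq_false, false_and, if_false,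
            hρZ, if_true]
          omega
        · have := hother v hvρ hvw
          simp only [load, hZ1, Finset.mem_erase, ne_eq, hvρ, not_false_eq_true, true_and]
          omega
      have hloadw : load F1 Z1 w ≤ load F Z w + 1 := by
        have := hone w
        simp only [load, hZ1, Finset.mem_erase, ne_eq, hwρ, not_false_eq_true, true_and]
        omega
      obtain ⟨F', Z', a1, a2, a3, a4, a5, a6, a7, a8, a9⟩ := ih F1 Z1
        (by rw [hZ1, Finset.card_erase_of_mem hρZ]; omega)
        (sup_le hFG (by rw [SimpleGraph.edge_le_iff]; exact Or.inr hadj))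
        (fun v => by
          by_cases hv : v = w
          · subst hv; omega
          · exact (hload1 v hv).trans (hload v))
        (fun v => by
          obtain ⟨z, hz, hvz⟩ := hreach v
          by_cases hzρ : z = ρ
          · subst hzρ
            obtain ⟨z', hz', hwz'⟩ := hreach w
            refine ⟨z', Finset.mem_erase.2 ⟨?_, hz'⟩,
              (hvz.mono hle).trans (hadj1.reachable.trans (hwz'.mono hle))⟩
            rintro rfl
            exact hwr hwz'
          · exact ⟨z, Finset.mem_erase.2 ⟨hzρ, hz⟩, hvz.mono hle⟩)
        (fun q hq => Finset.mem_erase.2 ⟨fun h => hρQ (h ▸ hq), hQZ hq⟩)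
        (fun q hq => by
          have := hother q (fun h => hρQ (h ▸ hq)) (fun h => hwQ (h ▸ hq))
          have := hQ q hq
          omega)
        (fun u => by
          have h2 : (Finset.univ.filter
              (fun x => G.Adj u x ∧ x ∉ Q ∧ load F Z x + 1 ≤ k)).erase w ⊆
              Finset.univ.filter (fun x => G.Adj u x ∧ x ∉ Q ∧ load F1 Z1 x + 1 ≤ k) := by
            intro x hx
            simp only [Finset.mem_erase, Finset.mem_filter, Finset.mem_univ, true_and] at hx ⊢
            have := hload1 x hx.1
            exact ⟨hx.2.1, hx.2.2.1, by omega⟩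
          have h3 := Finset.card_le_card h2
          have h4 := Finset.pred_card_le_card_erase (a := w) (s := Finset.univ.filter
              (fun x => G.Adj u x ∧ x ∉ Q ∧ load F Z x + 1 ≤ k))
          have h5 := havail u
          omega)
      refine ⟨F', Z', hle.trans a1, a2, a3, a4, a5, a6, a7, a8, ?_⟩
      have h2 : F'.edgeSet \ F.edgeSet ⊆ insert s(ρ, w) (F'.edgeSet \ F1.edgeSet) := by
        intro e he
        by_cases heρ : e = s(ρ, w)
        · exact Or.inl heρ
        · refine Or.inr ⟨he.1, ?_⟩
          intro h
          rw [hF1, SimpleGraph.edgeSet_sup] at h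
          rcases h with h | h
          · exact he.2 h
          · rw [SimpleGraph.edgeSet_edge_of_ne hwρ.symm] at h
            exact heρ h
      have h3 := Set.ncard_le_ncard h2 (Set.toFinite _)
      have h4 := Set.ncard_insert_le s(ρ, w) (F'.edgeSet \ F1.edgeSet)
      omega
    · by_cases h2 : ∃ ρ ∈ Z, ∃ ρ' ∈ Z, ρ' ∉ Q ∧ ρ ≠ ρ' ∧ F.Reachable ρ' ρ
      · obtain ⟨ρ, hρ, ρ', hρ', hρQ, hne, hr⟩ := h2
        have hl : ∀ v, load F (Z.erase ρ') v ≤ load F Z v := by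
          intro v
          simp only [load, Finset.mem_erase]
          split_ifs <;> simp_all
        obtain ⟨F', Z', a1, a2, a3, a4, a5, a6, a7, a8, a9⟩ := ih F (Z.erase ρ')
          (by rw [Finset.card_erase_of_mem hρ']; omega) hFG
          (fun v => (hl v).trans (hload v))
          (fun v => by
            obtain ⟨z, hz, hvz⟩ := hreach v
            by_cases hzρ : z = ρ'
            · subst hzρ
              exact ⟨ρ, Finset.mem_erase.2 ⟨hne, hρ⟩, hvz.trans hr⟩
            · exact ⟨z, Finset.mem_erase.2 ⟨hzρ, hz⟩, hvz⟩)
          (fun q hq => Finset.mem_erase.2 ⟨fun h => hρQ (h ▸ hq), hQZ hq⟩) hQ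
          (fun w => by
            refine le_trans (by have := havail w; omega) (Finset.card_le_card (s := Finset.univ.filter
              (fun x => G.Adj w x ∧ x ∉ Q ∧ load F Z x + 1 ≤ k)) ?_)
            intro x hx
            simp only [Finset.mem_filter, Finset.mem_univ, true_and] at hx ⊢
            have := hl x
            exact ⟨hx.1, hx.2.1, by omega⟩)
        exact ⟨F', Z', a1, a2, a3, a4, a5, a6, a7, a8, by omega⟩
      · refine ⟨F, Z, le_rfl, hFG, hload, hreach, hQZ, hQ, ?_, fun w => ?_, by simp⟩
        -- When no step applies, the component of each root outside `Q` contains all its available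
        -- neighbours, hence at least `a` vertices, and these components are disjoint.
        · push Not at h1 h2
          have hdisj : ∀ ρ ∈ Z \ Q, ∀ ρ' ∈ Z \ Q, ρ ≠ ρ' →
              Disjoint (Finset.univ.filter (fun v => F.Reachable v ρ))
                (Finset.univ.filter (fun v => F.Reachable v ρ')) := by
            intro ρ hρ ρ' hρ' hne
            rw [Finset.mem_sdiff] at hρ hρ'
            rw [Finset.disjoint_left]
            intro v hv hv'
            simp only [Finset.mem_filter, Finset.mem_univ, true_and] at hv hv'
            exact h2 ρ hρ.1 ρ' hρ'.1 hρ'.2 hne (hv'.symm.trans hv)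
          have hcard : ∀ ρ ∈ Z \ Q, a ≤ (Finset.univ.filter (fun v => F.Reachable v ρ)).card := by
            intro ρ hρ
            rw [Finset.mem_sdiff] at hρ
            refine le_trans (by have := havail ρ; omega) (Finset.card_le_card (s := Finset.univ.filter
              (fun x => G.Adj ρ x ∧ x ∉ Q ∧ load F Z x + 1 ≤ k)) ?_)
            intro x hx
            simp only [Finset.mem_filter, Finset.mem_univ, true_and] at hx ⊢
            exact h1 ρ hρ.1 hρ.2 x hx.1 hx.2.1 hx.2.2
          calc a * (Z \ Q).card = ∑ ρ ∈ Z \ Q, a := by simp [mul_comm]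
            _ ≤ ∑ ρ ∈ Z \ Q, (Finset.univ.filter (fun v => F.Reachable v ρ)).card :=
                Finset.sum_le_sum hcard
            _ = ((Z \ Q).biUnion (fun ρ => Finset.univ.filter (fun v => F.Reachable v ρ))).card :=
                (Finset.card_biUnion hdisj).symm
            _ ≤ Fintype.card V := Finset.card_le_univ _
        · have := havail w
          omega

open Classical in
/-- Roots in a common cluster are linked through reserved vertices. -/
theorem exists_cluster_merge [Fintype V] (G : SimpleGraph V) (k : ℕ) (hk : 3 ≤ k) (θ : ℝ) (J : ℕ)
    (cl : V → V) (hcl : ∀ u v, cl u = cl v → robust G θ J u v) (M : ℕ)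
    (H H' U : ℕ → Finset V) (jt : ℕ → V → V)
    (hH : ∀ i < M, ∀ A ∈ denseFamily G θ J, ∃ v ∈ A, v ∈ H i)
    (hH' : ∀ i < M, ∀ A ∈ denseFamily G θ J, ∃ v ∈ A, v ∈ H' i)
    (hjt : ∀ i < M, ∀ v, cl (jt i (cl v)) = cl v)
    (hHU : ∀ i < M, H i ⊆ U i) (hHU' : ∀ i < M, H' i ⊆ U i)
    (hjU : ∀ i < M, ∀ v, jt i (cl v) ∈ U i)
    (hHH : ∀ i < M, Disjoint (H i) (H' i))
    (hjH : ∀ i < M, ∀ v, jt i (cl v) ∉ H i ∧ jt i (cl v) ∉ H' i)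
    (hU : ∀ i < M, ∀ j < M, i ≠ j → Disjoint (U i) (U j))
    (m i : ℕ) (F : SimpleGraph V) (Z : Finset V) (hZ : Z.card ≤ m) (him : i + m ≤ M)
    (hFG : F ≤ G) (hload : ∀ v, load F Z v ≤ k)
    (hfree : ∀ j, i ≤ j → j < M → ∀ x ∈ U j, deg F x = 0 ∧ x ∉ Z) :
    ∃ F' : SimpleGraph V, F ≤ F' ∧ F' ≤ G ∧ (∀ v, deg F' v ≤ k) ∧
      (∀ z ∈ Z, ∀ z' ∈ Z, cl z = cl z' → F'.Reachable z z') ∧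
      (∀ x, (∀ j, i ≤ j → j < M → x ∉ U j) → deg F' x ≤ load F Z x) ∧
      (∀ j, i ≤ j → j < M → ∀ x ∈ U j, deg F' x ≠ 0 → ∃ z ∈ Z, F'.Reachable x z) ∧
      (∀ x y, F'.Adj x y → F.Adj x y ∨ ∃ j < M, x ∈ U j ∨ y ∈ U j) := by
  induction m generalizing i F Z with
  | zero =>
    have hZ0 : Z = ∅ := Finset.card_eq_zero.1 (Nat.le_zero.1 hZ)
    subst hZ0
    refine ⟨F, le_rfl, hFG, fun v => (deg_le_load _ _ _).trans (hload v), by simp,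
      fun x _ => deg_le_load _ _ _, fun j hj hjM x hx h => absurd (hfree j hj hjM x hx).1 h,
      fun x y h => Or.inl h⟩
  | succ m ih =>
    by_cases hex : ∃ ρ ∈ Z, ∃ ρ' ∈ Z, ρ ≠ ρ' ∧ cl ρ = cl ρ'
    swap
    · push Not at hex
      refine ⟨F, le_rfl, hFG, fun v => (deg_le_load _ _ _).trans (hload v), ?_,
        fun x _ => deg_le_load _ _ _, fun j hj hjM x hx h => absurd (hfree j hj hjM x hx).1 h,
        fun x y h => Or.inl h⟩
      intro z hz z' hz' h
      by_cases hzz : z = z'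
      · rw [hzz]
      · exact absurd h (hex z hz z' hz' hzz)
    obtain ⟨ρ, hρ, ρ', hρ', hne, hclρ⟩ := hex
    have hiM : i < M := by omega
    set p := jt i (cl ρ) with hp
    have hclp : cl p = cl ρ := hjt i hiM ρ
    have hpU : p ∈ U i := hjU i hiM ρ
    have hfi := hfree i le_rfl hiM
    have hρU : ρ ∉ U i := fun h => (hfi ρ h).2 hρ
    have hρU' : ρ' ∉ U i := fun h => (hfi ρ' h).2 hρ'
    have hρp : ρ ≠ p := fun h => hρU (h ▸ hpU)
    have hρp' : ρ' ≠ p := fun h => hρU' (h ▸ hpU)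
    have hρH : ρ ∉ H i := fun h => hρU (hHU i hiM h)
    have hρH' : ρ ∉ H' i := fun h => hρU (hHU' i hiM h)
    have hρ'H : ρ' ∉ H i := fun h => hρU' (hHU i hiM h)
    have hρ'H' : ρ' ∉ H' i := fun h => hρU' (hHU' i hiM h)
    have hpH : p ∉ H i := (hjH i hiM ρ).1
    have hpH' : p ∉ H' i := (hjH i hiM ρ).2
    obtain ⟨P, hPG, hPr, hPρ, hPp, hP2, hP0, hPs⟩ :=
      exists_linkGraph G θ J (H i) (hH i hiM) ρ p (hcl ρ p hclp.symm)
    obtain ⟨P', hPG', hPr', hPρ', hPp', hP2', hP0', hPs'⟩ :=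
      exists_linkGraph G θ J (H' i) (hH' i hiM) ρ' p (hcl ρ' p (hclρ.symm.trans hclp.symm))
    -- The roots `ρ`, `ρ'` are linked to the joint `p` along paths through the disjoint sets `H i`
    -- and `H' i`, and `p` replaces both as root. Its load is at most 1 + 1 + 1 ≤ k, and other
    -- vertices of the unit have degree at most 2. Each merge consumes one unit and one root.
    set F1 := F ⊔ P ⊔ P' with hF1
    set Z1 := insert p ((Z.erase ρ).erase ρ') with hZ1
    have hFF1 : F ≤ F1 := le_sup_left.trans le_sup_left
    have hPF1 : P ≤ F1 := le_sup_right.trans le_sup_left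
    have hPF1' : P' ≤ F1 := le_sup_right
    have hdeg : ∀ x, deg F1 x ≤ deg F x + deg P x + deg P' x := fun x =>
      (deg_sup_le _ _ _).trans (Nat.add_le_add_right (deg_sup_le _ _ _) _)
    have hpZ : p ∉ Z := (hfi p hpU).2
    have hZ1c : Z1.card ≤ m := by
      have h1 : ((Z.erase ρ).erase ρ').card = Z.card - 1 - 1 := by
        rw [Finset.card_erase_of_mem (Finset.mem_erase.2 ⟨hne.symm, hρ'⟩),
          Finset.card_erase_of_mem hρ]
      have h2 : 1 < Z.card := Finset.one_lt_card.2 ⟨ρ, hρ, ρ', hρ', hne⟩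
      have h3 : Z1.card ≤ _ := Finset.card_insert_le p ((Z.erase ρ).erase ρ')
      omega
    have hloadout : ∀ x, x ∉ U i → load F1 Z1 x ≤ load F Z x := by
      intro x hx
      have hxp : x ≠ p := fun h => hx (h ▸ hpU)
      have hxH : x ∉ H i := fun h => hx (hHU i hiM h)
      have hxH' : x ∉ H' i := fun h => hx (hHU' i hiM h)
      have hd := hdeg x
      by_cases h1 : x = ρ
      · subst h1
        have hz := hP0' x hne hρp hρH'
        have : x ∉ Z1 := by simp [hZ1, hxp]
        simp only [load, this, if_false, hρ, if_true]
        omega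
      · have h0 := hP0 x
        by_cases h2 : x = ρ'
        · subst h2
          have hz := hP0 x h1 hρp' hρ'H
          have : x ∉ Z1 := by simp [hZ1, hxp]
          simp only [load, this, if_false, hρ', if_true]
          omega
        · have hz := hP0 x h1 hxp hxH
          have hz' := hP0' x h2 hxp hxH'
          have : x ∈ Z1 ↔ x ∈ Z := by simp [hZ1, hxp, h1, h2]
          simp only [load, this]
          omega
    have hload1 : ∀ x, load F1 Z1 x ≤ k := by
      intro x
      by_cases hx : x ∈ U i
      · obtain ⟨hx0, hxZ⟩ := hfi x hx
        have hxρ : x ≠ ρ := fun h => hρU (h ▸ hx)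
        have hxρ' : x ≠ ρ' := fun h => hρU' (h ▸ hx)
        have hd := hdeg x
        by_cases hxp : x = p
        · have h1 : deg P x ≤ 1 := hxp ▸ hPp
          have h2 : deg P' x ≤ 1 := hxp ▸ hPp'
          simp only [load]
          split_ifs <;> omega
        · have : x ∉ Z1 := by simp [hZ1, hxp, hxZ]
          simp only [load, this, if_false]
          by_cases hxH : x ∈ H i
          · have h1 := hP2 x
            have h2 := hP0' x hxρ' hxp (Finset.disjoint_left.1 (hHH i hiM) hxH)
            omega
          · have h1 := hP2' x
            have h2 := hP0 x hxρ hxp hxH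
            omega
      · exact (hloadout x hx).trans (hload x)
    have hUi : ∀ j, i + 1 ≤ j → j < M → ∀ x ∈ U j, x ∉ U i := fun j hj hjM x hx hxi =>
      Finset.disjoint_left.1 (hU i hiM j hjM (by omega)) hxi hx
    obtain ⟨F', a1, a2, a3, a4, a5, a6, a7⟩ := ih (i + 1) F1 Z1 hZ1c (by omega)
      (sup_le (sup_le hFG hPG) hPG') hload1
      (fun j hj hjM x hx => by
        have h1 := hfree j (by omega) hjM x hx
        have h2 := hloadout x (hUi j hj hjM x hx)
        simp only [load, h1.1, h1.2, if_false] at h2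
        have h3 : ¬ x ∈ Z1 := by
          intro h
          rw [if_pos h] at h2
          omega
        exact ⟨by omega, h3⟩)
    have hback : ∀ z1 ∈ Z1, ∃ z ∈ Z, F'.Reachable z1 z := by
      intro z1 hz1
      rw [hZ1, Finset.mem_insert] at hz1
      rcases hz1 with rfl | hz1
      · exact ⟨ρ, hρ, (hPr.mono (hPF1.trans a1)).symm⟩
      · exact ⟨z1, Finset.mem_of_mem_erase (Finset.mem_of_mem_erase hz1), by rfl⟩
    have hforth : ∀ z ∈ Z, ∃ z1 ∈ Z1, F'.Reachable z z1 ∧ cl z1 = cl z := by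
      intro z hz
      by_cases h1 : z = ρ
      · exact ⟨p, Finset.mem_insert_self _ _, h1 ▸ hPr.mono (hPF1.trans a1), h1 ▸ hclp⟩
      · by_cases h2 : z = ρ'
        · exact ⟨p, Finset.mem_insert_self _ _, h2 ▸ hPr'.mono (hPF1'.trans a1),
            h2 ▸ hclp.trans hclρ⟩
        · exact ⟨z, by simp [hZ1, h1, h2, hz], by rfl, rfl⟩
    refine ⟨F', hFF1.trans a1, a2, a3, ?_, ?_, ?_, ?_⟩
    · intro z hz z' hz' hzz
      obtain ⟨w, hw, hzw, hcw⟩ := hforth z hz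
      obtain ⟨w', hw', hzw', hcw'⟩ := hforth z' hz'
      exact hzw.trans ((a4 w hw w' hw' (hcw.trans (hzz.trans hcw'.symm))).trans hzw'.symm)
    · intro x hx
      exact (a5 x (fun j hj => hx j (by omega))).trans (hloadout x (hx i le_rfl hiM))
    · intro j hj hjM x hx hd
      by_cases hji : j = i
      · subst hji
        by_cases hxp : x = p
        · exact ⟨ρ, hρ, hxp ▸ (hPr.mono (hPF1.trans a1)).symm⟩
        · by_cases h1 : deg P x = 0
          · by_cases h2 : deg P' x = 0
            · exfalso
              apply hd
              have h3 := a5 x (fun l hl hlM hxl => hUi l hl hlM x hxl hx)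
              have h4 := hdeg x
              have h5 := hfi x hx
              have : x ∉ Z1 := by simp [hZ1, hxp, h5.2]
              simp only [load, this, if_false] at h3
              omega
            · exact ⟨ρ', hρ', (hPs' x h2).mono (hPF1'.trans a1)⟩
          · exact ⟨ρ, hρ, (hPs x h1).mono (hPF1.trans a1)⟩
      · obtain ⟨z1, hz1, hxz1⟩ := a6 j (by omega) hjM x hx hd
        obtain ⟨z, hz, hzz⟩ := hback z1 hz1
        exact ⟨z, hz, hxz1.trans hzz⟩
    · intro x y hxy
      rcases a7 x y hxy with h | h
      · have key : ∀ x y, x ∉ U i → y ∉ U i → ¬ P.Adj x y := by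
          intro x y hx hy hP
          have e1 : ∀ v, v ∉ U i → deg P v ≠ 0 → v = ρ := by
            intro v hv hv0
            by_contra hvρ
            exact hv0 (hP0 v hvρ (fun h => hv (h ▸ hpU)) (fun h => hv (hHU i hiM h)))
          have e2 := e1 x hx (fun h => not_adj_of_deg_eq_zero h y hP)
          have e3 := e1 y hy (fun h => not_adj_of_deg_eq_zero h x hP.symm)
          exact hP.ne (e2.trans e3.symm)
        have key' : ∀ x y, x ∉ U i → y ∉ U i → ¬ P'.Adj x y := by
          intro x y hx hy hP
          have e1 : ∀ v, v ∉ U i → deg P' v ≠ 0 → v = ρ' := by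
            intro v hv hv0
            by_contra hvρ
            exact hv0 (hP0' v hvρ (fun h => hv (h ▸ hpU)) (fun h => hv (hHU' i hiM h)))
          have e2 := e1 x hx (fun h => not_adj_of_deg_eq_zero h y hP)
          have e3 := e1 y hy (fun h => not_adj_of_deg_eq_zero h x hP.symm)
          exact hP.ne (e2.trans e3.symm)
        by_cases hx : x ∈ U i
        · exact Or.inr ⟨i, hiM, Or.inl hx⟩
        · by_cases hy : y ∈ U i
          · exact Or.inr ⟨i, hiM, Or.inr hy⟩
          · rcases h with (h | h) | h
            · exact Or.inl h
            · exact absurd h (key x y hx hy)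
            · exact absurd h (key' x y hx hy)
      · exact Or.inr h

open Classical in
/-- Isolated vertices with many available neighbours are attached as leaves. -/
theorem exists_attach [Fintype V] (G F : SimpleGraph V) (k : ℕ) (hk : 1 ≤ k) (hFG : F ≤ G)
    (X : Finset V) (hX : ∀ x ∈ X, deg F x = 0) (hdeg : ∀ v, deg F v ≤ k)
    (havail : ∀ x ∈ X, X.card ≤ (Finset.univ.filter
      (fun y => G.Adj x y ∧ y ∉ X ∧ deg F y + 1 ≤ k)).card)
    (hconn : ∀ v, v ∉ X → ∀ w, w ∉ X → F.Reachable v w) :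
    ∃ F' : SimpleGraph V, F ≤ F' ∧ F' ≤ G ∧ (∀ v, deg F' v ≤ k) ∧ F'.Preconnected ∧
      ∀ x y, F'.Adj x y → F.Adj x y ∨ x ∈ X ∨ y ∈ X := by
  -- Hall's condition is trivial because each single vertex of `X` already has `X.card` targets.
  -- Distinct targets cost at most one slot each.
  obtain ⟨σ, hσi, hσ⟩ := (Finset.all_card_le_biUnion_card_iff_exists_injective
    (fun x : X => Finset.univ.filter (fun y => G.Adj x y ∧ y ∉ X ∧ deg F y + 1 ≤ k))).1 (by
      intro s
      rcases s.eq_empty_or_nonempty with rfl | ⟨x, hx⟩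
      · simp
      · calc s.card ≤ X.card := by
              have := Finset.card_le_univ s
              rwa [Fintype.card_coe] at this
          _ ≤ _ := havail x x.2
          _ ≤ _ := Finset.card_le_card (Finset.subset_biUnion_of_mem (fun x : X =>
              Finset.univ.filter (fun y => G.Adj x y ∧ y ∉ X ∧ deg F y + 1 ≤ k)) hx))
  simp only [Finset.mem_filter, Finset.mem_univ, true_and] at hσ
  let N : SimpleGraph V :=
    { Adj := fun u v => (∃ h : u ∈ X, σ ⟨u, h⟩ = v) ∨ ∃ h : v ∈ X, σ ⟨v, h⟩ = u
      symm := ⟨fun u v h => h.symm⟩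
      loopless := ⟨fun u h => by
        rcases h with ⟨h, h'⟩ | ⟨h, h'⟩
        · have := (hσ ⟨u, h⟩).2.1
          rw [h'] at this
          exact this h
        · have := (hσ ⟨u, h⟩).2.1
          rw [h'] at this
          exact this h⟩ }
  have hN1 : ∀ v, deg N v ≤ 1 := by
    intro v
    rw [deg, Set.ncard_le_one (Set.toFinite _)]
    rintro a (⟨ha, ha'⟩ | ⟨ha, ha'⟩) b (⟨hb, hb'⟩ | ⟨hb, hb'⟩)
    · exact ha'.symm.trans hb'
    · exact absurd ha (hb' ▸ (hσ ⟨b, hb⟩).2.1)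
    · exact absurd hb (ha' ▸ (hσ ⟨a, ha⟩).2.1)
    · exact congrArg Subtype.val (hσi (ha'.trans hb'.symm))
  have hle : F ≤ F ⊔ N := le_sup_left
  have htoX : ∀ v, ∃ w, w ∉ X ∧ (F ⊔ N).Reachable v w := by
    intro v
    by_cases hv : v ∈ X
    · exact ⟨σ ⟨v, hv⟩, (hσ ⟨v, hv⟩).2.1,
        SimpleGraph.Adj.reachable (Or.inr (Or.inl ⟨hv, rfl⟩))⟩
    · exact ⟨v, hv, by rfl⟩
  refine ⟨F ⊔ N, hle, sup_le hFG ?_, ?_, ?_, ?_⟩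
  · rintro u v (⟨h, rfl⟩ | ⟨h, rfl⟩)
    · exact (hσ ⟨u, h⟩).1
    · exact (hσ ⟨v, h⟩).1.symm
  · intro v
    have h1 := deg_sup_le F N v
    have h2 := hN1 v
    by_cases h0 : deg N v = 0
    · have := hdeg v; omega
    · have hnb : (N.neighborSet v).ncard ≠ 0 := h0
      obtain ⟨x, hx⟩ : (N.neighborSet v).Nonempty := by
        rw [← Set.ncard_pos (Set.toFinite _)]; omega
      rcases hx with ⟨h, h'⟩ | ⟨h, h'⟩
      · have := hX v h; omega
      · have := (hσ ⟨x, h⟩).2.2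
        rw [h'] at this
        omega
  · intro u v
    obtain ⟨u', hu', huu⟩ := htoX u
    obtain ⟨v', hv', hvv⟩ := htoX v
    exact huu.trans (((hconn u' hu' v' hv').mono hle).trans hvv.symm)
  · rintro x y (h | ⟨h, -⟩ | ⟨h, -⟩)
    · exact Or.inl h
    · exact Or.inr (Or.inl h)
    · exact Or.inr (Or.inr h)
end Merging

/-! ### The reserve and the completion to a connected graph -/

section Reserve
variable {V : Type*}

/-- Reserved vertices of `G`, in `M` disjoint units, that allow to connect up to `M` components:
clusters `cl` of robustly related vertices, few edges `L` connecting the clusters, and in each unit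
two hitting sets and a joint in every cluster. -/
structure Reserve [Fintype V] (G : SimpleGraph V) (k M : ℕ) where
  θ : ℝ
  J : ℕ
  cl : V → V
  robust_of_cl : ∀ u v, cl u = cl v → robust G θ J u v
  H : ℕ → Finset V
  H' : ℕ → Finset V
  U : ℕ → Finset V
  jt : ℕ → V → V
  hit : ∀ i < M, ∀ A ∈ denseFamily G θ J, ∃ v ∈ A, v ∈ H i
  hit' : ∀ i < M, ∀ A ∈ denseFamily G θ J, ∃ v ∈ A, v ∈ H' i
  cl_jt : ∀ i < M, ∀ v, cl (jt i (cl v)) = cl v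
  H_sub : ∀ i < M, H i ⊆ U i
  H'_sub : ∀ i < M, H' i ⊆ U i
  jt_mem : ∀ i < M, ∀ v, jt i (cl v) ∈ U i
  disj : ∀ i < M, Disjoint (H i) (H' i)
  jt_notMem : ∀ i < M, ∀ v, jt i (cl v) ∉ H i ∧ jt i (cl v) ∉ H' i
  U_disj : ∀ i < M, ∀ j < M, i ≠ j → Disjoint (U i) (U j)
  L : SimpleGraph V
  L_le : L ≤ G
  deg_L : ∀ v, deg L v + 1 ≤ k
  preconn : (clusterGraph cl ⊔ L).Preconnected
  S : Finset V
  card_S : S.card ≤ 2 * k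
  deg_L_eq_zero : ∀ v, v ∉ S → deg L v = 0
  S_disj : ∀ i < M, Disjoint S (U i)

open Classical in
/-- All vertices used by a reserve. -/
noncomputable def Reserve.Q [Fintype V] {G : SimpleGraph V} {k M : ℕ} (R : Reserve G k M) :
    Finset V := R.S ∪ (Finset.range M).biUnion R.U

open Classical in
/-- A rooted graph with free slots is completed to a connected graph by few edges. -/
theorem Reserve.exists_connected [Fintype V] [Nonempty V] {G : SimpleGraph V} {k M : ℕ}
    (R : Reserve G k M) (hk : 3 ≤ k) (a : ℕ) (F : SimpleGraph V) (Z : Finset V) (hFG : F ≤ G)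
    (hload : ∀ v, load F Z v ≤ k) (hreach : ∀ v, ∃ z ∈ Z, F.Reachable v z) (hQZ : R.Q ⊆ Z)
    (hQ : ∀ q ∈ R.Q, deg F q = 0)
    (havail : ∀ w, a + Z.card ≤ (Finset.univ.filter
      (fun x => G.Adj w x ∧ x ∉ R.Q ∧ load F Z x + 1 ≤ k)).card)
    (hM : ∀ q, a * q ≤ Fintype.card V → q + 2 * k ≤ M) (hQa : R.Q.card ≤ a) :
    ∃ F' : SimpleGraph V, F ≤ F' ∧ F' ≤ G ∧ (∀ v, deg F' v ≤ k) ∧ F'.Connected ∧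
      (F'.edgeSet \ F.edgeSet).ncard ≤ Z.card + k * R.Q.card := by
  obtain ⟨F1, Z1, hFF1, hF1G, hload1, hreach1, hQZ1, hQ1, hcard1, havail1, hnew1⟩ :=
    exists_greedy_merge G k a R.Q Z.card F Z le_rfl hFG hload hreach hQZ hQ havail
  have hSQ : R.S ⊆ R.Q := Finset.subset_union_left
  have hUQ : ∀ i < M, R.U i ⊆ R.Q := fun i hi =>
    (Finset.subset_biUnion_of_mem R.U (Finset.mem_range.2 hi)).trans Finset.subset_union_right
  have hSU : ∀ j < M, ∀ x ∈ R.U j, x ∉ R.S := fun j hj x hx hxS =>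
    Finset.disjoint_left.1 (R.S_disj j hj) hxS hx
  set F2 := F1 ⊔ R.L with hF2
  -- The reserve was kept as isolated roots during the greedy phase. From here on only the ends `S`
  -- of the links between clusters remain roots in it; the other reserve vertices are free for the
  -- merging within clusters.
  set Z2 := (Z1 \ R.Q) ∪ R.S with hZ2
  have hZ2c : Z2.card ≤ M := by
    have h1 := hM _ hcard1
    have h2 : Z2.card ≤ _ := Finset.card_union_le (Z1 \ R.Q) R.S
    have h3 := R.card_S
    omega
  have hload2 : ∀ v, v ∉ R.S → load F2 Z2 v ≤ load F1 Z1 v := by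
    intro v hv
    have h1 : deg F2 v ≤ _ := deg_sup_le F1 R.L v
    have h2 := R.deg_L_eq_zero v hv
    have h3 : v ∈ Z2 → v ∈ Z1 := by
      intro h
      rw [hZ2, Finset.mem_union, Finset.mem_sdiff] at h
      tauto
    simp only [load]
    split_ifs <;> first | omega | tauto
  have hloadk : ∀ v, load F2 Z2 v ≤ k := by
    intro v
    by_cases hv : v ∈ R.S
    · have h1 : deg F2 v ≤ _ := deg_sup_le F1 R.L v
      have h2 := R.deg_L v
      have h3 := hQ1 v (hSQ hv)
      simp only [load]
      split_ifs <;> omega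
    · exact (hload2 v hv).trans (hload1 v)
  obtain ⟨F3, hF23, hF3G, hdeg3, hcl3, hout3, hin3, hnew3⟩ := exists_cluster_merge G k hk R.θ R.J R.cl
    R.robust_of_cl M R.H R.H' R.U R.jt R.hit R.hit' R.cl_jt R.H_sub R.H'_sub R.jt_mem R.disj
    R.jt_notMem R.U_disj M 0 F2 Z2 hZ2c (by omega) (sup_le hF1G R.L_le) hloadk
    (fun j _ hjM x hx => by
      have h1 : deg F2 x ≤ _ := deg_sup_le F1 R.L x
      have h2 := R.deg_L_eq_zero x (hSU j hjM x hx)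
      have h3 := hQ1 x (hUQ j hjM hx)
      refine ⟨by omega, ?_⟩
      rw [hZ2, Finset.mem_union, Finset.mem_sdiff]
      rintro (h | h)
      · exact h.2 (hUQ j hjM hx)
      · exact hSU j hjM x hx h)
  have hF13 : F1 ≤ F3 := le_sup_left.trans hF23
  have hL3 : R.L ≤ F3 := le_sup_right.trans hF23
  have hLS : ∀ u v, R.L.Adj u v → u ∈ R.S := by
    intro u v h
    by_contra hu
    exact not_adj_of_deg_eq_zero (R.deg_L_eq_zero u hu) v h
  have hZ2conn : ∀ z ∈ Z2, ∀ z' ∈ Z2, F3.Reachable z z' := by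
    have key : ∀ u v, (clusterGraph R.cl ⊔ R.L).Reachable u v → ∀ z ∈ Z2, R.cl z = R.cl u →
        ∀ z' ∈ Z2, R.cl z' = R.cl v → F3.Reachable z z' := by
      rintro u v ⟨p⟩
      induction p with
      | nil => exact fun z hz h z' hz' h' => hcl3 z hz z' hz' (h.trans h'.symm)
      | @cons u w v h q ih =>
        intro z hz hzu z' hz' hzv
        rcases h with h | h
        · exact ih z hz (hzu.trans h.2) z' hz' hzv
        · have hu : u ∈ Z2 := Finset.mem_union_right _ (hLS u w h)
          have hw : w ∈ Z2 := Finset.mem_union_right _ (hLS w u h.symm)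
          exact (hcl3 z hz u hu hzu).trans
            ((hL3 h).reachable.trans (ih w hw rfl z' hz' hzv))
    exact fun z hz z' hz' => key z z' (R.preconn z z') z hz rfl z' hz' rfl
  -- Unit vertices that the merging left isolated; they are attached as leaves at the end.
  set X := ((Finset.range M).biUnion R.U).filter (fun x => deg F3 x = 0) with hXdef
  have hXQ : X ⊆ R.Q := (Finset.filter_subset _ _).trans Finset.subset_union_right
  have htoZ2 : ∀ v, v ∉ X → ∃ z ∈ Z2, F3.Reachable v z := by
    intro v hv
    by_cases hvU : v ∈ (Finset.range M).biUnion R.U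
    · obtain ⟨j, hj, hvj⟩ := Finset.mem_biUnion.1 hvU
      apply hin3 j (Nat.zero_le _) (Finset.mem_range.1 hj) v hvj
      intro h
      exact hv (Finset.mem_filter.2 ⟨hvU, h⟩)
    · obtain ⟨z, hz, hvz⟩ := hreach1 v
      by_cases hzQ : z ∈ R.Q
      · have hvz' : v = z := by
          by_contra hne
          obtain ⟨p⟩ := hvz.symm
          cases p with
          | nil => exact hne rfl
          | cons h _ => exact not_adj_of_deg_eq_zero (hQ1 z hzQ) _ h
        refine ⟨v, Finset.mem_union_right _ ?_, by rfl⟩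
        rw [← hvz', Reserve.Q, Finset.mem_union] at hzQ
        exact hzQ.resolve_right hvU
      · exact ⟨z, Finset.mem_union_left _ (Finset.mem_sdiff.2 ⟨hz, hzQ⟩), hvz.mono hF13⟩
  obtain ⟨F4, hF34, hF4G, hdeg4, hconn4, hnew4⟩ := exists_attach G F3 k (by omega) hF3G X
    (fun x hx => (Finset.mem_filter.1 hx).2) hdeg3
    (fun x hx => by
      refine (Finset.card_le_card hXQ).trans (hQa.trans ((havail1 x).trans (Finset.card_le_card ?_)))
      intro y hy
      simp only [Finset.mem_filter, Finset.mem_univ, true_and] at hy ⊢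
      refine ⟨hy.1, fun h => hy.2.1 (hXQ h), ?_⟩
      have h1 := hout3 y (fun j _ hj hyj => hy.2.1 (hUQ j hj hyj))
      have h2 := hload2 y (fun h => hy.2.1 (hSQ h))
      have h3 := hy.2.2
      omega)
    (fun v hv w hw => by
      obtain ⟨z, hz, hvz⟩ := htoZ2 v hv
      obtain ⟨z', hz', hwz⟩ := htoZ2 w hw
      exact hvz.trans ((hZ2conn z hz z' hz').trans hwz.symm))
  refine ⟨F4, hFF1.trans (hF13.trans hF34), hF4G, hdeg4, ⟨hconn4⟩, ?_⟩
  -- After the greedy phase every new edge touches the reserve, whence at most `k * R.Q.card`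
  -- further edges.
  have hadj : ∀ x y, F4.Adj x y → F1.Adj x y ∨ x ∈ R.Q ∨ y ∈ R.Q := by
    intro x y h
    rcases hnew4 x y h with h | h | h
    · rcases hnew3 x y h with (h | h) | ⟨j, hj, h | h⟩
      · exact Or.inl h
      · exact Or.inr (Or.inl (hSQ (hLS x y h)))
      · exact Or.inr (Or.inl (hUQ j hj h))
      · exact Or.inr (Or.inr (hUQ j hj h))
    · exact Or.inr (Or.inl (hXQ h))
    · exact Or.inr (Or.inr (hXQ h))
  have hsub : F4.edgeSet \ F.edgeSet ⊆ (F1.edgeSet \ F.edgeSet) ∪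
      ⋃ q ∈ R.Q, (fun y => s(q, y)) '' F4.neighborSet q := by
    rintro e ⟨he, he'⟩
    induction e with
    | _ x y =>
      rcases hadj x y he with h | h | h
      · exact Or.inl ⟨h, he'⟩
      · right
        simp only [Set.mem_iUnion]
        exact ⟨x, h, y, he, rfl⟩
      · right
        simp only [Set.mem_iUnion]
        exact ⟨y, h, x, SimpleGraph.Adj.symm he, Sym2.eq_swap⟩
  refine (Set.ncard_le_ncard hsub (Set.toFinite _)).trans ((Set.ncard_union_le _ _).trans ?_)
  refine Nat.add_le_add hnew1 ?_
  refine (Finset.set_ncard_biUnion_le _ _).trans ?_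
  calc ∑ q ∈ R.Q, ((fun y => s(q, y)) '' F4.neighborSet q).ncard ≤ ∑ q ∈ R.Q, k := by
        apply Finset.sum_le_sum
        intro q _
        exact (Set.ncard_image_le (Set.toFinite _)).trans (hdeg4 q)
    _ = k * R.Q.card := by simp [mul_comm]

theorem exists_injOn_range (T : Finset V) (M : ℕ) [Nonempty V] (h : M ≤ T.card) :
    ∃ f : ℕ → V, (∀ i < M, f i ∈ T) ∧ ∀ i < M, ∀ j < M, f i = f j → i = j := by
  classical
  obtain ⟨v0⟩ := ‹Nonempty V›
  refine ⟨fun i => if h : i < T.card then (T.equivFin.symm ⟨i, h⟩ : V) else v0, ?_, ?_⟩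
  · intro i hi
    simp only [dif_pos (hi.trans_le h)]
    exact Finset.coe_mem _
  · intro i hi j hj hij
    simp only [dif_pos (hi.trans_le h), dif_pos (hj.trans_le h)] at hij
    have h1 := T.equivFin.symm.injective (Subtype.ext hij)
    exact congrArg Fin.val h1

-- The joints come first: a cluster has at least 2k + M vertices and so contains M joints outside
-- the at most 2k link ends. Then 2M disjoint hitting sets of size at most h are chosen off all
-- these vertices, two for each unit.
open Classical in
theorem exists_reserve_aux [Fintype V] (G : SimpleGraph V) (hG : G.Connected) (k r M h : ℕ)
    (hk : 3 ≤ k) (hM : 2 ≤ M) (hr : 0 < r)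
    (hreg : ∀ v, (Finset.univ.filter (fun u => G.Adj v u)).card = r)
    (hn : Fintype.card V ≤ (k + 1) * r)
    (h1 : ((2 * k + M : ℕ) : ℝ) ≤ (r : ℝ) / (2 * (k + 1)))
    (h2 : (1 - 1 / (4 * (k + 2) ^ 3) : ℝ) ^ h *
      (((2 * (k + 1) + 4) * Fintype.card V ^ 2 : ℕ) : ℝ) < 1)
    (h3 : ((2 * k + M * (k + 1) + 2 * M * h : ℕ) : ℝ) ≤ 1 / (4 * (k + 2) ^ 3) * Fintype.card V) :
    ∃ R : Reserve G k M, R.Q.card ≤ 2 * k + M * (k + 1) + 2 * M * h := by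
  have hne : Nonempty V := hG.nonempty
  obtain ⟨cl, hcl, hclc, hclsize⟩ := exists_graph_clusters G k r hr hreg hn
  set θ : ℝ := (r : ℝ) / (2 * (k + 2) ^ 2) with hθ
  set J := 2 * (k + 1) + 4 with hJ
  have hk0 : (0 : ℝ) ≤ k := Nat.cast_nonneg k
  have hsize : ∀ v, 2 * k + M ≤ (Finset.univ.filter (fun u => cl u = cl v)).card := by
    intro v
    exact_mod_cast h1.trans (hclsize v)
  obtain ⟨L, hLG, hLdeg, hLpre, S, hSc, hS0⟩ := exists_cluster_links G hG k r hk hreg hn cl hclc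
    (fun v => by
      have h4 := hsize v
      obtain ⟨u, hu, huv⟩ := Finset.exists_mem_ne (s := Finset.univ.filter (fun u => cl u = cl v))
        (by omega) v
      exact ⟨u, huv, (Finset.mem_filter.1 hu).2⟩)
  have hjt : ∀ c : V, ∃ f : ℕ → V, c ∈ Finset.univ.image cl →
      (∀ i < M, cl (f i) = c ∧ f i ∉ S) ∧ ∀ i < M, ∀ j < M, f i = f j → i = j := by
    intro c
    by_cases hc : c ∈ Finset.univ.image cl
    · obtain ⟨v, -, rfl⟩ := Finset.mem_image.1 hc
      obtain ⟨f, hf, hfi⟩ := exists_injOn_range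
        ((Finset.univ.filter (fun u => cl u = cl v)) \ S) M (by
          have h4 := hsize v
          have h5 := Finset.le_card_sdiff S (Finset.univ.filter (fun u => cl u = cl v))
          omega)
      refine ⟨f, fun _ => ⟨fun i hi => ?_, hfi⟩⟩
      have h6 := hf i hi
      simp only [Finset.mem_sdiff, Finset.mem_filter, Finset.mem_univ, true_and] at h6
      exact h6
    · exact ⟨fun _ => c, fun h => absurd h hc⟩
  choose f hf using hjt
  set jt : ℕ → V → V := fun i c => f c i with hjtdef
  have hmem : ∀ v, cl v ∈ Finset.univ.image cl :=
    fun v => Finset.mem_image_of_mem _ (Finset.mem_univ _)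
  have hjcl : ∀ i < M, ∀ v, cl (jt i (cl v)) = cl v := fun i hi v => ((hf _ (hmem v)).1 i hi).1
  have hjS : ∀ i < M, ∀ v, jt i (cl v) ∉ S := fun i hi v => ((hf _ (hmem v)).1 i hi).2
  have hjinj : ∀ i < M, ∀ j < M, ∀ u v, jt i (cl u) = jt j (cl v) → i = j := by
    intro i hi j hj u v h
    have h4 : cl u = cl v := by rw [← hjcl i hi u, h, hjcl j hj v]
    rw [h4] at h
    exact (hf _ (hmem v)).2 i hi j hj h
  let T : ℕ → Finset V := fun i => (Finset.univ.image cl).image (jt i)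
  have hTc : ∀ i, (T i).card ≤ k + 1 := fun i => Finset.card_image_le.trans hclc
  have hmemT : ∀ i x, x ∈ T i ↔ ∃ v, jt i (cl v) = x := by
    intro i x; simp [T]
  set X := S ∪ (Finset.range M).biUnion T with hX
  have hXc : X.card ≤ 2 * k + M * (k + 1) := by
    refine (Finset.card_union_le _ _).trans (Nat.add_le_add hSc (Finset.card_biUnion_le.trans ?_))
    calc ∑ i ∈ Finset.range M, (T i).card ≤ ∑ i ∈ Finset.range M, (k + 1) :=
          Finset.sum_le_sum (fun i _ => hTc i)
      _ = M * (k + 1) := by simp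
  have hθ0 : (1 / (4 * (k + 2) ^ 3) : ℝ) ≤ 1 := by
    rw [div_le_one (by positivity)]
    nlinarith [sq_nonneg (k : ℝ), mul_nonneg hk0 (sq_nonneg (k : ℝ))]
  have hrR : (Fintype.card V : ℝ) ≤ ((k : ℝ) + 1) * r := by exact_mod_cast hn
  obtain ⟨K, hKc, hKX, hKK, hKhit⟩ := exists_disjoint_hittingSets
    (1 / (4 * (k + 2) ^ 3) : ℝ) hθ0 h (2 * M) (denseFamily G θ J) (by
      intro A hA
      have h4 : θ ≤ A.card := (Finset.mem_filter.1 hA).2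
      refine le_trans ?_ h4
      -- The density 1 / (4 (k+2)^3) is chosen so that, as n ≤ (k+1) r, twice it times n is at most
      -- `θ`.
      have h5 : θ = 2 * (1 / (4 * ((k : ℝ) + 2) ^ 3)) * (((k : ℝ) + 2) * r) := by
        rw [hθ]; field_simp; ring
      rw [h5]
      apply mul_le_mul_of_nonneg_left _ (by positivity)
      have : (0 : ℝ) ≤ r := Nat.cast_nonneg r
      linarith) (by
      refine lt_of_le_of_lt ?_ h2
      apply mul_le_mul_of_nonneg_left _ (pow_nonneg (by linarith) _)
      exact_mod_cast card_denseFamily_le G θ J) X (by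
      refine le_trans ?_ h3
      have : (X.card : ℝ) ≤ ((2 * k + M * (k + 1) : ℕ) : ℝ) := by exact_mod_cast hXc
      push_cast at this ⊢
      linarith)
  have hTX : ∀ i < M, T i ⊆ X := fun i hi =>
    (Finset.subset_biUnion_of_mem T (Finset.mem_range.2 hi)).trans Finset.subset_union_right
  have hKT : ∀ i < 2 * M, ∀ j < M, Disjoint (K i) (T j) := fun i hi j hj =>
    Finset.disjoint_of_subset_right (hTX j hj) (hKX i hi)
  have hKS : ∀ i < 2 * M, Disjoint (K i) S := fun i hi =>
    Finset.disjoint_of_subset_right Finset.subset_union_left (hKX i hi)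
  have hTT : ∀ i < M, ∀ j < M, i ≠ j → Disjoint (T i) (T j) := by
    intro i hi j hj hij
    rw [Finset.disjoint_left]
    intro x hx hx'
    obtain ⟨u, rfl⟩ := (hmemT i x).1 hx
    obtain ⟨v, hv⟩ := (hmemT j _).1 hx'
    exact hij (hjinj i hi j hj u v hv.symm)
  have hST : ∀ i < M, Disjoint S (T i) := by
    intro i hi
    rw [Finset.disjoint_right]
    intro x hx
    obtain ⟨u, rfl⟩ := (hmemT i x).1 hx
    exact hjS i hi u
  have hjK : ∀ i < M, ∀ v, ∀ j < 2 * M, jt i (cl v) ∉ K j := by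
    intro i hi v j hj h
    exact Finset.disjoint_left.1 (hKT j hj i hi) h ((hmemT i _).2 ⟨v, rfl⟩)
  let U : ℕ → Finset V := fun i => T i ∪ K (2 * i) ∪ K (2 * i + 1)
  refine ⟨{ θ := θ, J := J, cl := cl, robust_of_cl := hcl, H := fun i => K (2 * i),
            H' := fun i => K (2 * i + 1), U := U, jt := jt,
            hit := fun i hi => hKhit (2 * i) (by omega),
            hit' := fun i hi => hKhit (2 * i + 1) (by omega),
            cl_jt := hjcl,
            H_sub := fun i _ => Finset.subset_union_right.trans Finset.subset_union_left,
            H'_sub := fun i _ => Finset.subset_union_right,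
            jt_mem := fun i _ v => Finset.mem_union_left _ (Finset.mem_union_left _
              ((hmemT i _).2 ⟨v, rfl⟩)),
            disj := fun i hi => hKK _ (by omega) _ (by omega) (by omega),
            jt_notMem := fun i hi v => ⟨hjK i hi v _ (by omega), hjK i hi v _ (by omega)⟩,
            U_disj := ?_, L := L, L_le := hLG, deg_L := hLdeg, preconn := hLpre, S := S,
            card_S := hSc, deg_L_eq_zero := hS0, S_disj := ?_ }, ?_⟩
  · intro i hi j hj hij
    simp only [U, Finset.disjoint_union_left, Finset.disjoint_union_right]
    have e1 : ∀ i < M, 2 * i < 2 * M := fun i hi => by omega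
    have e2 : ∀ i < M, 2 * i + 1 < 2 * M := fun i hi => by omega
    constructorm* _ ∧ _
    all_goals first
      | exact hTT i hi j hj hij
      | exact hKT _ (e1 i hi) j hj
      | exact hKT _ (e2 i hi) j hj
      | exact (hKT _ (e1 j hj) i hi).symm
      | exact (hKT _ (e2 j hj) i hi).symm
      | exact hKK _ (e1 i hi) _ (e1 j hj) (by omega)
      | exact hKK _ (e1 i hi) _ (e2 j hj) (by omega)
      | exact hKK _ (e2 i hi) _ (e1 j hj) (by omega)
      | exact hKK _ (e2 i hi) _ (e2 j hj) (by omega)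
  · intro i hi
    simp only [U, Finset.disjoint_union_right]
    exact ⟨⟨hST i hi, (hKS _ (by omega)).symm⟩, (hKS _ (by omega)).symm⟩
  · simp only [Reserve.Q]
    refine (Finset.card_union_le _ _).trans ?_
    have h4 : ((Finset.range M).biUnion U).card ≤ M * ((k + 1) + h + h) := by
      refine Finset.card_biUnion_le.trans ?_
      calc ∑ i ∈ Finset.range M, (U i).card ≤ ∑ i ∈ Finset.range M, ((k + 1) + h + h) := by
            apply Finset.sum_le_sum
            intro i hi
            rw [Finset.mem_range] at hi
            refine (Finset.card_union_le _ _).trans (Nat.add_le_add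
              ((Finset.card_union_le _ _).trans (Nat.add_le_add (hTc i) (hKc _ (by omega))))
              (hKc _ (by omega)))
        _ = _ := by simp
    have h5 : M * ((k + 1) + h + h) = M * (k + 1) + 2 * M * h := by ring
    omega
end Reserve

/-! ### From maps to spanning trees and back -/

section Functional
variable {V : Type*}

open Classical in
/-- The number of preimages of `x`. -/
noncomputable def indeg [Fintype V] (φ : V → V) (x : V) : ℕ :=
  (Finset.univ.filter (fun v => φ v = x)).card

/-- The graph with edges `v - φ v`. -/
def funGraph (φ : V → V) : SimpleGraph V where
  Adj u v := u ≠ v ∧ (φ u = v ∨ φ v = u)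
  symm := ⟨fun _ _ h => ⟨h.1.symm, h.2.symm⟩⟩
  loopless := ⟨fun _ h => h.1 rfl⟩

/-- A map is determined by its graph and its values near a set that meets all its orbits. -/
theorem eq_of_funGraph_eq {φ ψ : V → V} (hφ : ∀ v, φ v ≠ v)
    (hg : funGraph φ = funGraph ψ) (B : Set V) (hB : ∀ v, ∃ i, φ^[i] v ∈ B)
    (h1 : ∀ b ∈ B, φ b = ψ b) (h2 : ∀ b ∈ B, φ (φ b) = ψ (φ b)) : φ = ψ := by
  have key : ∀ m v, φ^[m] v ∈ B → φ v = ψ v := by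
    intro m
    induction m with
    | zero => exact fun v hv => h1 v hv
    | succ m ih =>
      intro v hv
      have hw := ih (φ v) (by rwa [Function.iterate_succ_apply] at hv)
      have hadj : (funGraph φ).Adj v (φ v) := ⟨(hφ v).symm, Or.inl rfl⟩
      rw [hg] at hadj
      rcases hadj.2 with h | h
      · exact h.symm
      -- Here `φ` and `ψ` traverse the edge in opposite directions. Then `v` and `φ v` form a
      -- 2-cycle of `φ`, so the orbit of `v` is this pair and meets `B`. If it does so only at `φ
      -- v`, the agreement at images of points of `B` is needed.
      · have hcyc : φ (φ v) = v := hw.trans h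
        have horb : ∀ i, φ^[i] v = v ∨ φ^[i] v = φ v := by
          intro i
          induction i with
          | zero => exact Or.inl rfl
          | succ i ih =>
            rw [Function.iterate_succ_apply']
            rcases ih with h | h
            · rw [h]; exact Or.inr rfl
            · rw [h]; exact Or.inl hcyc
        rcases horb (m + 1) with h3 | h3
        · rw [h3] at hv; exact h1 v hv
        · rw [h3] at hv
          have := h2 _ hv
          rwa [hcyc] at this
  funext v
  obtain ⟨i, hi⟩ := hB v
  exact key i v hi

-- Out-edges are deleted at `B`, at the reserve and at all preimages of the reserve. Every vertex
-- then still reaches a deleted one, which becomes a root; a root trades its out-edge for a free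
-- slot, so loads stay at most in-degree plus one. Reserve vertices become isolated.
open Classical in
theorem exists_tree_near [Fintype V] [Nonempty V] {G : SimpleGraph V} {k M : ℕ}
    (R : Reserve G k M) (hk : 3 ≤ k) (a a' : ℕ) (φ : V → V) (hφ : ∀ v, G.Adj v (φ v))
    (hin : ∀ x, indeg φ x + 1 ≤ k) (B : Finset V) (hB : ∀ v, ∃ i, φ^[i] v ∈ B)
    (havail : ∀ w, a' ≤ (Finset.univ.filter (fun x => G.Adj w x ∧ indeg φ x + 2 ≤ k)).card)
    (ha : a + B.card + (k + 1) * R.Q.card ≤ a')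
    (hM : ∀ q, a * q ≤ Fintype.card V → q + 2 * k ≤ M) (hQa : R.Q.card ≤ a) :
    ∃ T : SimpleGraph V, T ≤ G ∧ T.IsTree ∧ (∀ v, deg T v ≤ k) ∧
      ((funGraph φ).edgeSet \ T.edgeSet).ncard ≤ 2 * B.card + 3 * k * R.Q.card + 1 ∧
      (T.edgeSet \ (funGraph φ).edgeSet).ncard ≤ 2 * B.card + 3 * k * R.Q.card + 1 := by
  set P := R.Q.biUnion (fun q => Finset.univ.filter (fun v => φ v = q)) with hP
  set Z := B ∪ (R.Q ∪ P) with hZ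
  have hPc : P.card + R.Q.card ≤ k * R.Q.card := by
    have h1 : P.card ≤ ∑ q ∈ R.Q, indeg φ q := Finset.card_biUnion_le
    have h2 : ∑ q ∈ R.Q, (indeg φ q + 1) ≤ ∑ q ∈ R.Q, k := Finset.sum_le_sum (fun q _ => hin q)
    rw [Finset.sum_add_distrib] at h2
    simp only [Finset.sum_const, smul_eq_mul, mul_one] at h2
    rw [mul_comm] at h2
    rw [mul_comm]
    rw [mul_comm] at h2
    omega
  have hZc : Z.card ≤ B.card + k * R.Q.card := by
    have h1 : Z.card ≤ _ := Finset.card_union_le B (R.Q ∪ P)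
    have h2 := Finset.card_union_le R.Q P
    omega
  have hBZ : B ⊆ Z := Finset.subset_union_left
  have hQZ : R.Q ⊆ Z := Finset.subset_union_left.trans Finset.subset_union_right
  have hPZ : ∀ v, φ v ∈ R.Q → v ∈ Z := by
    intro v hv
    refine Finset.mem_union_right _ (Finset.mem_union_right _ ?_)
    rw [hP, Finset.mem_biUnion]
    exact ⟨φ v, hv, by simp⟩
  let F : SimpleGraph V :=
    { Adj := fun u v => u ≠ v ∧ ((u ∉ Z ∧ φ u = v) ∨ (v ∉ Z ∧ φ v = u))
      symm := ⟨fun _ _ h => ⟨h.1.symm, h.2.symm⟩⟩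
      loopless := ⟨fun _ h => h.1 rfl⟩ }
  have hFφ : F ≤ funGraph φ := by
    rintro u v ⟨h, h' | h'⟩
    · exact ⟨h, Or.inl h'.2⟩
    · exact ⟨h, Or.inr h'.2⟩
  have hFG : F ≤ G := by
    rintro u v ⟨h, ⟨-, rfl⟩ | ⟨-, rfl⟩⟩
    · exact hφ u
    · exact (hφ v).symm
  have hloadF : ∀ v, load F Z v ≤ indeg φ v + 1 := by
    intro v
    have hind : indeg φ v = ((Finset.univ.filter (fun u => φ u = v) : Finset V) : Set V).ncard := by
      rw [Set.ncard_coe_finset]; rfl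
    by_cases hv : v ∈ Z
    · simp only [load, hv, if_true, Nat.add_le_add_iff_right]
      rw [hind]
      apply Set.ncard_le_ncard _ (Set.toFinite _)
      rintro u ⟨h, h' | h'⟩
      · exact absurd hv h'.1
      · simpa using h'.2
    · simp only [load, hv, if_false, add_zero]
      refine le_trans (Set.ncard_le_ncard (t := insert (φ v)
        ((Finset.univ.filter (fun u => φ u = v) : Finset V) : Set V)) ?_ (Set.toFinite _)) ?_
      · rintro u ⟨h, h' | h'⟩
        · exact Or.inl h'.2.symm
        · right; simpa using h'.2
      · rw [hind]; exact Set.ncard_insert_le _ _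
  have hreach : ∀ v, ∃ z ∈ Z, F.Reachable v z := by
    intro v
    obtain ⟨i, hi⟩ := hB v
    induction i generalizing v with
    | zero => exact ⟨v, hBZ hi, by rfl⟩
    | succ i ih =>
      by_cases hv : v ∈ Z
      · exact ⟨v, hv, by rfl⟩
      · obtain ⟨z, hz, hvz⟩ := ih (φ v) (by rwa [Function.iterate_succ_apply] at hi)
        have hadj : F.Adj v (φ v) := ⟨(hφ v).ne, Or.inl ⟨hv, rfl⟩⟩
        exact ⟨z, hz, hadj.reachable.trans hvz⟩
  have hQ0 : ∀ q ∈ R.Q, deg F q = 0 := by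
    intro q hq
    apply deg_eq_zero_of
    rintro x ⟨-, h | h⟩
    · exact h.1 (hQZ hq)
    · exact h.1 (hPZ x (h.2 ▸ hq))
  obtain ⟨F', hFF', hF'G, hdeg', hconn', hnew'⟩ := R.exists_connected hk a F Z hFG
    (fun v => (hloadF v).trans (hin v)) hreach hQZ hQ0 (fun w => by
      have h1 : (Finset.univ.filter (fun x => G.Adj w x ∧ indeg φ x + 2 ≤ k)) \ R.Q ⊆
          Finset.univ.filter (fun x => G.Adj w x ∧ x ∉ R.Q ∧ load F Z x + 1 ≤ k) := by
        intro x hx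
        simp only [Finset.mem_sdiff, Finset.mem_filter, Finset.mem_univ, true_and] at hx ⊢
        have := hloadF x
        exact ⟨hx.1.1, hx.2, by omega⟩
      have h2 := Finset.card_le_card h1
      have h3 := Finset.le_card_sdiff R.Q
        (Finset.univ.filter (fun x => G.Adj w x ∧ indeg φ x + 2 ≤ k))
      have h4 := havail w
      have h5 : (k + 1) * R.Q.card = k * R.Q.card + R.Q.card := by ring
      omega) hM hQa
  obtain ⟨T, hTF, hT⟩ := hconn'.exists_isTree_le
  have hΓF : ((funGraph φ).edgeSet \ F.edgeSet).ncard ≤ Z.card := by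
    have h1 : (funGraph φ).edgeSet \ F.edgeSet ⊆ ((Z.image (fun v => s(v, φ v)) : Finset _) :
        Set (Sym2 V)) := by
      rintro e ⟨he, he'⟩
      induction e with
      | _ x y =>
        rw [SimpleGraph.mem_edgeSet] at he he'
        rw [Finset.mem_coe, Finset.mem_image]
        rcases he with ⟨hne, h | h⟩
        · refine ⟨x, ?_, by rw [h]⟩
          by_contra hx
          exact he' ⟨hne, Or.inl ⟨hx, h⟩⟩
        · refine ⟨y, ?_, by rw [h]; exact Sym2.eq_swap⟩
          by_contra hx
          exact he' ⟨hne, Or.inr ⟨hx, h⟩⟩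
    have h2 := Set.ncard_le_ncard h1 (Set.toFinite _)
    rw [Set.ncard_coe_finset] at h2
    exact h2.trans Finset.card_image_le
  have hFc : F.edgeSet.ncard ≤ Fintype.card V := by
    have h1 : F.edgeSet ⊆ ((Finset.univ.image (fun v => s(v, φ v)) : Finset _) :
        Set (Sym2 V)) := by
      rintro e he
      induction e with
      | _ x y =>
        rw [Finset.mem_coe, Finset.mem_image]
        rcases he with ⟨hne, h | h⟩
        · exact ⟨x, Finset.mem_univ _, by rw [h.2]⟩
        · exact ⟨y, Finset.mem_univ _, by rw [h.2]; exact Sym2.eq_swap⟩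
    have h2 := Set.ncard_le_ncard h1 (Set.toFinite _)
    rw [Set.ncard_coe_finset] at h2
    exact h2.trans Finset.card_image_le
  have hTc : T.edgeSet.ncard + 1 = Fintype.card V := by
    rw [← hT.card_edgeFinset, ← SimpleGraph.coe_edgeFinset, Set.ncard_coe_finset]
  -- `F` has at most n edges, one at most for each vertex, and `T` has n - 1. So cutting the
  -- connected graph down to a spanning tree loses few edges.
  have hF'T : (F'.edgeSet \ T.edgeSet).ncard ≤ Z.card + k * R.Q.card + 1 := by
    have hsub : T.edgeSet ⊆ F'.edgeSet := SimpleGraph.edgeSet_subset_edgeSet.2 hTF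
    have h1 := Set.ncard_sdiff_add_ncard_of_subset hsub (Set.toFinite _)
    have h2 : F'.edgeSet.ncard ≤ (F'.edgeSet \ F.edgeSet).ncard + F.edgeSet.ncard :=
      Set.ncard_le_ncard_sdiff_add_ncard _ _ (Set.toFinite _)
    omega
  have h3k : 3 * k * R.Q.card = 3 * (k * R.Q.card) := by ring
  refine ⟨T, hTF.trans hF'G, hT, fun v => (deg_mono hTF v).trans (hdeg' v), ?_, ?_⟩
  · have hsub : (funGraph φ).edgeSet \ T.edgeSet ⊆
        ((funGraph φ).edgeSet \ F.edgeSet) ∪ (F'.edgeSet \ T.edgeSet) := by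
      intro e he
      by_cases heF : e ∈ F.edgeSet
      · exact Or.inr ⟨SimpleGraph.edgeSet_subset_edgeSet.2 hFF' heF, he.2⟩
      · exact Or.inl ⟨he.1, heF⟩
    have h1 := (Set.ncard_le_ncard hsub (Set.toFinite _)).trans (Set.ncard_union_le _ _)
    omega
  · have hsub : T.edgeSet \ (funGraph φ).edgeSet ⊆ F'.edgeSet \ F.edgeSet := by
      intro e he
      exact ⟨SimpleGraph.edgeSet_subset_edgeSet.2 hTF he.1,
        fun h => he.2 (SimpleGraph.edgeSet_subset_edgeSet.2 hFφ h)⟩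
    have h1 := Set.ncard_le_ncard hsub (Set.toFinite _)
    omega

-- A set of at most E elements is the range of a partial function on `Fin E`; this gives the crude
-- bound (N + 1) ^ E.
open Classical in
theorem card_filter_card_le {α : Type*} [Fintype α] (E : ℕ) :
    (Finset.univ.filter (fun A : Finset α => A.card ≤ E)).card ≤ (Fintype.card α + 1) ^ E := by
  have h : Finset.univ.filter (fun A : Finset α => A.card ≤ E) ⊆
      Finset.univ.image (fun f : Fin E → Option α =>
        Finset.univ.filter (fun x : α => ∃ i, f i = some x)) := by
    intro A hA
    simp only [Finset.mem_filter, Finset.mem_univ, true_and] at hA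
    rw [Finset.mem_image]
    refine ⟨fun i => if h : i.1 < A.card then some (A.equivFin.symm ⟨i, h⟩ : α) else none,
      Finset.mem_univ _, ?_⟩
    ext x
    simp only [Finset.mem_filter, Finset.mem_univ, true_and]
    constructor
    · rintro ⟨i, hi⟩
      by_cases h : i.1 < A.card
      · rw [dif_pos h, Option.some_inj] at hi
        rw [← hi]; exact Finset.coe_mem _
      · rw [dif_neg h] at hi; cases hi
    · intro hx
      refine ⟨⟨A.equivFin ⟨x, hx⟩, (A.equivFin ⟨x, hx⟩).2.trans_le hA⟩, ?_⟩
      simp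
  refine (Finset.card_le_card h).trans (Finset.card_image_le.trans ?_)
  rw [Finset.card_univ, Fintype.card_fun, Fintype.card_option, Fintype.card_fin]

open Classical in
/-- Few maps are close to the same tree. -/
theorem card_le_mul_numSpanningTrees [Fintype V] [Nonempty V] (G : SimpleGraph V) (k E t : ℕ)
    (Ψ : Finset (V → V)) (hfix : ∀ φ ∈ Ψ, ∀ v, φ v ≠ v)
    (hB : ∀ φ ∈ Ψ, ∃ B : Finset V, B.card ≤ t ∧ ∀ v, ∃ i, φ^[i] v ∈ B)
    (hT : ∀ φ ∈ Ψ, ∃ T : SimpleGraph V, T ≤ G ∧ T.IsTree ∧ (∀ v, deg T v ≤ k) ∧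
      ((funGraph φ).edgeSet \ T.edgeSet).ncard ≤ E ∧
      (T.edgeSet \ (funGraph φ).edgeSet).ncard ≤ E) :
    Ψ.card ≤ numSpanningTrees G k * (Fintype.card V ^ 2 + 1) ^ (2 * E + 2 * t) := by
  choose! B hBc hBo using hB
  choose! T hTG hTt hTd hT1 hT2 using hT
  let 𝓣 : Finset (SimpleGraph V) := Finset.univ.filter
    (fun T => T ≤ G ∧ T.IsTree ∧ T.maxDegree ≤ k)
  have h𝓣 : 𝓣.card = numSpanningTrees G k := by
    rw [numSpanningTrees, ← Set.ncard_coe_finset]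
    congr 1
    ext T
    simp [𝓣]
  let 𝓢 : Finset (Finset (Sym2 V)) := Finset.univ.filter (fun A => A.card ≤ E)
  let 𝓥 : Finset (Finset (V × V)) := Finset.univ.filter (fun A => A.card ≤ 2 * t)
  have h𝓢 : 𝓢.card ≤ (Fintype.card V ^ 2 + 1) ^ E := by
    refine (card_filter_card_le E).trans (Nat.pow_le_pow_left ?_ _)
    have := Fintype.card_le_of_surjective _ (Sym2.mk_surjective (α := V))
    rw [Fintype.card_prod, ← sq] at this
    omega
  have h𝓥 : 𝓥.card ≤ (Fintype.card V ^ 2 + 1) ^ (2 * t) := by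
    refine (card_filter_card_le (2 * t)).trans ?_
    rw [Fintype.card_prod, ← sq]
  -- The tree and the two edge differences determine the graph of φ; the values of φ on `B` and on
  -- its image then determine φ, by `eq_of_funGraph_eq`.
  let W : (V → V) → Finset (V × V) := fun φ =>
    (B φ).image (fun b => (b, φ b)) ∪ (B φ).image (fun b => (φ b, φ (φ b)))
  have hinj : Ψ.card ≤ (𝓣 ×ˢ 𝓢 ×ˢ 𝓢 ×ˢ 𝓥).card := by
    refine Finset.card_le_card_of_injOn (fun φ => (T φ,
      ((funGraph φ).edgeSet \ (T φ).edgeSet).toFinset,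
      ((T φ).edgeSet \ (funGraph φ).edgeSet).toFinset, W φ)) ?_ ?_
    · intro φ hφ
      rw [Finset.mem_coe] at hφ ⊢
      simp only [Finset.mem_product, 𝓣, 𝓢, 𝓥, Finset.mem_filter, Finset.mem_univ, true_and]
      refine ⟨⟨hTG φ hφ, hTt φ hφ, ?_⟩, ?_, ?_, ?_⟩
      · apply SimpleGraph.maxDegree_le_of_forall_degree_le
        intro v
        have h1 := hTd φ hφ v
        rwa [deg, Set.ncard_eq_toFinset_card', ← SimpleGraph.neighborFinset_def,
          SimpleGraph.card_neighborFinset_eq_degree] at h1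
      · rw [← Set.ncard_eq_toFinset_card']; exact hT1 φ hφ
      · rw [← Set.ncard_eq_toFinset_card']; exact hT2 φ hφ
      · have h1 := Finset.card_union_le ((B φ).image (fun b => (b, φ b)))
          ((B φ).image (fun b => (φ b, φ (φ b))))
        have h2 : ((B φ).image (fun b => (b, φ b))).card ≤ _ := Finset.card_image_le
        have h3 : ((B φ).image (fun b => (φ b, φ (φ b)))).card ≤ _ := Finset.card_image_le
        have h4 := hBc φ hφ
        simp only [W]
        omega
    · intro φ hφ ψ hψ h
      rw [Finset.mem_coe] at hφ hψ
      simp only [Prod.mk.injEq] at h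
      obtain ⟨e1, e2, e3, e4⟩ := h
      rw [Set.toFinset_inj, e1] at e2 e3
      have hg : funGraph φ = funGraph ψ := by
        rw [← SimpleGraph.edgeSet_inj]
        ext e
        have a2 := Set.ext_iff.1 e2 e
        have a3 := Set.ext_iff.1 e3 e
        simp only [Set.mem_sdiff] at a2 a3
        tauto
      have hmemW : ∀ χ : V → V, ∀ p ∈ W χ, χ p.1 = p.2 := by
        intro χ p hp
        simp only [W, Finset.mem_union, Finset.mem_image] at hp
        rcases hp with ⟨b, -, rfl⟩ | ⟨b, -, rfl⟩ <;> rfl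
      refine eq_of_funGraph_eq (hfix φ hφ) hg (B φ) (hBo φ hφ) ?_ ?_
      · intro b hb
        have : (b, φ b) ∈ W φ :=
          Finset.mem_union_left _ (Finset.mem_image.2 ⟨b, hb, rfl⟩)
        rw [e4] at this
        exact (hmemW ψ _ this).symm
      · intro b hb
        have : (φ b, φ (φ b)) ∈ W φ :=
          Finset.mem_union_right _ (Finset.mem_image.2 ⟨b, hb, rfl⟩)
        rw [e4] at this
        exact (hmemW ψ _ this).symm
  rw [Finset.card_product, Finset.card_product, Finset.card_product, h𝓣] at hinj
  refine hinj.trans (Nat.mul_le_mul_left _ ?_)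
  calc 𝓢.card * (𝓢.card * 𝓥.card) ≤ (Fintype.card V ^ 2 + 1) ^ E *
        ((Fintype.card V ^ 2 + 1) ^ E * (Fintype.card V ^ 2 + 1) ^ (2 * t)) :=
        Nat.mul_le_mul h𝓢 (Nat.mul_le_mul h𝓢 h𝓥)
    _ = _ := by rw [← pow_add, ← pow_add]; congr 1; ring
end Functional

/-! ### Short cycles are rare -/

section Cycles
variable {V : Type*}

open Classical in
/-- The number of points of `M` on cycles of `φ` of length at most `s`. -/
noncomputable def shortCount (φ : V → V) (M : Finset V) (s : ℕ) : ℕ :=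
  (M.filter (fun u => 1 ≤ Function.minimalPeriod φ u ∧ Function.minimalPeriod φ u ≤ s)).card

theorem apply_iterate (φ : V → V) (n : ℕ) (v : V) : φ (φ^[n] v) = φ^[n + 1] v :=
  (Function.iterate_succ_apply' φ n v).symm

theorem iterate_apply (φ : V → V) (n : ℕ) (v : V) : φ^[n] (φ v) = φ^[n + 1] v :=
  (Function.iterate_succ_apply φ n v).symm

theorem iterate_ne_last {φ : V → V} {v : V} {l : ℕ} (h : Function.minimalPeriod φ v = l + 1)
    {i : ℕ} (hi : i < l) : φ^[i] v ≠ φ^[l] v := by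
  intro heq
  have h1 : φ^[i + 1] v = v := by
    rw [Function.iterate_succ_apply', heq, apply_iterate φ, ← h]
    exact Function.iterate_minimalPeriod
  exact Function.not_isPeriodicPt_of_pos_of_lt_minimalPeriod (n := i + 1) (by omega) (by omega) h1

theorem iterate_update_of_period [DecidableEq V] {φ : V → V} {v : V} {l : ℕ}
    (h : Function.minimalPeriod φ v = l + 1) (w : V) {i : ℕ} (hi : i ≤ l) :
    (Function.update φ (φ^[l] v) w)^[i] v = φ^[i] v := by
  induction i with
  | zero => rfl
  | succ i ih =>
    rw [Function.iterate_succ_apply', ih (by omega), Function.iterate_succ_apply',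
      Function.update_of_ne (iterate_ne_last h (by omega))]

-- Switching: redirect the last vertex u = φ^l v of the cycle from v to any of A targets. This is
-- reversible, since the path from v to u is not affected: u is still the l-th iterate of v, and its
-- old image was v. The tag in τ lets the set of vertices allowed to move depend on more than the
-- current map.
open Classical in
theorem mul_card_period_le [Fintype V] {τ : Type*} (X : Finset (τ × (V → V))) (M : τ → Finset V)
    (A : ℕ) (hA : ∀ x ∈ X, ∀ u ∈ M x.1,
      ∃ W : Finset V, A ≤ W.card ∧ ∀ w ∈ W, (x.1, Function.update x.2 u w) ∈ X) (v : V) (l : ℕ) :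
    A * (X.filter (fun x => Function.minimalPeriod x.2 v = l + 1 ∧ x.2^[l] v ∈ M x.1)).card ≤
      X.card := by
  set Y := X.filter (fun x => Function.minimalPeriod x.2 v = l + 1 ∧ x.2^[l] v ∈ M x.1) with hY
  let S : Finset (Σ _ : τ × (V → V), V) := Y.sigma (fun x =>
    Finset.univ.filter (fun w => (x.1, Function.update x.2 (x.2^[l] v) w) ∈ X))
  have h1 : A * Y.card ≤ S.card := by
    rw [Finset.card_sigma, mul_comm, ← smul_eq_mul]
    apply Finset.card_nsmul_le_sum
    intro x hx
    rw [hY, Finset.mem_filter] at hx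
    obtain ⟨W, hWA, hW⟩ := hA x hx.1 _ hx.2.2
    exact hWA.trans (Finset.card_le_card fun w hw =>
      Finset.mem_filter.2 ⟨Finset.mem_univ _, hW w hw⟩)
  refine h1.trans (Finset.card_le_card_of_injOn
    (fun p => (p.1.1, Function.update p.1.2 (p.1.2^[l] v) p.2)) ?_ ?_)
  · intro p hp
    rw [Finset.mem_coe, Finset.mem_sigma] at hp
    exact (Finset.mem_filter.1 hp.2).2
  · rintro ⟨⟨t, φ⟩, w⟩ hp ⟨⟨t', ψ⟩, w'⟩ hq h
    simp only [S, hY, Finset.coe_sigma, Set.mem_sigma_iff, Finset.mem_coe, Finset.mem_filter,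
      Finset.mem_univ, true_and] at hp hq
    simp only [Prod.mk.injEq] at h
    obtain ⟨rfl, h⟩ := h
    have e1 := iterate_update_of_period hp.1.2.1 w le_rfl
    have e2 := iterate_update_of_period hq.1.2.1 w' le_rfl
    rw [h, e2] at e1
    have hw : w = w' := by
      have := congrFun h (φ^[l] v)
      rwa [Function.update_self, ← e1, Function.update_self] at this
    have p1 : φ (φ^[l] v) = v := by
      rw [apply_iterate φ, ← hp.1.2.1]; exact Function.iterate_minimalPeriod
    have p2 : ψ (ψ^[l] v) = v := by
      rw [apply_iterate ψ, ← hq.1.2.1]; exact Function.iterate_minimalPeriod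
    have hφ : φ = ψ := by
      funext y
      by_cases hy : y = φ^[l] v
      · rw [hy, p1, ← e1, p2]
      · have := congrFun h y
        rwa [Function.update_of_ne hy, Function.update_of_ne (e1 ▸ hy)] at this
    subst hφ hw
    rfl

-- A point u of M on a cycle of length l + 1 is recorded by v = φ u, from which u is the l-th
-- iterate. The switching bound is then summed over v and over the s possible lengths.
open Classical in
theorem mul_sum_shortCount_le [Fintype V] {τ : Type*} (X : Finset (τ × (V → V)))
    (M : τ → Finset V) (A s : ℕ) (hA : ∀ x ∈ X, ∀ u ∈ M x.1,
      ∃ W : Finset V, A ≤ W.card ∧ ∀ w ∈ W, (x.1, Function.update x.2 u w) ∈ X) :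
    A * ∑ x ∈ X, shortCount x.2 (M x.1) s ≤ s * Fintype.card V * X.card := by
  have h1 : ∀ x ∈ X, shortCount x.2 (M x.1) s ≤ ∑ l ∈ Finset.range s, ∑ v : V,
      if Function.minimalPeriod x.2 v = l + 1 ∧ x.2^[l] v ∈ M x.1 then 1 else 0 := by
    intro x _
    simp only [← Finset.card_filter]
    have h2 : (M x.1).filter (fun u => 1 ≤ Function.minimalPeriod x.2 u ∧
        Function.minimalPeriod x.2 u ≤ s) ⊆ (Finset.range s).biUnion (fun l =>
          (M x.1).filter (fun u => Function.minimalPeriod x.2 u = l + 1)) := by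
      intro u hu
      rw [Finset.mem_filter] at hu
      rw [Finset.mem_biUnion]
      exact ⟨Function.minimalPeriod x.2 u - 1, Finset.mem_range.2 (by omega),
        Finset.mem_filter.2 ⟨hu.1, by omega⟩⟩
    refine (Finset.card_le_card h2).trans (Finset.card_biUnion_le.trans
      (Finset.sum_le_sum fun l _ => ?_))
    have hback : ∀ u, Function.minimalPeriod x.2 u = l + 1 → x.2^[l] (x.2 u) = u := by
      intro u hu
      rw [iterate_apply, ← hu]; exact Function.iterate_minimalPeriod
    refine Finset.card_le_card_of_injOn x.2 ?_ ?_
    · intro u hu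
      rw [Finset.mem_coe, Finset.mem_filter] at hu
      rw [Finset.mem_coe, Finset.mem_filter]
      refine ⟨Finset.mem_univ _, ?_, ?_⟩
      · rw [Function.minimalPeriod_apply]
        · exact hu.2
        · exact Function.minimalPeriod_pos_iff_mem_periodicPts.1 (by omega)
      · rw [hback u hu.2]; exact hu.1
    · intro u hu u' hu' h
      rw [Finset.mem_coe, Finset.mem_filter] at hu hu'
      rw [← hback u hu.2, ← hback u' hu'.2, h]
  calc A * ∑ x ∈ X, shortCount x.2 (M x.1) s
      ≤ A * ∑ x ∈ X, ∑ l ∈ Finset.range s, ∑ v : V,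
        (if Function.minimalPeriod x.2 v = l + 1 ∧ x.2^[l] v ∈ M x.1 then 1 else 0) :=
        Nat.mul_le_mul_left _ (Finset.sum_le_sum h1)
    _ = ∑ l ∈ Finset.range s, ∑ v : V, A * (X.filter (fun x =>
        Function.minimalPeriod x.2 v = l + 1 ∧ x.2^[l] v ∈ M x.1)).card := by
        rw [Finset.sum_comm, Finset.mul_sum]
        apply Finset.sum_congr rfl
        intro l _
        rw [Finset.sum_comm, Finset.mul_sum]
        apply Finset.sum_congr rfl
        intro v _
        rw [Finset.card_filter]
    _ ≤ ∑ l ∈ Finset.range s, ∑ v : V, X.card :=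
        Finset.sum_le_sum fun l _ => Finset.sum_le_sum fun v _ => mul_card_period_le X M A hA v l
    _ = _ := by simp [mul_assoc]

theorem exists_iterate_mem_periodicPts [Finite V] (φ : V → V) (v : V) :
    ∃ i, φ^[i] v ∈ Function.periodicPts φ := by
  obtain ⟨i, j, hij, h⟩ := Finite.exists_ne_map_eq_of_infinite (fun i : ℕ => φ^[i] v)
  wlog hlt : i < j generalizing i j
  · exact this j i hij.symm h.symm (by omega)
  refine ⟨i, Function.mk_mem_periodicPts (n := j - i) (by omega) ?_⟩
  rw [Function.IsPeriodicPt, Function.IsFixedPt, ← Function.iterate_add_apply,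
    Nat.sub_add_cancel hlt.le]
  exact h.symm

open Classical in
/-- The long cycles are met by few points. -/
theorem exists_longCycle_set [Fintype V] (φ : V → V) (s : ℕ) (hs : 0 < s) :
    ∃ B : Finset V, B.card ≤ Fintype.card V / s ∧
      ∀ y ∈ Function.periodicPts φ, s < Function.minimalPeriod φ y → ∃ i, φ^[i] y ∈ B := by
  let O : V → Set V := fun y => {x | ∃ i, φ^[i] y = x}
  have hOself : ∀ y, y ∈ O y := fun y => ⟨0, rfl⟩
  let rep : V → V := fun y => @Classical.epsilon V ⟨y⟩ (fun x => x ∈ O y)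
  have hrepO : ∀ y, rep y ∈ O y := fun y => Classical.epsilon_spec ⟨y, hOself y⟩
  have hrepeq : ∀ y z, O y = O z → rep y = rep z := by
    intro y z h
    simp only [rep, h]
  have hOstep : ∀ y ∈ Function.periodicPts φ, ∀ i, O (φ^[i] y) = O y := by
    intro y hy i
    obtain ⟨n, hn, hper⟩ := hy
    ext x
    constructor
    · rintro ⟨j, rfl⟩
      exact ⟨j + i, Function.iterate_add_apply _ _ _ _⟩
    · rintro ⟨j, rfl⟩
      refine ⟨j + (n * i - i), ?_⟩
      have h1 : i ≤ n * i := Nat.le_mul_of_pos_left i hn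
      rw [← Function.iterate_add_apply, add_assoc, Nat.sub_add_cancel h1,
        Function.iterate_add_apply, (hper.mul_const i).eq]
  let P : Finset V := Finset.univ.filter
    (fun y => y ∈ Function.periodicPts φ ∧ s < Function.minimalPeriod φ y)
  have hperiter : ∀ y ∈ Function.periodicPts φ, ∀ i,
      φ^[i] y ∈ Function.periodicPts φ ∧
      Function.minimalPeriod φ (φ^[i] y) = Function.minimalPeriod φ y := by
    intro y hy i
    have h := Function.minimalPeriod_apply_iterate hy i
    refine ⟨?_, h⟩
    rw [← Function.minimalPeriod_pos_iff_mem_periodicPts, h]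
    exact Function.minimalPeriod_pos_of_mem_periodicPts hy
  refine ⟨P.image rep, ?_, ?_⟩
  · rw [Nat.le_div_iff_mul_le hs]
    have hB : ∀ b ∈ P.image rep, b ∈ Function.periodicPts φ ∧
        s < Function.minimalPeriod φ b ∧ rep b = b := by
      intro b hb
      obtain ⟨y, hy, rfl⟩ := Finset.mem_image.1 hb
      simp only [P, Finset.mem_filter, Finset.mem_univ, true_and] at hy
      obtain ⟨i, hi⟩ := hrepO y
      have h1 := hperiter y hy.1 i
      rw [hi] at h1
      refine ⟨h1.1, h1.2 ▸ hy.2, ?_⟩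
      apply hrepeq
      conv_lhs => rw [← hi]
      exact hOstep y hy.1 i
    have h2 : (P.image rep ×ˢ Finset.range s).card ≤ (Finset.univ : Finset V).card := by
      refine Finset.card_le_card_of_injOn (fun p => φ^[p.2] p.1)
        (fun _ _ => Finset.mem_coe.2 (Finset.mem_univ _)) ?_
      rintro ⟨b, i⟩ hbi ⟨c, j⟩ hcj h
      rw [Finset.mem_coe, Finset.mem_product, Finset.mem_range] at hbi hcj
      simp only at h hbi hcj
      obtain ⟨hb, hbs, hbr⟩ := hB b hbi.1
      obtain ⟨hc, hcs, hcr⟩ := hB c hcj.1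
      have hbc : b = c := by
        rw [← hbr, ← hcr]
        apply hrepeq
        rw [← hOstep b hb i, h, hOstep c hc j]
      subst hbc
      have := Function.iterate_injOn_Iio_minimalPeriod (f := φ) (x := b)
        (Set.mem_Iio.2 (hbi.2.trans hbs)) (Set.mem_Iio.2 (hcj.2.trans hbs)) h
      rw [this]
    rw [Finset.card_product, Finset.card_range, Finset.card_univ] at h2
    exact h2
  · intro y hy hys
    obtain ⟨i, hi⟩ := hrepO y
    exact ⟨i, hi ▸ Finset.mem_image_of_mem _ (by simp [P, hy, hys])⟩

open Classical in
/-- A map that agrees with `φ` off `M` has a small set meeting all its orbits, if short cycles are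
rare. -/
theorem exists_orbit_hittingSet [Fintype V] (φ ψ : V → V) (M : Finset V)
    (h : ∀ v, v ∉ M → ψ v = φ v) (s : ℕ) (hs : 0 < s) :
    ∃ B : Finset V, B.card ≤ Fintype.card V / s + shortCount ψ M s +
      shortCount φ Finset.univ s ∧ ∀ v, ∃ i, ψ^[i] v ∈ B := by
  obtain ⟨B, hBc, hB⟩ := exists_longCycle_set ψ s hs
  refine ⟨B ∪ M.filter (fun u => 1 ≤ Function.minimalPeriod ψ u ∧
    Function.minimalPeriod ψ u ≤ s) ∪ Finset.univ.filter (fun u =>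
      1 ≤ Function.minimalPeriod φ u ∧ Function.minimalPeriod φ u ≤ s), ?_, ?_⟩
  · refine (Finset.card_union_le _ _).trans (Nat.add_le_add_right
      ((Finset.card_union_le _ _).trans (Nat.add_le_add_right hBc _)) _)
  · intro v
    obtain ⟨i, hi⟩ := exists_iterate_mem_periodicPts ψ v
    set y := ψ^[i] v with hy
    suffices ∃ j, ψ^[j] y ∈ _ by
      obtain ⟨j, hj⟩ := this
      refine ⟨j + i, ?_⟩
      rw [Function.iterate_add_apply]
      exact hj
    have hpos := Function.minimalPeriod_pos_of_mem_periodicPts hi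
    by_cases hlong : s < Function.minimalPeriod ψ y
    · obtain ⟨j, hj⟩ := hB y hi hlong
      exact ⟨j, Finset.mem_union_left _ (Finset.mem_union_left _ hj)⟩
    -- A short cycle of `ψ` either meets `M`, and is counted in `shortCount ψ M s`, or avoids `M`
    -- and is already a cycle of `φ`.
    · by_cases hM : ∃ j, ψ^[j] y ∈ M
      · obtain ⟨j, hj⟩ := hM
        refine ⟨j, Finset.mem_union_left _ (Finset.mem_union_right _ ?_)⟩
        rw [Finset.mem_filter, Function.minimalPeriod_apply_iterate hi]
        exact ⟨hj, hpos, by omega⟩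
      · push Not at hM
        have hiter : ∀ j, φ^[j] y = ψ^[j] y := by
          intro j
          induction j with
          | zero => rfl
          | succ j ih =>
            rw [Function.iterate_succ_apply', Function.iterate_succ_apply', ih, h _ (hM j)]
        have hper : Function.minimalPeriod φ y = Function.minimalPeriod ψ y := by
          apply Function.minimalPeriod_eq_minimalPeriod_iff.2
          intro n
          rw [Function.IsPeriodicPt, Function.IsPeriodicPt, Function.IsFixedPt,
            Function.IsFixedPt, hiter]
        refine ⟨0, Finset.mem_union_right _ ?_⟩
        rw [Finset.mem_filter, Function.iterate_zero_apply, hper]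
        exact ⟨Finset.mem_univ _, hpos, by omega⟩
end Cycles

/-! ### Redirecting the surplus vertices -/

section Redirect
variable {V : Type*}

open Classical in
/-- The maps sending every vertex to one of its neighbours. -/
noncomputable def choices [Fintype V] (G : SimpleGraph V) : Finset (V → V) :=
  Fintype.piFinset (fun v => Finset.univ.filter (fun u => G.Adj v u))

theorem mem_choices [Fintype V] {G : SimpleGraph V} {φ : V → V} :
    φ ∈ choices G ↔ ∀ v, G.Adj v (φ v) := by
  classical
  simp [choices]

open Classical in
theorem card_choices [Fintype V] {G : SimpleGraph V} {r : ℕ}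
    (hreg : ∀ v, (Finset.univ.filter (fun u => G.Adj v u)).card = r) :
    (choices G).card = r ^ Fintype.card V := by
  rw [choices, Fintype.card_piFinset, Finset.prod_congr rfl (fun v _ => hreg v), Finset.prod_const,
    Finset.card_univ]

/-- The total excess of the in-degrees over `q`. -/
noncomputable def excess [Fintype V] (φ : V → V) (q : ℕ) : ℕ := ∑ x, (indeg φ x - q)

open Classical in
/-- The maps that agree with `φ` off `M` and are injective on `M` with values in the sets `A u`. -/
noncomputable def redirects [Fintype V] (φ : V → V) (M : Finset V) (A : V → Finset V) :
    Finset (V → V) :=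
  Finset.univ.filter (fun ψ => (∀ v, v ∉ M → ψ v = φ v) ∧ (∀ u ∈ M, ψ u ∈ A u) ∧
    ∀ u ∈ M, ∀ v ∈ M, ψ u = ψ v → u = v)

theorem mem_redirects [Fintype V] {φ ψ : V → V} {M : Finset V} {A : V → Finset V} :
    ψ ∈ redirects φ M A ↔ (∀ v, v ∉ M → ψ v = φ v) ∧ (∀ u ∈ M, ψ u ∈ A u) ∧
    ∀ u ∈ M, ∀ v ∈ M, ψ u = ψ v → u = v := by
  simp [redirects]

-- The vertices of M are redirected one after another; injectivity forbids fewer than M.card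
-- targets, so at least a remain each time.
open Classical in
theorem pow_le_card_redirects [Fintype V] (φ : V → V) (M : Finset V) (A : V → Finset V) (a : ℕ)
    (hA : ∀ u, a + M.card ≤ (A u).card) : a ^ M.card ≤ (redirects φ M A).card := by
  induction M using Finset.induction_on with
  | empty =>
    rw [Finset.card_empty, pow_zero]
    exact Finset.card_pos.2 ⟨φ, mem_redirects.2 (by simp)⟩
  | insert u M hu ih =>
    rw [Finset.card_insert_of_notMem hu] at hA ⊢
    have h1 := ih (fun v => by have := hA v; omega)
    let S : Finset (Σ _ : V → V, V) := (redirects φ M A).sigma (fun ψ => A u \ M.image ψ)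
    have h2 : a ^ (M.card + 1) ≤ S.card := by
      rw [Finset.card_sigma]
      calc a ^ (M.card + 1) = a ^ M.card * a := pow_succ _ _
        _ ≤ (redirects φ M A).card * a := Nat.mul_le_mul_right _ h1
        _ ≤ _ := by
          rw [← smul_eq_mul]
          apply Finset.card_nsmul_le_sum
          intro ψ _
          have h3 := Finset.le_card_sdiff (M.image ψ) (A u)
          have h4 : (M.image ψ).card ≤ M.card := Finset.card_image_le
          have h5 := hA u
          omega
    refine h2.trans (Finset.card_le_card_of_injOn (fun p => Function.update p.1 u p.2) ?_ ?_)
    · rintro ⟨ψ, w⟩ hp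
      simp only [S, Finset.coe_sigma, Set.mem_sigma_iff, Finset.mem_coe, mem_redirects,
        Finset.mem_sdiff, Finset.mem_image, not_exists, not_and] at hp
      obtain ⟨⟨e1, e2, e3⟩, e4, e5⟩ := hp
      rw [Finset.mem_coe, mem_redirects]
      refine ⟨?_, ?_, ?_⟩
      · intro v hv
        rw [Finset.mem_insert, not_or] at hv
        simp only
        rw [Function.update_of_ne hv.1, e1 v hv.2]
      · intro v hv
        by_cases hvu : v = u
        · subst hvu; simpa using e4
        · simp only
          rw [Function.update_of_ne hvu]
          exact e2 v (Finset.mem_of_mem_insert_of_ne hv hvu)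
      · intro v hv v' hv' h
        simp only at h
        by_cases hvu : v = u
        · by_cases hvu' : v' = u
          · rw [hvu, hvu']
          · subst hvu
            rw [Function.update_self, Function.update_of_ne hvu'] at h
            exact absurd h.symm (e5 v' (Finset.mem_of_mem_insert_of_ne hv' hvu'))
        · by_cases hvu' : v' = u
          · subst hvu'
            rw [Function.update_self, Function.update_of_ne hvu] at h
            exact absurd h (e5 v (Finset.mem_of_mem_insert_of_ne hv hvu))
          · rw [Function.update_of_ne hvu, Function.update_of_ne hvu'] at h
            exact e3 v (Finset.mem_of_mem_insert_of_ne hv hvu) v'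
              (Finset.mem_of_mem_insert_of_ne hv' hvu') h
    · rintro ⟨ψ, w⟩ hp ⟨ψ', w'⟩ hq h
      simp only [S, Finset.coe_sigma, Set.mem_sigma_iff, Finset.mem_coe, mem_redirects] at hp hq
      simp only at h
      have hw : w = w' := by
        have := congrFun h u
        rwa [Function.update_self, Function.update_self] at this
      have hψ : ψ = ψ' := by
        funext v
        by_cases hvu : v = u
        · rw [hvu, hp.1.1 u hu, hq.1.1 u hu]
        · have := congrFun h v
          rwa [Function.update_of_ne hvu, Function.update_of_ne hvu] at this
      subst hw hψ
      rfl

-- Supplies the switching argument: moving one vertex of M again keeps the map in the family for at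
-- least a targets.
open Classical in
theorem le_card_update_redirects [Fintype V] (φ : V → V) (M : Finset V) (A : V → Finset V) (a : ℕ)
    (hA : ∀ u, a + M.card ≤ (A u).card) (ψ : V → V) (hψ : ψ ∈ redirects φ M A) (u : V)
    (hu : u ∈ M) :
    a ≤ (Finset.univ.filter (fun w => Function.update ψ u w ∈ redirects φ M A)).card := by
  rw [mem_redirects] at hψ
  obtain ⟨e1, e2, e3⟩ := hψ
  have h1 : A u \ M.image ψ ⊆
      Finset.univ.filter (fun w => Function.update ψ u w ∈ redirects φ M A) := by
    intro w hw
    rw [Finset.mem_sdiff, Finset.mem_image] at hw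
    have hw2 : ∀ v ∈ M, ψ v ≠ w := fun v hv h => hw.2 ⟨v, hv, h⟩
    rw [Finset.mem_filter, mem_redirects]
    refine ⟨Finset.mem_univ _, ?_, ?_, ?_⟩
    · intro v hv
      rw [Function.update_of_ne (by rintro rfl; exact hv hu), e1 v hv]
    · intro v hv
      by_cases hvu : v = u
      · subst hvu; rw [Function.update_self]; exact hw.1
      · rw [Function.update_of_ne hvu]; exact e2 v hv
    · intro v hv v' hv' h
      by_cases hvu : v = u
      · by_cases hvu' : v' = u
        · rw [hvu, hvu']
        · subst hvu
          rw [Function.update_self, Function.update_of_ne hvu'] at h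
          exact absurd h.symm (hw2 v' hv')
      · by_cases hvu' : v' = u
        · subst hvu'
          rw [Function.update_self, Function.update_of_ne hvu] at h
          exact absurd h (hw2 v hv)
        · rw [Function.update_of_ne hvu, Function.update_of_ne hvu'] at h
          exact e3 v hv v' hv' h
  have h2 := Finset.card_le_card h1
  have h3 := Finset.le_card_sdiff (M.image ψ) (A u)
  have h4 : (M.image ψ).card ≤ M.card := Finset.card_image_le
  have h5 := hA u
  omega

open Classical in
/-- A set of surplus vertices whose removal cuts all in-degrees to at most `q`. -/
theorem exists_surplus [Fintype V] (φ : V → V) (q : ℕ) :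
    ∃ M : Finset V, M.card = excess φ q ∧
      ∀ x, (Finset.univ.filter (fun v => v ∉ M ∧ φ v = x)).card ≤ q := by
  have h : ∀ x, ∃ A : Finset V, A ⊆ Finset.univ.filter (fun v => φ v = x) ∧
      A.card = indeg φ x - q := fun x =>
    Finset.exists_subset_card_eq (Nat.sub_le _ _)
  choose A hA hAc using h
  have hAφ : ∀ x v, v ∈ A x → φ v = x := fun x v hv => (Finset.mem_filter.1 (hA x hv)).2
  refine ⟨Finset.univ.biUnion A, ?_, ?_⟩
  · rw [Finset.card_biUnion, excess]
    · exact Finset.sum_congr rfl (fun x _ => hAc x)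
    · intro x _ y _ hxy
      rw [Function.onFun, Finset.disjoint_left]
      intro v hv hv'
      exact hxy ((hAφ x v hv).symm.trans (hAφ y v hv'))
  · intro x
    have h1 : Finset.univ.filter (fun v => v ∉ Finset.univ.biUnion A ∧ φ v = x) ⊆
        Finset.univ.filter (fun v => φ v = x) \ A x := by
      intro v hv
      simp only [Finset.mem_filter, Finset.mem_univ, true_and, Finset.mem_biUnion, not_exists,
        Finset.mem_sdiff] at hv ⊢
      exact ⟨hv.2, hv.1 x⟩
    refine (Finset.card_le_card h1).trans ?_
    rw [Finset.card_sdiff_of_subset (hA x), hAc x]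
    have : indeg φ x = (Finset.univ.filter (fun v => φ v = x)).card := rfl
    omega

-- Markov's inequality, with the mean of f at most N / A.
open Classical in
theorem card_le_two_mul_card_filter {α : Type*} (X : Finset α) (f : α → ℕ) (A N t : ℕ)
    (h : A * ∑ x ∈ X, f x ≤ N * X.card) (hN : 2 * N ≤ A * (t + 1)) (hpos : 0 < N) :
    X.card ≤ 2 * (X.filter (fun x => f x ≤ t)).card := by
  have h1 := Finset.card_filter_add_card_filter_not (s := X) (fun x => f x ≤ t)
  set Z := X.filter (fun x => ¬ f x ≤ t) with hZ
  have h2 : Z.card * (t + 1) ≤ ∑ x ∈ X, f x := by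
    rw [← smul_eq_mul]
    refine (Finset.card_nsmul_le_sum Z f _ ?_).trans
      (Finset.sum_le_sum_of_subset (Finset.filter_subset _ _))
    intro x hx
    rw [hZ, Finset.mem_filter] at hx
    omega
  have h4 : 2 * Z.card * N ≤ X.card * N := by
    calc 2 * Z.card * N = Z.card * (2 * N) := by ring
      _ ≤ Z.card * (A * (t + 1)) := Nat.mul_le_mul_left _ hN
      _ = A * (Z.card * (t + 1)) := by ring
      _ ≤ A * ∑ x ∈ X, f x := Nat.mul_le_mul_left _ h2
      _ ≤ _ := h.trans (by rw [mul_comm])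
  have := Nat.le_of_mul_le_mul_right h4 hpos
  omega

/-- A map `ψ` obtained from `φ` by redirecting the surplus vertices `M`. -/
structure IsRedirect [Fintype V] (G : SimpleGraph V) (k : ℕ) (φ ψ : V → V) (M : Finset V) :
    Prop where
  eq_of_notMem : ∀ v, v ∉ M → ψ v = φ v
  adj : ∀ u ∈ M, G.Adj u (ψ u)
  indeg_le : ∀ u ∈ M, indeg φ (ψ u) + 2 ≤ k
  inj : ∀ u ∈ M, ∀ v ∈ M, ψ u = ψ v → u = v

theorem indeg_kept_le [Fintype V] (φ : V → V) (M : Finset V) (y : V)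
    [DecidablePred fun v => v ∉ M ∧ φ v = y] :
    (Finset.univ.filter (fun v => v ∉ M ∧ φ v = y)).card ≤ indeg φ y := by
  classical
  apply Finset.card_le_card
  intro v hv
  simp only [Finset.mem_filter, Finset.mem_univ, true_and] at hv ⊢
  exact hv.2

open Classical in
theorem IsRedirect.indeg_le_add [Fintype V] {G : SimpleGraph V} {k : ℕ} {φ ψ : V → V} {M : Finset V}
    (h : IsRedirect G k φ ψ M) (y : V) : indeg ψ y ≤
      (Finset.univ.filter (fun v => v ∉ M ∧ φ v = y)).card +
      (M.filter (fun v => ψ v = y)).card := by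
  refine le_trans (Finset.card_le_card ?_) (Finset.card_union_le _ _)
  intro v hv
  simp only [Finset.mem_filter, Finset.mem_univ, true_and, Finset.mem_union] at hv ⊢
  by_cases hvM : v ∈ M
  · exact Or.inr ⟨hvM, hv⟩
  · exact Or.inl ⟨hvM, (h.eq_of_notMem v hvM).symm.trans hv⟩

theorem IsRedirect.mem_choices [Fintype V] {G : SimpleGraph V} {k : ℕ} {φ ψ : V → V}
    {M : Finset V} (h : IsRedirect G k φ ψ M) (hφ : φ ∈ choices G) : ψ ∈ choices G := by
  rw [BoundedDegreeTrees.mem_choices]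
  intro v
  by_cases hv : v ∈ M
  · exact h.adj v hv
  · rw [h.eq_of_notMem v hv]
    exact BoundedDegreeTrees.mem_choices.1 hφ v

-- A target of a redirected vertex had in-degree at most k - 2 and gains one preimage; any other
-- vertex only keeps preimages outside M, at most k - 1.
open Classical in
theorem IsRedirect.indeg_succ_le [Fintype V] {G : SimpleGraph V} {k : ℕ} {φ ψ : V → V}
    {M : Finset V} (h : IsRedirect G k φ ψ M) (hk : 1 ≤ k)
    (hM : ∀ x, (Finset.univ.filter (fun v => v ∉ M ∧ φ v = x)).card ≤ k - 1) (y : V) :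
    indeg ψ y + 1 ≤ k := by
  have h1 := h.indeg_le_add y
  have h2 := indeg_kept_le φ M y
  have h3 := hM y
  have h4 : (M.filter (fun v => ψ v = y)).card ≤ 1 := by
    rw [Finset.card_le_one]
    intro u hu v hv
    rw [Finset.mem_filter] at hu hv
    exact h.inj u hu.1 v hv.1 (hu.2.trans hv.2.symm)
  rcases Finset.eq_empty_or_nonempty (M.filter (fun v => ψ v = y)) with h5 | ⟨u, hu⟩
  · rw [h5, Finset.card_empty] at h1
    omega
  · rw [Finset.mem_filter] at hu
    have h6 := h.indeg_le u hu.1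
    rw [hu.2] at h6
    omega

open Classical in
theorem IsRedirect.le_card_avail [Fintype V] {G : SimpleGraph V} {k a m : ℕ} {φ ψ : V → V}
    {M : Finset V} (h : IsRedirect G k φ ψ M) (hm : M.card = m) (w : V)
    (havail : a + m ≤ (Finset.univ.filter (fun x => G.Adj w x ∧ indeg φ x + 2 ≤ k)).card) :
    a ≤ (Finset.univ.filter (fun x => G.Adj w x ∧ indeg ψ x + 2 ≤ k)).card := by
  have h1 : (Finset.univ.filter (fun y => G.Adj w y ∧ indeg φ y + 2 ≤ k)) \ M.image ψ ⊆
      Finset.univ.filter (fun y => G.Adj w y ∧ indeg ψ y + 2 ≤ k) := by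
    intro y hy
    simp only [Finset.mem_sdiff, Finset.mem_filter, Finset.mem_univ, true_and, Finset.mem_image,
      not_exists, not_and] at hy ⊢
    refine ⟨hy.1.1, ?_⟩
    have h2 := h.indeg_le_add y
    have h3 := indeg_kept_le φ M y
    have h4 : M.filter (fun v => ψ v = y) = ∅ := by
      rw [Finset.filter_eq_empty_iff]; exact fun v hv => hy.2 v hv
    rw [h4, Finset.card_empty] at h2
    omega
  have h2 := Finset.card_le_card h1
  have h3 := Finset.le_card_sdiff (M.image ψ)
    (Finset.univ.filter (fun y => G.Adj w y ∧ indeg φ y + 2 ≤ k))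
  have h4 : (M.image ψ).card ≤ M.card := Finset.card_image_le
  omega

open Classical in
/-- A redirected map has few preimages. -/
theorem card_le_card_image_redirect [Fintype V] (G : SimpleGraph V) (k r m : ℕ)
    (hreg : ∀ v, (Finset.univ.filter (fun u => G.Adj v u)).card = r)
    (M : (V → V) → Finset V) (Y : Finset ((V → V) × (V → V)))
    (hY : ∀ x ∈ Y, x.1 ∈ choices G ∧ (M x.1).card = m ∧ IsRedirect G k x.1 x.2 (M x.1)) :
    Y.card ≤ (Y.image Prod.snd).card * ((Fintype.card V).choose m * r ^ m) := by
  let N : V → Finset V := fun v => Finset.univ.filter (fun u => G.Adj v u)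
  let F : (V → V) × Finset V → Finset (V → V) := fun p =>
    Fintype.piFinset (fun v => if v ∈ p.2 then N v else {p.1 v})
  -- Given the redirected map and the set `M` of size `m`, the original map is known off `M` and has
  -- `r` possible values at each vertex of `M`.
  let S : Finset (Σ _ : (V → V) × Finset V, V → V) :=
    ((Y.image Prod.snd) ×ˢ (Finset.univ.powersetCard m)).sigma F
  have hS : S.card = (Y.image Prod.snd).card * ((Fintype.card V).choose m * r ^ m) := by
    rw [Finset.card_sigma]
    have : ∀ p ∈ (Y.image Prod.snd) ×ˢ (Finset.univ.powersetCard m : Finset (Finset V)),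
        (F p).card = r ^ m := by
      intro p hp
      rw [Finset.mem_product, Finset.mem_powersetCard] at hp
      rw [Fintype.card_piFinset]
      calc ∏ v, (if v ∈ p.2 then N v else {p.1 v}).card
          = ∏ v, (if v ∈ p.2 then r else 1) := by
            apply Finset.prod_congr rfl
            intro v _
            split_ifs
            · exact hreg v
            · simp
        _ = r ^ m := by
            rw [Finset.prod_ite_mem, Finset.univ_inter, Finset.prod_const, hp.2.2]
    rw [Finset.sum_congr rfl this, Finset.sum_const, Finset.card_product,
      Finset.card_powersetCard, Finset.card_univ, smul_eq_mul, mul_assoc]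
  rw [← hS]
  refine Finset.card_le_card_of_injOn (fun x => ⟨(x.2, M x.1), x.1⟩) ?_ ?_
  · intro x hx
    rw [Finset.mem_coe] at hx
    obtain ⟨h1, h2, h3⟩ := hY x hx
    rw [Finset.mem_coe, Finset.mem_sigma, Finset.mem_product, Finset.mem_powersetCard,
      Fintype.mem_piFinset]
    refine ⟨⟨Finset.mem_image_of_mem _ hx, Finset.subset_univ _, h2⟩, ?_⟩
    intro v
    simp only
    split_ifs with hv
    · rw [Finset.mem_filter]
      exact ⟨Finset.mem_univ _, mem_choices.1 h1 v⟩
    · rw [Finset.mem_singleton]; exact (h3.eq_of_notMem v hv).symm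
  · rintro ⟨φ, ψ⟩ _ ⟨φ', ψ'⟩ _ h
    simp only [Sigma.mk.injEq, Prod.mk.injEq, heq_eq_eq] at h
    rw [h.2, h.1.1]

open Classical in
/-- Many maps with bounded in-degrees and few cycles arise by redirecting surplus edges. -/
theorem exists_redirected_family [Fintype V] (G : SimpleGraph V) (k r a m s t₁ t₂ : ℕ) (hk : 1 ≤ k)
    (hs : 0 < s) [Nonempty V]
    (hreg : ∀ v, (Finset.univ.filter (fun u => G.Adj v u)).card = r)
    (Γ : Finset (V → V)) (hΓ : Γ ⊆ choices G) (hm : ∀ φ ∈ Γ, excess φ (k - 1) = m)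
    (havail : ∀ φ ∈ Γ, ∀ w, a + m ≤
      (Finset.univ.filter (fun x => G.Adj w x ∧ indeg φ x + 2 ≤ k)).card)
    (ht₁ : ∀ φ ∈ Γ, shortCount φ Finset.univ s ≤ t₁)
    (ht₂ : 2 * (s * Fintype.card V) ≤ a * (t₂ + 1)) :
    ∃ Ψ : Finset (V → V), Ψ ⊆ choices G ∧
      Γ.card * a ^ m ≤ 2 * (Ψ.card * ((Fintype.card V).choose m * r ^ m)) ∧
      (∀ ψ ∈ Ψ, ∀ x, indeg ψ x + 1 ≤ k) ∧
      (∀ ψ ∈ Ψ, ∀ w, a ≤ (Finset.univ.filter (fun x => G.Adj w x ∧ indeg ψ x + 2 ≤ k)).card) ∧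
      ∀ ψ ∈ Ψ, ∃ B : Finset V, B.card ≤ Fintype.card V / s + t₂ + t₁ ∧ ∀ v, ∃ i, ψ^[i] v ∈ B := by
  have hsur : ∀ φ : V → V, ∃ M : Finset V, M.card = excess φ (k - 1) ∧
      ∀ x, (Finset.univ.filter (fun v => v ∉ M ∧ φ v = x)).card ≤ k - 1 :=
    fun φ => exists_surplus φ (k - 1)
  choose M hMc hMx using hsur
  let A : (V → V) → V → Finset V := fun φ w =>
    Finset.univ.filter (fun x => G.Adj w x ∧ indeg φ x + 2 ≤ k)
  have hA : ∀ φ ∈ Γ, ∀ u, a + (M φ).card ≤ (A φ u).card := by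
    intro φ hφ u
    rw [hMc, hm φ hφ]
    exact havail φ hφ u
  let X : Finset ((V → V) × (V → V)) :=
    Finset.univ.filter (fun x => x.1 ∈ Γ ∧ x.2 ∈ redirects x.1 (M x.1) (A x.1))
  have hmemX : ∀ x, x ∈ X ↔ x.1 ∈ Γ ∧ x.2 ∈ redirects x.1 (M x.1) (A x.1) := by
    intro x; simp [X]
  have hXc : Γ.card * a ^ m ≤ X.card := by
    have h1 : (Γ.sigma (fun φ => redirects φ (M φ) (A φ))).card ≤ X.card := by
      refine Finset.card_le_card_of_injOn (fun p => (p.1, p.2)) ?_ ?_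
      · rintro ⟨φ, ψ⟩ hp
        rw [Finset.mem_coe, Finset.mem_sigma] at hp
        rw [Finset.mem_coe, hmemX]
        exact hp
      · rintro ⟨φ, ψ⟩ _ ⟨φ', ψ'⟩ _ h
        simp only [Prod.mk.injEq] at h
        obtain ⟨rfl, rfl⟩ := h
        rfl
    refine le_trans ?_ h1
    rw [Finset.card_sigma, ← smul_eq_mul]
    apply Finset.card_nsmul_le_sum
    intro φ hφ
    have h2 := pow_le_card_redirects φ (M φ) (A φ) a (hA φ hφ)
    rwa [hMc, hm φ hφ] at h2
  have hsum := mul_sum_shortCount_le X M a s (fun x hx u hu => by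
    rw [hmemX] at hx
    exact ⟨_, le_card_update_redirects x.1 (M x.1) (A x.1) a (hA _ hx.1) x.2 hx.2 u hu,
      fun w hw => (hmemX _).2 ⟨hx.1, (Finset.mem_filter.1 hw).2⟩⟩)
  have hXY := card_le_two_mul_card_filter X (fun x => shortCount x.2 (M x.1) s) a
    (s * Fintype.card V) t₂ hsum ht₂ (Nat.mul_pos hs Fintype.card_pos)
  set Y := X.filter (fun x => shortCount x.2 (M x.1) s ≤ t₂) with hYdef
  have hY : ∀ x ∈ Y, x.1 ∈ Γ ∧ (M x.1).card = m ∧ IsRedirect G k x.1 x.2 (M x.1) ∧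
      shortCount x.2 (M x.1) s ≤ t₂ := by
    intro x hx
    rw [hYdef, Finset.mem_filter, hmemX] at hx
    obtain ⟨e1, e2, e3⟩ := mem_redirects.1 hx.1.2
    exact ⟨hx.1.1, (hMc _).trans (hm _ hx.1.1), ⟨e1, fun u hu => (Finset.mem_filter.1 (e2 u hu)).2.1,
      fun u hu => (Finset.mem_filter.1 (e2 u hu)).2.2, e3⟩, hx.2⟩
  refine ⟨Y.image Prod.snd, ?_, ?_, ?_, ?_, ?_⟩
  · intro ψ hψ
    obtain ⟨x, hx, rfl⟩ := Finset.mem_image.1 hψ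
    obtain ⟨h1, -, h3, -⟩ := hY x hx
    exact h3.mem_choices (hΓ h1)
  · refine hXc.trans (hXY.trans (Nat.mul_le_mul_left 2 ?_))
    exact card_le_card_image_redirect G k r m hreg M Y
      (fun x hx => ⟨hΓ (hY x hx).1, (hY x hx).2.1, (hY x hx).2.2.1⟩)
  · intro ψ hψ y
    obtain ⟨x, hx, rfl⟩ := Finset.mem_image.1 hψ
    exact (hY x hx).2.2.1.indeg_succ_le hk (hMx x.1) y
  · intro ψ hψ w
    obtain ⟨x, hx, rfl⟩ := Finset.mem_image.1 hψ
    exact (hY x hx).2.2.1.le_card_avail (hY x hx).2.1 w (havail x.1 (hY x hx).1 w)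
  · intro ψ hψ
    obtain ⟨x, hx, rfl⟩ := Finset.mem_image.1 hψ
    obtain ⟨h1, -, h3, h4⟩ := hY x hx
    obtain ⟨B, hBc, hB⟩ := exists_orbit_hittingSet x.1 x.2 (M x.1) h3.eq_of_notMem s hs
    refine ⟨B, hBc.trans ?_, hB⟩
    have := ht₁ x.1 h1
    omega
end Redirect

/-! ### First moment of the in-degree excess -/

section FirstMoment
variable {V : Type*}

-- The in-degree of x in a uniform choice is binomial with parameters r and 1/r: choose which j of
-- the r neighbours map to x, then all other values.
open Classical in
theorem card_filter_indeg_le [Fintype V] (G : SimpleGraph V) (r : ℕ)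
    (hreg : ∀ v, (Finset.univ.filter (fun u => G.Adj v u)).card = r) (x : V) (j : ℕ) :
    ((choices G).filter (fun φ => indeg φ x = j)).card ≤
      r.choose j * ((r - 1) ^ (r - j) * r ^ (Fintype.card V - r)) := by
  let N : V → Finset V := fun v => Finset.univ.filter (fun u => G.Adj v u)
  let F : Finset V → Finset (V → V) := fun A =>
    Fintype.piFinset (fun v => if v ∈ A then {x} else (N v).erase x)
  have hsub : (choices G).filter (fun φ => indeg φ x = j) ⊆
      ((N x).powersetCard j).biUnion F := by
    intro φ hφ
    rw [Finset.mem_filter, mem_choices] at hφ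
    rw [Finset.mem_biUnion]
    refine ⟨Finset.univ.filter (fun v => φ v = x), ?_, ?_⟩
    · rw [Finset.mem_powersetCard]
      refine ⟨?_, hφ.2⟩
      intro v hv
      rw [Finset.mem_filter] at hv
      simp only [N, Finset.mem_filter, Finset.mem_univ, true_and]
      exact (hv.2 ▸ hφ.1 v).symm
    · rw [Fintype.mem_piFinset]
      intro v
      by_cases hv : φ v = x
      · simp [hv]
      · simp [hv, N, hφ.1 v]
  refine (Finset.card_le_card hsub).trans (Finset.card_biUnion_le.trans ?_)
  have hF : ∀ A ∈ (N x).powersetCard j,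
      (F A).card = (r - 1) ^ (r - j) * r ^ (Fintype.card V - r) := by
    intro A hA
    rw [Finset.mem_powersetCard] at hA
    rw [Fintype.card_piFinset]
    calc ∏ v, (if v ∈ A then {x} else (N v).erase x).card
        = ∏ v, ((if v ∈ N x \ A then r - 1 else 1) * (if v ∈ (N x)ᶜ then r else 1)) := by
          apply Finset.prod_congr rfl
          intro v _
          by_cases hv : v ∈ A
          · have := hA.1 hv
            simp [hv, this]
          · by_cases hvx : v ∈ N x
            · have hxv : x ∈ N v := by
                simp only [N, Finset.mem_filter, Finset.mem_univ, true_and] at hvx ⊢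
                exact hvx.symm
              have hxc : (N v).card = r := hreg v
              rw [if_neg hv, if_pos (Finset.mem_sdiff.2 ⟨hvx, hv⟩), if_neg (by simpa using hvx),
                Finset.card_erase_of_mem hxv, hxc, mul_one]
            · have hxv : x ∉ N v := by
                simp only [N, Finset.mem_filter, Finset.mem_univ, true_and] at hvx ⊢
                exact fun h => hvx h.symm
              have hxc : (N v).card = r := hreg v
              rw [if_neg hv, if_neg (fun h => hvx (Finset.mem_sdiff.1 h).1),
                if_pos (Finset.mem_compl.2 hvx), Finset.erase_eq_of_notMem hxv, hxc, one_mul]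
      _ = _ := by
          rw [Finset.prod_mul_distrib, Finset.prod_ite_mem, Finset.prod_ite_mem,
            Finset.univ_inter, Finset.univ_inter, Finset.prod_const, Finset.prod_const,
            Finset.card_sdiff_of_subset hA.1, Finset.card_compl, hA.2]
          simp only [N, hreg]
  rw [Finset.sum_congr rfl hF, Finset.sum_const, Finset.card_powersetCard, smul_eq_mul]
  simp only [N, hreg]
  exact le_rfl

/-- Poisson domination of that binomial weight: binom(r, j) ≤ r^j / j! and 1 - 1/r ≤ exp(-1/r). The
factor exp(1/r)^j corrects for the exponent r - j and tends to 1 for fixed j. -/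
theorem choose_mul_pow_le (r n j : ℕ) (hr : 1 ≤ r) (hn : r ≤ n) :
    ((r.choose j * ((r - 1) ^ (r - j) * r ^ (n - r)) : ℕ) : ℝ) ≤
      (r : ℝ) ^ n * (Real.exp (-1) * Real.exp (1 / r) ^ j / (j.factorial : ℝ)) := by
  rcases lt_or_ge r j with hj | hj
  · rw [Nat.choose_eq_zero_of_lt hj]
    simp only [Nat.zero_mul, Nat.cast_zero]
    positivity
  have hr0 : (0 : ℝ) < r := by exact_mod_cast hr
  have h1 : ((r.choose j : ℕ) : ℝ) ≤ (r : ℝ) ^ j / (j.factorial : ℝ) :=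
    Nat.choose_le_pow_div j r
  have h2 : ((r : ℝ) - 1) ≤ r * Real.exp (-(1 / r)) := by
    have := Real.add_one_le_exp (-(1 / (r : ℝ)))
    calc ((r : ℝ) - 1) = r * (-(1 / r) + 1) := by field_simp; ring
      _ ≤ _ := by gcongr
  have h3 : ((r : ℝ) - 1) ^ (r - j) ≤ r ^ (r - j) * (Real.exp (-1) * Real.exp (1 / r) ^ j) := by
    calc ((r : ℝ) - 1) ^ (r - j) ≤ (r * Real.exp (-(1 / r))) ^ (r - j) := by
          apply pow_le_pow_left₀ _ h2
          have : (1 : ℝ) ≤ r := by exact_mod_cast hr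
          linarith
      _ = _ := by
          rw [mul_pow, ← Real.exp_nat_mul, ← Real.exp_nat_mul, ← Real.exp_add]
          congr 2
          rw [Nat.cast_sub hj]
          field_simp
          ring
  push_cast [Nat.cast_sub hr]
  have h4 : (0 : ℝ) ≤ ((r : ℝ) - 1) ^ (r - j) := by
    have : (1 : ℝ) ≤ r := by exact_mod_cast hr
    exact pow_nonneg (by linarith) _
  calc (r.choose j : ℝ) * (((r : ℝ) - 1) ^ (r - j) * (r : ℝ) ^ (n - r))
      ≤ (r : ℝ) ^ j / (j.factorial : ℝ) *
        ((r ^ (r - j) * (Real.exp (-1) * Real.exp (1 / r) ^ j)) * (r : ℝ) ^ (n - r)) := by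
        gcongr
    _ = ((r : ℝ) ^ j * r ^ (r - j) * (r : ℝ) ^ (n - r)) *
        (Real.exp (-1) * Real.exp (1 / r) ^ j / (j.factorial : ℝ)) := by ring
    _ = _ := by
        rw [← pow_add, ← pow_add]
        congr 2
        omega

theorem sum_succ_mul_pow_le (x : ℝ) (h0 : 0 ≤ x) (h1 : x < 1) (N : ℕ) :
    ∑ i ∈ Finset.range N, ((i : ℝ) + 1) * x ^ i ≤ 1 / (1 - x) ^ 2 := by
  have key : ∀ N : ℕ, (∑ i ∈ Finset.range N, ((i : ℝ) + 1) * x ^ i) * (1 - x) ^ 2 =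
      1 - x ^ N * (1 + N * (1 - x)) := by
    intro N
    induction N with
    | zero => simp
    | succ N ih =>
      rw [Finset.sum_range_succ, add_mul, ih]
      push_cast
      ring
  rw [le_div_iff₀ (by have : 0 < 1 - x := by linarith
                      positivity), key]
  have : 0 ≤ x ^ N * (1 + N * (1 - x)) := by
    have : 0 ≤ 1 - x := by linarith
    positivity
  linarith

/-- Only j ≥ q + 1 contributes. With (q+1+i)! ≥ (q+1)! (q+2)^i the tail is dominated by Σ (i+1) x^i
at x = c/(q+2). -/
theorem sum_excess_term_le (c : ℝ) (hc : 0 ≤ c) (q : ℕ) (hcq : c < q + 2) (N : ℕ) :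
    ∑ j ∈ Finset.range N, ((j - q : ℕ) : ℝ) * (c ^ j / (j.factorial : ℝ)) ≤
      c ^ (q + 1) / ((q + 1).factorial : ℝ) * (1 / (1 - c / (q + 2)) ^ 2) := by
  have hq : (0 : ℝ) < q + 2 := by positivity
  have h1 : ∑ j ∈ Finset.range N, ((j - q : ℕ) : ℝ) * (c ^ j / (j.factorial : ℝ)) ≤
      ∑ j ∈ Finset.range (q + 1 + N), ((j - q : ℕ) : ℝ) * (c ^ j / (j.factorial : ℝ)) :=
    Finset.sum_le_sum_of_subset_of_nonneg (Finset.range_mono (by omega))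
      (fun _ _ _ => by positivity)
  refine h1.trans ?_
  rw [Finset.sum_range_add]
  have h2 : ∑ j ∈ Finset.range (q + 1), ((j - q : ℕ) : ℝ) * (c ^ j / (j.factorial : ℝ)) = 0 := by
    apply Finset.sum_eq_zero
    intro j hj
    rw [Finset.mem_range] at hj
    rw [Nat.sub_eq_zero_of_le (by omega)]
    simp
  rw [h2, zero_add]
  calc ∑ i ∈ Finset.range N, ((q + 1 + i - q : ℕ) : ℝ) *
        (c ^ (q + 1 + i) / ((q + 1 + i).factorial : ℝ))
      ≤ ∑ i ∈ Finset.range N, c ^ (q + 1) / ((q + 1).factorial : ℝ) *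
        (((i : ℝ) + 1) * (c / (q + 2)) ^ i) := by
        apply Finset.sum_le_sum
        intro i _
        have h3 : (((q + 1).factorial : ℝ)) * ((q : ℝ) + 2) ^ i ≤ ((q + 1 + i).factorial : ℝ) := by
          have := Nat.factorial_mul_pow_le_factorial (n := i) (m := q + 1)
          have h4 : (((q + 1).factorial * (q + 1 + 1) ^ i : ℕ) : ℝ) ≤
            ((q + 1 + i).factorial : ℕ) := by exact_mod_cast this
          push_cast at h4
          rw [show (q : ℝ) + 2 = q + 1 + 1 by ring]
          exact h4
        have h4 : q + 1 + i - q = i + 1 := by omega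
        rw [h4]
        push_cast
        calc ((i : ℝ) + 1) * (c ^ (q + 1 + i) / ((q + 1 + i).factorial : ℝ))
            ≤ ((i : ℝ) + 1) * (c ^ (q + 1 + i) /
              ((((q + 1).factorial : ℝ)) * ((q : ℝ) + 2) ^ i)) := by gcongr
          _ = _ := by rw [pow_add, div_pow]; field_simp
    _ = c ^ (q + 1) / ((q + 1).factorial : ℝ) *
        ∑ i ∈ Finset.range N, ((i : ℝ) + 1) * (c / (q + 2)) ^ i := by rw [Finset.mul_sum]
    _ ≤ _ := by
        apply mul_le_mul_of_nonneg_left _ (by positivity)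
        exact sum_succ_mul_pow_le _ (by positivity) ((div_lt_one hq).2 hcq) N

open Classical in
theorem sum_excess_le [Fintype V] (G : SimpleGraph V) (r q : ℕ) (hr : 1 ≤ r)
    (hreg : ∀ v, (Finset.univ.filter (fun u => G.Adj v u)).card = r)
    (hc : Real.exp (1 / r) < q + 2) :
    ((∑ φ ∈ choices G, excess φ q : ℕ) : ℝ) ≤ (Fintype.card V : ℝ) * ((r : ℝ) ^ Fintype.card V *
      (Real.exp (-1) * (Real.exp (1 / r) ^ (q + 1) / ((q + 1).factorial : ℝ) *
        (1 / (1 - Real.exp (1 / r) / (q + 2)) ^ 2)))) := by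
  have hx : ∀ x : V, ((∑ φ ∈ choices G, (indeg φ x - q) : ℕ) : ℝ) ≤ (r : ℝ) ^ Fintype.card V *
      (Real.exp (-1) * (Real.exp (1 / r) ^ (q + 1) / ((q + 1).factorial : ℝ) *
        (1 / (1 - Real.exp (1 / r) / (q + 2)) ^ 2))) := by
    intro x
    have hrn : r ≤ Fintype.card V := by
      rw [← hreg x]; exact Finset.card_le_univ _
    have h1 : ∑ φ ∈ choices G, (indeg φ x - q) =
        ∑ j ∈ Finset.range (Fintype.card V + 1),
          ((choices G).filter (fun φ => indeg φ x = j)).card * (j - q) := by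
      rw [← Finset.sum_fiberwise_of_maps_to (s := choices G)
        (t := Finset.range (Fintype.card V + 1)) (g := fun φ => indeg φ x)]
      · apply Finset.sum_congr rfl
        intro j _
        rw [← smul_eq_mul, ← Finset.sum_const]
        apply Finset.sum_congr rfl
        intro φ hφ
        rw [(Finset.mem_filter.1 hφ).2]
      · intro φ _
        rw [Finset.mem_range, Nat.lt_succ_iff]
        exact Finset.card_le_univ _
    rw [h1, Nat.cast_sum]
    calc ∑ j ∈ Finset.range (Fintype.card V + 1),
          (((((choices G).filter (fun φ => indeg φ x = j)).card * (j - q) : ℕ)) : ℝ)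
        ≤ ∑ j ∈ Finset.range (Fintype.card V + 1), (r : ℝ) ^ Fintype.card V * (Real.exp (-1) *
          (((j - q : ℕ) : ℝ) * (Real.exp (1 / r) ^ j / (j.factorial : ℝ)))) := by
          apply Finset.sum_le_sum
          intro j _
          have h2 : ((((choices G).filter (fun φ => indeg φ x = j)).card : ℕ) : ℝ) ≤ _ :=
            (Nat.cast_le.2 (card_filter_indeg_le G r hreg x j)).trans
              (choose_mul_pow_le r (Fintype.card V) j hr hrn)
          rw [Nat.cast_mul]
          refine (mul_le_mul_of_nonneg_right h2 (Nat.cast_nonneg _)).trans (le_of_eq ?_)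
          ring
      _ = (r : ℝ) ^ Fintype.card V * (Real.exp (-1) *
          ∑ j ∈ Finset.range (Fintype.card V + 1),
          (((j - q : ℕ) : ℝ) * (Real.exp (1 / r) ^ j / (j.factorial : ℝ)))) := by
          rw [Finset.mul_sum, Finset.mul_sum]
      _ ≤ _ := by
          gcongr
          exact sum_excess_term_le _ (Real.exp_pos _).le q hc _
  simp only [excess]
  rw [Finset.sum_comm, Nat.cast_sum]
  refine (Finset.sum_le_sum (fun x _ => hx x)).trans (le_of_eq ?_)
  rw [Finset.sum_const, Finset.card_univ, nsmul_eq_mul]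

/-- As r grows, the bound tends to 1/(e (q+1)!) times (1 - 1/(q+2))^(-2), and the last factor is at
most 16/9 < 19/10 for q ≥ 2. The numerator 2 in `g` therefore leaves room for the factor 19/20,
which makes Markov's inequality give a positive proportion. -/
theorem eventually_excess_const_le (q : ℕ) (hq : 2 ≤ q) :
    ∀ᶠ r : ℕ in atTop, Real.exp (1 / r) < q + 2 ∧
      Real.exp (-1) * (Real.exp (1 / r) ^ (q + 1) / ((q + 1).factorial : ℝ) *
        (1 / (1 - Real.exp (1 / r) / (q + 2)) ^ 2)) ≤ 19 / 20 * g (q + 2) := by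
  have hc : Tendsto (fun r : ℕ => Real.exp (1 / (r : ℝ))) atTop (𝓝 1) := by
    have := (Real.continuous_exp.tendsto 0).comp tendsto_one_div_atTop_nhds_zero_nat
    simpa [Function.comp_def] using this
  have hq' : (2 : ℝ) ≤ q := by exact_mod_cast hq
  have hx : (1 : ℝ) / (q + 2) ≤ 1 / 4 := by
    apply one_div_le_one_div_of_le <;> linarith
  have hne : (1 - (1 : ℝ) / (q + 2)) ^ 2 ≠ 0 := by
    have : 0 < 1 - (1 : ℝ) / (q + 2) := by linarith
    positivity
  have ht : Tendsto (fun r : ℕ => Real.exp (1 / (r : ℝ)) ^ (q + 1) *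
      (1 / (1 - Real.exp (1 / (r : ℝ)) / (q + 2)) ^ 2)) atTop
      (𝓝 (1 ^ (q + 1) * (1 / (1 - (1 : ℝ) / (q + 2)) ^ 2))) :=
    (hc.pow _).mul ((tendsto_const_nhds).div ((tendsto_const_nhds.sub (hc.div_const _)).pow 2) hne)
  have hlt : (1 : ℝ) ^ (q + 1) * (1 / (1 - (1 : ℝ) / (q + 2)) ^ 2) < 19 / 10 := by
    rw [one_pow, one_mul]
    have h1 : (3 / 4 : ℝ) ^ 2 ≤ (1 - (1 : ℝ) / (q + 2)) ^ 2 := by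
      apply pow_le_pow_left₀ <;> linarith
    calc 1 / (1 - (1 : ℝ) / (q + 2)) ^ 2 ≤ 1 / (3 / 4 : ℝ) ^ 2 :=
          one_div_le_one_div_of_le (by norm_num) h1
      _ < 19 / 10 := by norm_num
  filter_upwards [hc.eventually (gt_mem_nhds (show (1 : ℝ) < q + 2 by linarith)),
    ht.eventually (gt_mem_nhds hlt)] with r h1 h2
  refine ⟨h1, ?_⟩
  have h3 : g (q + 2) = Real.exp (-1) / ((q + 1).factorial : ℝ) * 2 := by
    rw [g, Real.exp_neg]
    simp only [show q + 2 - 1 = q + 1 by omega]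
    field_simp
  rw [h3]
  have h4 : 0 ≤ Real.exp (-1) / ((q + 1).factorial : ℝ) := by positivity
  calc _ = Real.exp (-1) / ((q + 1).factorial : ℝ) * (Real.exp (1 / (r : ℝ)) ^ (q + 1) *
      (1 / (1 - Real.exp (1 / (r : ℝ)) / (q + 2)) ^ 2)) := by ring
    _ ≤ Real.exp (-1) / ((q + 1).factorial : ℝ) * (19 / 10) := by gcongr
    _ = _ := by ring

theorem g_pos (k : ℕ) : 0 < g k := by
  rw [g]; positivity

open Classical in
theorem card_filter_mul_le_sum {α : Type*} (X : Finset α) (p : α → ℝ) (hp : ∀ x ∈ X, 0 ≤ p x)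
    (c : ℝ) : ((X.filter (fun x => c < p x)).card : ℝ) * c ≤ ∑ x ∈ X, p x := by
  calc ((X.filter (fun x => c < p x)).card : ℝ) * c
      = ∑ x ∈ X.filter (fun x => c < p x), c := by rw [Finset.sum_const, nsmul_eq_mul]
    _ ≤ ∑ x ∈ X.filter (fun x => c < p x), p x :=
        Finset.sum_le_sum (fun x hx => (Finset.mem_filter.1 hx).2.le)
    _ ≤ _ := Finset.sum_le_sum_of_subset_of_nonneg (Finset.filter_subset _ _)
        (fun x hx _ => hp x hx)

open Classical in
theorem eventually_card_large_excess_le (q : ℕ) (hq : 2 ≤ q) :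
    ∀ᶠ r : ℕ in atTop, ∀ (V : Type*) [Fintype V] [Nonempty V] (G : SimpleGraph V),
      (∀ v, (Finset.univ.filter (fun u => G.Adj v u)).card = r) →
      (((choices G).filter (fun φ => g (q + 2) * Fintype.card V < (excess φ q : ℝ))).card : ℝ) ≤
        19 / 20 * (r : ℝ) ^ Fintype.card V := by
  filter_upwards [eventually_excess_const_le q hq, eventually_ge_atTop 1] with r hr hr1
  intro V _ _ G hreg
  have h1 := sum_excess_le G r q hr1 hreg hr.1
  have h2 := card_filter_mul_le_sum (choices G) (fun φ => (excess φ q : ℝ))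
    (fun _ _ => Nat.cast_nonneg _) (g (q + 2) * Fintype.card V)
  rw [Nat.cast_sum] at h1
  have hn : (0 : ℝ) < Fintype.card V := by exact_mod_cast Fintype.card_pos
  have h3 : 0 < g (q + 2) * Fintype.card V := mul_pos (g_pos _) hn
  refine le_of_mul_le_mul_right ?_ h3
  refine h2.trans (h1.trans ?_)
  calc _ ≤ (Fintype.card V : ℝ) * ((r : ℝ) ^ Fintype.card V * (19 / 20 * g (q + 2))) :=
        mul_le_mul_of_nonneg_left (mul_le_mul_of_nonneg_left hr.2 (by positivity)) hn.le
    _ = _ := by ring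
end FirstMoment

/-! ### A positive proportion of good maps -/

section GoodChoices
variable {V : Type*}

open Classical in
/-- The number of vertices that `φ` maps to a neighbour of `w`. -/
noncomputable def hits [Fintype V] (G : SimpleGraph V) (w : V) (φ : V → V) : ℕ :=
  (Finset.univ.filter (fun v => G.Adj w (φ v))).card

open Classical in
theorem sum_codegree [Fintype V] (G : SimpleGraph V) (r : ℕ)
    (hreg : ∀ v, (Finset.univ.filter (fun u => G.Adj v u)).card = r) (w : V) :
    ∑ v, (Finset.univ.filter (fun u => G.Adj v u ∧ G.Adj w u)).card = r * r := by
  have h1 : ∀ v : V, (Finset.univ.filter (fun u => G.Adj v u ∧ G.Adj w u)).card =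
      ∑ u ∈ Finset.univ.filter (fun u => G.Adj w u), if G.Adj u v then 1 else 0 := by
    intro v
    rw [Finset.card_filter, Finset.sum_filter]
    apply Finset.sum_congr rfl
    intro u _
    by_cases h1 : G.Adj w u <;> by_cases h2 : G.Adj v u <;>
      simp [h1, h2, G.adj_comm u v]
  rw [Finset.sum_congr rfl (fun v _ => h1 v), Finset.sum_comm]
  have h2 : ∀ u ∈ Finset.univ.filter (fun u => G.Adj w u),
      (∑ v, if G.Adj u v then 1 else 0) = r := by
    intro u _
    rw [← Finset.card_filter]; exact hreg u
  rw [Finset.sum_congr rfl h2, Finset.sum_const, hreg w, smul_eq_mul]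

-- The exponential moment factors over v. Each factor is r + (t-1) d(v) ≤ r exp((t-1) d(v)/r), with
-- d(v) the codegree of v and w, and the codegrees sum to r².
open Classical in
theorem sum_pow_hits_le [Fintype V] (G : SimpleGraph V) (r : ℕ) (hr : 1 ≤ r)
    (hreg : ∀ v, (Finset.univ.filter (fun u => G.Adj v u)).card = r) (w : V) (t : ℝ) (ht : 1 ≤ t) :
    ∑ φ ∈ choices G, t ^ hits G w φ ≤ (r : ℝ) ^ Fintype.card V * Real.exp ((t - 1) * r) := by
  have hr0 : (0 : ℝ) < r := by exact_mod_cast hr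
  set d : V → ℕ := fun v => (Finset.univ.filter (fun u => G.Adj v u ∧ G.Adj w u)).card with hd
  have h1 : ∀ φ : V → V, t ^ hits G w φ = ∏ v, if G.Adj w (φ v) then t else 1 := by
    intro φ
    rw [hits, ← Finset.prod_const, Finset.prod_filter]
  rw [Finset.sum_congr rfl (fun φ _ => h1 φ), choices,
    ← Finset.prod_univ_sum (f := fun _ u => if G.Adj w u then t else 1)]
  have h2 : ∀ v, (∑ u ∈ Finset.univ.filter (fun u => G.Adj v u), if G.Adj w u then t else 1) ≤
      r * Real.exp ((t - 1) / r * d v) := by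
    intro v
    have h3 : (∑ u ∈ Finset.univ.filter (fun u => G.Adj v u), if G.Adj w u then t else 1) =
        r + (t - 1) * d v := by
      have : ∀ u, (if G.Adj w u then t else 1) = 1 + (t - 1) * (if G.Adj w u then 1 else 0) := by
        intro u; split_ifs <;> ring
      simp only [this]
      rw [Finset.sum_add_distrib, Finset.sum_const, hreg v, nsmul_eq_mul, mul_one,
        ← Finset.mul_sum, Finset.sum_boole, Finset.filter_filter]
    rw [h3]
    have h4 := Real.add_one_le_exp ((t - 1) / r * d v)
    calc (r : ℝ) + (t - 1) * d v = r * ((t - 1) / r * d v + 1) := by field_simp; ring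
      _ ≤ _ := by gcongr
  calc _ ≤ ∏ v : V, (r * Real.exp ((t - 1) / r * d v)) := by
        apply Finset.prod_le_prod
        · intro v _
          apply Finset.sum_nonneg
          intro u _
          split_ifs <;> linarith
        · exact fun v _ => h2 v
    _ = _ := by
        rw [Finset.prod_mul_distrib, Finset.prod_const, Finset.card_univ, ← Real.exp_sum,
          ← Finset.mul_sum, ← Nat.cast_sum, sum_codegree G r hreg w]
        congr 2
        push_cast
        field_simp

-- Chernoff bound at t = exp(1/100): since t - 1 ≤ 0.0101, the exponent is at most (0.0101 -
-- 0.01016) r.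
open Classical in
theorem card_many_hits_le [Fintype V] (G : SimpleGraph V) (r : ℕ) (hr : 1 ≤ r)
    (hreg : ∀ v, (Finset.univ.filter (fun u => G.Adj v u)).card = r) (w : V) :
    (((choices G).filter (fun φ => 1.016 * (r : ℝ) < hits G w φ)).card : ℝ) ≤
      Real.exp (-(6 / 100000) * r) * (r : ℝ) ^ Fintype.card V := by
  have h1 := sum_pow_hits_le G r hr hreg w (Real.exp (1 / 100)) (Real.one_le_exp (by norm_num))
  have h2 := card_filter_mul_le_sum (choices G) (fun φ => Real.exp (1 / 100) ^ hits G w φ)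
    (fun _ _ => by positivity) (Real.exp (1.016 / 100 * r))
  have h3 : (choices G).filter (fun φ => 1.016 * (r : ℝ) < hits G w φ) ⊆
      (choices G).filter (fun φ => Real.exp (1.016 / 100 * r) < Real.exp (1 / 100) ^ hits G w φ) := by
    intro φ hφ
    rw [Finset.mem_filter] at hφ ⊢
    refine ⟨hφ.1, ?_⟩
    rw [← Real.exp_nat_mul, Real.exp_lt_exp]
    linarith [hφ.2]
  have h4 : ((((choices G).filter (fun φ => 1.016 * (r : ℝ) < hits G w φ)).card : ℕ) : ℝ) ≤ _ :=
    Nat.cast_le.2 (Finset.card_le_card h3)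
  have h5 : Real.exp (1 / 100) - 1 ≤ 0.0101 := by
    have := Real.abs_exp_sub_one_sub_id_le (x := 1 / 100) (by norm_num [abs_le])
    have := (abs_le.1 this).2
    norm_num at this ⊢
    linarith
  have h6 : Real.exp ((Real.exp (1 / 100) - 1) * r) ≤
      Real.exp (-(6 / 100000) * r) * Real.exp (1.016 / 100 * r) := by
    rw [← Real.exp_add, Real.exp_le_exp]
    have := mul_le_mul_of_nonneg_right h5 (Nat.cast_nonneg (α := ℝ) r)
    linarith
  refine h4.trans (le_of_mul_le_mul_right ?_ (Real.exp_pos (1.016 / 100 * (r : ℝ))))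
  refine h2.trans (h1.trans ?_)
  calc _ ≤ (r : ℝ) ^ Fintype.card V *
        (Real.exp (-(6 / 100000) * r) * Real.exp (1.016 / 100 * r)) := by gcongr
    _ = _ := by ring

open Classical in
theorem two_mul_card_le_hits [Fintype V] (G : SimpleGraph V) (w : V) (φ : V → V) :
    2 * (Finset.univ.filter (fun x => G.Adj w x ∧ 2 ≤ indeg φ x)).card ≤ hits G w φ := by
  have h1 : hits G w φ = ∑ x ∈ Finset.univ.filter (fun x => G.Adj w x), indeg φ x := by
    rw [hits, Finset.card_eq_sum_card_fiberwise (f := φ)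
      (t := Finset.univ.filter (fun x => G.Adj w x))]
    · apply Finset.sum_congr rfl
      intro x hx
      rw [indeg, Finset.filter_filter]
      congr 1
      apply Finset.filter_congr
      intro v _
      constructor
      · exact fun h => h.2
      · rintro rfl
        exact ⟨(Finset.mem_filter.1 hx).2, rfl⟩
    · intro v hv
      simpa using hv
  rw [h1, mul_comm, ← smul_eq_mul]
  refine (Finset.card_nsmul_le_sum _ (fun x => indeg φ x) 2 ?_).trans
    (Finset.sum_le_sum_of_subset ?_)
  · intro x hx
    exact (Finset.mem_filter.1 hx).2.2
  · intro x hx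
    rw [Finset.mem_filter] at hx ⊢
    exact ⟨hx.1, hx.2.1⟩

-- For q = k - 2 the excess pays at once for the vertices of in-degree at least k - 1, which are not
-- available, and for the surplus over k - 1.
open Classical in
theorem excess_succ [Fintype V] (φ : V → V) (q : ℕ) :
    excess φ q = (Finset.univ.filter (fun x => q + 1 ≤ indeg φ x)).card + excess φ (q + 1) := by
  rw [excess, excess, Finset.card_filter, ← Finset.sum_add_distrib]
  apply Finset.sum_congr rfl
  intro x _
  split_ifs <;> omega

open Classical in
theorem card_neighbors_split [Fintype V] (G : SimpleGraph V) (r k : ℕ) (hk : 2 ≤ k)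
    (hreg : ∀ v, (Finset.univ.filter (fun u => G.Adj v u)).card = r) (w : V) (φ : V → V) :
    (Finset.univ.filter (fun x => G.Adj w x ∧ indeg φ x + 2 ≤ k)).card +
      (Finset.univ.filter (fun x => G.Adj w x ∧ k - 1 ≤ indeg φ x)).card = r := by
  rw [← hreg w, ← Finset.card_filter_add_card_filter_not
    (s := Finset.univ.filter (fun u => G.Adj w u)) (fun x => indeg φ x + 2 ≤ k),
    Finset.filter_filter, Finset.filter_filter]
  congr 2
  apply Finset.filter_congr
  intro x _
  constructor
  · rintro ⟨h1, h2⟩; exact ⟨h1, by omega⟩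
  · rintro ⟨h1, h2⟩; exact ⟨h1, by omega⟩

/-- The fraction of the neighbours of a vertex that are always available as redirection targets. -/
noncomputable def slack (k : ℕ) : ℝ := if k = 3 then 1 / 1000 else 1 - ((k : ℝ) + 1) * g k

theorem succ_le_factorial (k : ℕ) (hk : 4 ≤ k) : 6 * (k + 1) ≤ 5 * (k - 1).factorial := by
  induction k, hk using Nat.le_induction with
  | base => decide
  | succ k hk ih =>
    have h1 : (k + 1 - 1).factorial = k * (k - 1).factorial := by
      rw [Nat.add_sub_cancel, Nat.mul_factorial_pred (by omega)]
    rw [h1]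
    nlinarith

theorem le_slack (k : ℕ) (hk : 4 ≤ k) : 0.38 ≤ slack k := by
  rw [slack, if_neg (by omega), g]
  have h1 : ((6 * (k + 1) : ℕ) : ℝ) ≤ (5 * (k - 1).factorial : ℕ) := by
    exact_mod_cast succ_le_factorial k hk
  push_cast at h1
  have he : 2.7 < Real.exp 1 := lt_trans (by norm_num) Real.exp_one_gt_d9
  have hf : (0 : ℝ) < ((k - 1).factorial : ℝ) := by positivity
  have h2 : ((k : ℝ) + 1) * (2 / (Real.exp 1 * ((k - 1).factorial : ℝ))) ≤ 0.62 := by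
    rw [← mul_div_assoc, div_le_iff₀ (by positivity)]
    nlinarith
  linarith

theorem slack_pos (k : ℕ) (hk : 3 ≤ k) : 0 < slack k := by
  rcases hk.eq_or_lt with rfl | hk
  · norm_num [slack]
  · linarith [le_slack k hk]

theorem slack_le_one (k : ℕ) : slack k ≤ 1 := by
  rw [slack]
  split_ifs
  · norm_num
  · have := mul_nonneg (by positivity : (0 : ℝ) ≤ (k : ℝ) + 1) (g_pos k).le
    linarith

theorem g_four_le : g 4 ≤ 0.12265 := by
  rw [g, show (4 - 1 : ℕ).factorial = 6 from rfl, div_le_iff₀ (by positivity)]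
  have := Real.exp_one_gt_d9
  push_cast
  linarith

theorem g_le_g_four (k : ℕ) (hk : 4 ≤ k) : g k ≤ g 4 := by
  rw [g, g]
  have : (((4 - 1).factorial : ℕ) : ℝ) ≤ ((k - 1).factorial : ℕ) := by
    exact_mod_cast Nat.factorial_le (by omega)
  gcongr

-- For k = 3 the bound by the excess over k - 2 is useless, as 1 - 4 g_3 < 0. Instead at most half
-- of the hits, hence 0.508 r neighbours, have in-degree at least 2. The surplus is at most 0.12265
-- · 4r = 0.4906 r, so more than r/1000 neighbours remain.
open Classical in
theorem le_card_avail_of_hits [Fintype V] (G : SimpleGraph V) (r : ℕ)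
    (hreg : ∀ v, (Finset.univ.filter (fun u => G.Adj v u)).card = r)
    (hn : Fintype.card V ≤ (3 + 1) * r) (φ : V → V)
    (hφ : (excess φ 2 : ℝ) ≤ g 4 * Fintype.card V) (w : V)
    (hw : (hits G w φ : ℝ) ≤ 1.016 * r) :
    ⌈slack 3 * r⌉₊ + excess φ 2 ≤
      (Finset.univ.filter (fun x => G.Adj w x ∧ indeg φ x + 2 ≤ 3)).card := by
  have h1 := card_neighbors_split G r 3 (by omega) hreg w φ
  have h2 := two_mul_card_le_hits G w φ
  simp only [show 3 - 1 = 2 from rfl] at h1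
  set a := (Finset.univ.filter (fun x => G.Adj w x ∧ indeg φ x + 2 ≤ 3)).card
  set b := (Finset.univ.filter (fun x => G.Adj w x ∧ 2 ≤ indeg φ x)).card
  have h3 : ((a + b : ℕ) : ℝ) = r := by exact_mod_cast h1
  have h4 : ((2 * b : ℕ) : ℝ) ≤ hits G w φ := by exact_mod_cast h2
  have h5 : ((Fintype.card V : ℕ) : ℝ) ≤ ((3 + 1) * r : ℕ) := by exact_mod_cast hn
  push_cast at h3 h4 h5
  have h6 : g 4 * Fintype.card V ≤ 0.12265 * Fintype.card V :=
    mul_le_mul_of_nonneg_right g_four_le (Nat.cast_nonneg _)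
  have h7 : slack 3 = 1 / 1000 := by simp [slack]
  rw [h7]
  have h8 : 1 / 1000 * (r : ℝ) + excess φ 2 ≤ a := by linarith
  have h9 : excess φ 2 ≤ a := by
    have : ((excess φ 2 : ℕ) : ℝ) ≤ a := by
      have := Nat.cast_nonneg (α := ℝ) r
      linarith
    exact_mod_cast this
  have h10 : ⌈1 / 1000 * (r : ℝ)⌉₊ ≤ a - excess φ 2 := by
    rw [Nat.ceil_le, Nat.cast_sub h9]
    linarith
  omega

-- By `excess_succ`, the unavailable vertices and the surplus together number at most g_k n ≤ (k+1)
-- g_k r, which leaves `slack k` * r.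
open Classical in
theorem le_card_avail_of_excess [Fintype V] (G : SimpleGraph V) (r k : ℕ) (hk : 4 ≤ k)
    (hreg : ∀ v, (Finset.univ.filter (fun u => G.Adj v u)).card = r)
    (hn : Fintype.card V ≤ (k + 1) * r) (φ : V → V)
    (hφ : (excess φ (k - 2) : ℝ) ≤ g k * Fintype.card V) (w : V) :
    ⌈slack k * r⌉₊ + excess φ (k - 1) ≤
      (Finset.univ.filter (fun x => G.Adj w x ∧ indeg φ x + 2 ≤ k)).card := by
  have h1 := card_neighbors_split G r k (by omega) hreg w φ
  have h2 := excess_succ φ (k - 2)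
  have h3 : k - 2 + 1 = k - 1 := by omega
  rw [h3] at h2
  have h4 : (Finset.univ.filter (fun x => G.Adj w x ∧ k - 1 ≤ indeg φ x)).card ≤
      (Finset.univ.filter (fun x => k - 1 ≤ indeg φ x)).card := by
    apply Finset.card_le_card
    intro x hx
    rw [Finset.mem_filter] at hx ⊢
    exact ⟨hx.1, hx.2.2⟩
  set a := (Finset.univ.filter (fun x => G.Adj w x ∧ indeg φ x + 2 ≤ k)).card
  have h5 : r + excess φ (k - 1) ≤ a + excess φ (k - 2) := by omega
  have h6 : ((r + excess φ (k - 1) : ℕ) : ℝ) ≤ (a + excess φ (k - 2) : ℕ) := by exact_mod_cast h5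
  have h7 : ((Fintype.card V : ℕ) : ℝ) ≤ ((k + 1) * r : ℕ) := by exact_mod_cast hn
  push_cast at h6 h7
  have h8 : g k * Fintype.card V ≤ g k * (((k : ℝ) + 1) * r) :=
    mul_le_mul_of_nonneg_left h7 (g_pos k).le
  have h9 : slack k * r = r - g k * (((k : ℝ) + 1) * r) := by
    rw [slack, if_neg (by omega)]; ring
  have h10 : excess φ (k - 1) ≤ a := by
    have h12 := mul_nonneg (slack_pos k (by omega)).le (Nat.cast_nonneg (α := ℝ) r)
    have h13 : ((excess φ (k - 1) : ℕ) : ℝ) ≤ a := by linarith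
    exact_mod_cast h13
  have h11 : ⌈slack k * r⌉₊ ≤ a - excess φ (k - 1) := by
    rw [Nat.ceil_le, Nat.cast_sub h10]
    linarith
  omega
theorem excess_antitone [Fintype V] (φ : V → V) {p q : ℕ} (h : p ≤ q) :
    excess φ q ≤ excess φ p :=
  Finset.sum_le_sum fun _ _ => Nat.sub_le_sub_left h _

-- The switching bound is applied to all choices, where every vertex has r targets: the mean number
-- of points on short cycles is at most (k+1) s. Markov's inequality follows.
open Classical in
theorem card_many_short_le [Fintype V] [Nonempty V] (G : SimpleGraph V) (r k s : ℕ) (hr : 1 ≤ r)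
    (hs : 1 ≤ s) (hreg : ∀ v, (Finset.univ.filter (fun u => G.Adj v u)).card = r)
    (hn : Fintype.card V ≤ (k + 1) * r) :
    100 * ((choices G).filter (fun φ => 100 * ((k + 1) * s) <
      shortCount φ Finset.univ s)).card ≤ r ^ Fintype.card V := by
  have h1 := mul_sum_shortCount_le ((Finset.univ : Finset Unit) ×ˢ choices G)
    (fun _ => Finset.univ) r s (by
      rintro ⟨t, φ⟩ hx u -
      refine ⟨Finset.univ.filter (fun w => G.Adj u w), (hreg u).ge, ?_⟩
      intro w hw
      rw [Finset.mem_product, mem_choices] at hx ⊢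
      refine ⟨Finset.mem_univ _, fun v => ?_⟩
      by_cases hv : v = u
      · subst hv
        simp only [Function.update_self]
        exact (Finset.mem_filter.1 hw).2
      · simp only [ne_eq, hv, not_false_eq_true, Function.update_of_ne]
        exact hx.2 v)
  rw [Finset.sum_product, Finset.card_product] at h1
  simp only [Finset.univ_unique, Finset.sum_singleton, Finset.card_singleton, one_mul] at h1
  rw [card_choices hreg] at h1
  set Z := (choices G).filter (fun φ => 100 * ((k + 1) * s) < shortCount φ Finset.univ s) with hZ
  have h2 : Z.card * (100 * ((k + 1) * s)) ≤ ∑ φ ∈ choices G, shortCount φ Finset.univ s := by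
    rw [← smul_eq_mul]
    refine (Finset.card_nsmul_le_sum Z (fun φ => shortCount φ Finset.univ s) _ ?_).trans
      (Finset.sum_le_sum_of_subset (Finset.filter_subset _ _))
    intro φ hφ
    exact (Finset.mem_filter.1 hφ).2.le
  have h3 : 100 * Z.card * ((k + 1) * r * s) ≤ r ^ Fintype.card V * ((k + 1) * r * s) := by
    calc 100 * Z.card * ((k + 1) * r * s) = r * (Z.card * (100 * ((k + 1) * s))) := by ring
      _ ≤ r * ∑ φ ∈ choices G, shortCount φ Finset.univ s := Nat.mul_le_mul_left _ h2
      _ ≤ s * Fintype.card V * r ^ Fintype.card V := h1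
      _ ≤ s * ((k + 1) * r) * r ^ Fintype.card V := by gcongr
      _ = _ := by ring
  exact Nat.le_of_mul_le_mul_right h3 (by positivity)

/-- Maps with small excess, few short cycles and no overloaded neighbourhood. -/
structure IsGood [Fintype V] (G : SimpleGraph V) (r k s : ℕ) (φ : V → V) : Prop where
  excess_le : (excess φ (max k 4 - 2) : ℝ) ≤ g (max k 4) * Fintype.card V
  short_le : shortCount φ Finset.univ s ≤ 100 * ((k + 1) * s)
  hits_le : k = 3 → ∀ w, (hits G w φ : ℝ) ≤ 1.016 * r

open Classical in
theorem IsGood.le_card_avail [Fintype V] {G : SimpleGraph V} {r k s : ℕ} {φ : V → V}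
    (h : IsGood G r k s φ) (hk : 3 ≤ k)
    (hreg : ∀ v, (Finset.univ.filter (fun u => G.Adj v u)).card = r)
    (hn : Fintype.card V ≤ (k + 1) * r) (w : V) :
    ⌈slack k * r⌉₊ + excess φ (k - 1) ≤
      (Finset.univ.filter (fun x => G.Adj w x ∧ indeg φ x + 2 ≤ k)).card := by
  have h1 := h.excess_le
  rcases hk.eq_or_lt with rfl | hk
  · exact le_card_avail_of_hits G r hreg hn φ h1 w (h.hits_le rfl w)
  · rw [max_eq_left hk] at h1
    exact le_card_avail_of_excess G r k hk hreg hn φ h1 w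

theorem IsGood.excess_pred_le [Fintype V] {G : SimpleGraph V} {r k s : ℕ} {φ : V → V}
    (h : IsGood G r k s φ) (hk : 3 ≤ k) :
    (excess φ (k - 1) : ℝ) ≤ g (max k 4) * Fintype.card V := by
  refine le_trans ?_ h.excess_le
  exact_mod_cast excess_antitone φ (by omega)

theorem eventually_mul_exp_le : ∀ᶠ r : ℕ in atTop,
    4 * (r : ℝ) * Real.exp (-(6 / 100000) * r) ≤ 1 / 100 := by
  have h1 : Tendsto (fun x : ℝ => x * Real.exp (-(6 / 100000) * x)) atTop (𝓝 0) := by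
    have := tendsto_rpow_mul_exp_neg_mul_atTop_nhds_zero 1 (6 / 100000) (by norm_num)
    simpa using this
  have h2 := (h1.comp tendsto_natCast_atTop_atTop).eventually
    (gt_mem_nhds (show (0 : ℝ) < 1 / 400 by norm_num))
  filter_upwards [h2] with r hr
  simp only [Function.comp_apply] at hr
  linarith

-- The three bad events have proportions at most 19/20, 1/100 and 1/100; for k = 3 the last one is a
-- union bound over the at most 4r vertices w.
open Classical in
theorem eventually_card_isGood_ge (k : ℕ) :
    ∀ᶠ r : ℕ in atTop, ∀ (V : Type*) [Fintype V] [Nonempty V] (G : SimpleGraph V) (s : ℕ),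
      (∀ v, (Finset.univ.filter (fun u => G.Adj v u)).card = r) →
      Fintype.card V ≤ (k + 1) * r → 1 ≤ s →
      1 / 50 * (r : ℝ) ^ Fintype.card V ≤ ((choices G).filter (IsGood G r k s)).card := by
  filter_upwards [eventually_card_large_excess_le (max k 4 - 2) (by omega), eventually_mul_exp_le,
    eventually_ge_atTop 1] with r h1 h2 hr V _ _ G s hreg hn hs
  have e1 := h1 V G hreg
  rw [show max k 4 - 2 + 2 = max k 4 by omega] at e1
  have e2 := card_many_short_le G r k s hr hs hreg hn
  set P := (r : ℝ) ^ Fintype.card V with hP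
  have hP0 : 0 ≤ P := by positivity
  set A := (choices G).filter
    (fun φ => g (max k 4) * Fintype.card V < (excess φ (max k 4 - 2) : ℝ))
  set B := (choices G).filter (fun φ => 100 * ((k + 1) * s) < shortCount φ Finset.univ s)
  set C := (choices G).filter (fun φ => k = 3 ∧ ∃ w, 1.016 * (r : ℝ) < hits G w φ)
  set D := (choices G).filter (IsGood G r k s)
  have e2' : (B.card : ℝ) ≤ 1 / 100 * P := by
    have : ((100 * B.card : ℕ) : ℝ) ≤ ((r ^ Fintype.card V : ℕ) : ℝ) := by exact_mod_cast e2
    push_cast at this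
    linarith
  have e3 : (C.card : ℝ) ≤ 1 / 100 * P := by
    by_cases hk3 : k = 3
    · have hsub : C ⊆ Finset.univ.biUnion
          (fun w => (choices G).filter (fun φ => 1.016 * (r : ℝ) < hits G w φ)) := by
        intro φ hφ
        obtain ⟨hφ, -, w, hw⟩ := Finset.mem_filter.1 hφ
        exact Finset.mem_biUnion.2 ⟨w, Finset.mem_univ _, Finset.mem_filter.2 ⟨hφ, hw⟩⟩
      have h3 : (C.card : ℝ) ≤ ∑ w : V,
          (((choices G).filter (fun φ => 1.016 * (r : ℝ) < hits G w φ)).card : ℝ) := by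
        exact_mod_cast (Finset.card_le_card hsub).trans Finset.card_biUnion_le
      refine h3.trans ((Finset.sum_le_sum (fun w _ => card_many_hits_le G r hr hreg w)).trans ?_)
      rw [Finset.sum_const, Finset.card_univ, nsmul_eq_mul, ← mul_assoc]
      refine mul_le_mul_of_nonneg_right (le_trans ?_ h2) hP0
      have : ((Fintype.card V : ℕ) : ℝ) ≤ ((k + 1) * r : ℕ) := by exact_mod_cast hn
      rw [hk3] at this
      push_cast at this
      exact mul_le_mul_of_nonneg_right (by linarith) (Real.exp_pos _).le
    · have : C = ∅ := Finset.filter_eq_empty_iff.2 (fun φ _ h => hk3 h.1)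
      rw [this, Finset.card_empty, Nat.cast_zero]
      positivity
  have hcover : choices G ⊆ A ∪ (B ∪ (C ∪ D)) := by
    intro φ hφ
    simp only [A, B, C, D, Finset.mem_union, Finset.mem_filter, hφ, true_and]
    by_contra hcon
    push Not at hcon
    exact hcon.2.2.2 ⟨hcon.1, hcon.2.1, hcon.2.2.1⟩
  have h4 : ((choices G).card : ℝ) ≤ A.card + (B.card + (C.card + D.card)) := by
    have h5 := (Finset.card_le_card hcover).trans ((Finset.card_union_le _ _).trans
      (Nat.add_le_add_left ((Finset.card_union_le _ _).trans
        (Nat.add_le_add_left (Finset.card_union_le _ _) _)) _))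
    exact_mod_cast h5
  rw [card_choices hreg, Nat.cast_pow, ← hP] at h4
  linarith

-- Pigeonhole over the n + 1 possible values of the excess, so that all maps redirect the same
-- number m of vertices.
open Classical in
theorem eventually_exists_uniform_excess (k : ℕ) (hk : 3 ≤ k) :
    ∀ᶠ r : ℕ in atTop, ∀ (V : Type*) [Fintype V] [Nonempty V] (G : SimpleGraph V) (s : ℕ),
      (∀ v, (Finset.univ.filter (fun u => G.Adj v u)).card = r) →
      Fintype.card V ≤ (k + 1) * r → 1 ≤ s →
      ∃ (m : ℕ) (Γ : Finset (V → V)), Γ ⊆ choices G ∧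
        (m : ℝ) ≤ g (max k 4) * Fintype.card V ∧
        (r : ℝ) ^ Fintype.card V ≤ 50 * ((Fintype.card V + 1) * Γ.card) ∧
        ∀ φ ∈ Γ, excess φ (k - 1) = m ∧ shortCount φ Finset.univ s ≤ 100 * ((k + 1) * s) ∧
          ∀ w, ⌈slack k * r⌉₊ + m ≤
            (Finset.univ.filter (fun x => G.Adj w x ∧ indeg φ x + 2 ≤ k)).card := by
  filter_upwards [eventually_card_isGood_ge k, eventually_ge_atTop 1] with
    r h1 hr V _ _ G s hreg hn hs
  have e1 := h1 V G s hreg hn hs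
  set D := (choices G).filter (IsGood G r k s) with hD
  have hgood : ∀ φ ∈ D, IsGood G r k s φ := fun φ hφ => (Finset.mem_filter.1 hφ).2
  have hmaps : ∀ φ ∈ D, excess φ (k - 1) ∈ Finset.range (Fintype.card V + 1) := by
    intro φ hφ
    rw [Finset.mem_range, Nat.lt_succ_iff]
    have h2 := (hgood φ hφ).excess_pred_le hk
    have h3 : g (max k 4) ≤ 1 := (g_le_g_four _ (le_max_right _ _)).trans
      (g_four_le.trans (by norm_num))
    have h4 : (excess φ (k - 1) : ℝ) ≤ 1 * Fintype.card V :=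
      h2.trans (mul_le_mul_of_nonneg_right h3 (Nat.cast_nonneg _))
    rw [one_mul] at h4
    exact_mod_cast h4
  obtain ⟨m, -, hm⟩ := Finset.exists_le_card_fiber_of_nsmul_le_card_of_maps_to hmaps
    (b := (D.card : ℝ) / (Fintype.card V + 1)) ⟨0, by simp⟩ (by
      rw [Finset.card_range, nsmul_eq_mul]
      push_cast
      rw [mul_div_cancel₀]
      positivity)
  set Γ := D.filter (fun φ => excess φ (k - 1) = m) with hΓ
  have hpos : (0 : ℝ) < (r : ℝ) ^ Fintype.card V := by
    have : (0 : ℝ) < r := by exact_mod_cast hr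
    positivity
  have hbound : (r : ℝ) ^ Fintype.card V ≤ 50 * ((Fintype.card V + 1) * Γ.card) := by
    rw [div_le_iff₀ (by positivity)] at hm
    linarith
  have hne : Γ.Nonempty := by
    rw [Finset.nonempty_iff_ne_empty]
    intro h
    rw [h, Finset.card_empty] at hbound
    simp only [Nat.cast_zero, mul_zero] at hbound
    linarith
  have hprops : ∀ φ ∈ Γ, φ ∈ choices G ∧ IsGood G r k s φ ∧ excess φ (k - 1) = m := by
    intro φ hφ
    obtain ⟨hφ, hφm⟩ := Finset.mem_filter.1 hφ
    exact ⟨(Finset.mem_filter.1 hφ).1, hgood φ hφ, hφm⟩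
  refine ⟨m, Γ, fun φ hφ => (hprops φ hφ).1, ?_, hbound, ?_⟩
  · obtain ⟨φ, hφ⟩ := hne
    obtain ⟨-, h2, h3⟩ := hprops φ hφ
    rw [← h3]
    exact h2.excess_pred_le hk
  · intro φ hφ
    obtain ⟨-, h2, h3⟩ := hprops φ hφ
    refine ⟨h3, h2.short_le, fun w => ?_⟩
    rw [← h3]
    exact h2.le_card_avail hk hreg hn w
end GoodChoices

/-! ### Assembling the count -/

section Count
variable {V : Type*}

open Classical in
theorem card_mul_pow_le_numSpanningTrees [Fintype V] [Nonempty V] {G : SimpleGraph V} {k M : ℕ}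
    (R : Reserve G k M) (hk : 3 ≤ k) (r a a' m s t₁ t₂ b q : ℕ) (hs : 0 < s)
    (hreg : ∀ v, (Finset.univ.filter (fun u => G.Adj v u)).card = r)
    (Γ : Finset (V → V)) (hΓ : Γ ⊆ choices G) (hm : ∀ φ ∈ Γ, excess φ (k - 1) = m)
    (havail : ∀ φ ∈ Γ, ∀ w, a' + m ≤
      (Finset.univ.filter (fun x => G.Adj w x ∧ indeg φ x + 2 ≤ k)).card)
    (ht₁ : ∀ φ ∈ Γ, shortCount φ Finset.univ s ≤ t₁)
    (ht₂ : 2 * (s * Fintype.card V) ≤ a' * (t₂ + 1))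
    (hb : Fintype.card V / s + t₂ + t₁ ≤ b) (hq : R.Q.card ≤ q)
    (ha : a + b + (k + 1) * q ≤ a') (hM : ∀ i, a * i ≤ Fintype.card V → i + 2 * k ≤ M)
    (hqa : q ≤ a) :
    Γ.card * a' ^ m ≤ 2 * (numSpanningTrees G k *
      (Fintype.card V ^ 2 + 1) ^ (2 * (2 * b + 3 * k * q + 1) + 2 * b) *
      ((Fintype.card V).choose m * r ^ m)) := by
  obtain ⟨Ψ, h1, h2, h3, h4, h5⟩ := exists_redirected_family G k r a' m s t₁ t₂ (by omega) hs hreg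
    Γ hΓ hm havail ht₁ ht₂
  refine h2.trans (Nat.mul_le_mul_left 2 (Nat.mul_le_mul_right _ ?_))
  apply card_le_mul_numSpanningTrees
  · intro φ hφ v h
    have := mem_choices.1 (h1 hφ) v
    rw [h] at this
    exact G.loopless.irrefl v this
  · intro φ hφ
    obtain ⟨B, hB1, hB2⟩ := h5 φ hφ
    exact ⟨B, hB1.trans hb, hB2⟩
  · intro φ hφ
    obtain ⟨B, hB1, hB2⟩ := h5 φ hφ
    have hBb := hB1.trans hb
    have hq1 : (k + 1) * R.Q.card ≤ (k + 1) * q := Nat.mul_le_mul_left _ hq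
    have hq2 : 3 * k * R.Q.card ≤ 3 * k * q := Nat.mul_le_mul_left _ hq
    obtain ⟨T, hT1, hT2, hT3, hT4, hT5⟩ := exists_tree_near R hk a a' φ (mem_choices.1 (h1 hφ))
      (h3 φ hφ) B hB2 (h4 φ hφ) (by omega) hM (by omega)
    exact ⟨T, hT1, hT2, hT3, hT4.trans (by omega), hT5.trans (by omega)⟩

theorem eventually_pow_mul_lt (β : ℝ) (h0 : 0 < β) (h1 : β ≤ 1) (C : ℝ) :
    ∀ᶠ s : ℕ in atTop, (1 - β) ^ s * (C * (((s : ℝ) + 1) ^ 2) ^ 2) < 1 := by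
  have h2 : Tendsto (fun s : ℕ => (16 * |C|) * ((s : ℝ) ^ 4 * (1 - β) ^ s)) atTop
      (𝓝 ((16 * |C|) * 0)) :=
    (tendsto_pow_const_mul_const_pow_of_abs_lt_one 4
      (by rw [abs_lt]; constructor <;> linarith)).const_mul _
  rw [mul_zero] at h2
  filter_upwards [h2.eventually (gt_mem_nhds one_pos), eventually_ge_atTop 1] with s hs hs1
  refine lt_of_le_of_lt ?_ hs
  have h3 : (0 : ℝ) ≤ (1 - β) ^ s := pow_nonneg (by linarith) _
  have hs1' : (1 : ℝ) ≤ s := by exact_mod_cast hs1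
  have h4 : (((s : ℝ) + 1) ^ 2) ^ 2 ≤ 16 * (s : ℝ) ^ 4 := by
    calc (((s : ℝ) + 1) ^ 2) ^ 2 ≤ ((2 * (s : ℝ)) ^ 2) ^ 2 := by gcongr; linarith
      _ = _ := by ring
  calc (1 - β) ^ s * (C * (((s : ℝ) + 1) ^ 2) ^ 2)
      ≤ (1 - β) ^ s * (|C| * (16 * (s : ℝ) ^ 4)) := by
        gcongr
        exact le_abs_self C
    _ = _ := by ring

-- The integer part s of √n is both the cycle cutoff and the size of the hitting sets. It is large
-- enough that n/s is O(√n) and that size-s sets hit the O(n²) dense neighbourhoods, yet small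
-- enough that everything removed is o(r).
set_option maxHeartbeats 1000000 in
open Classical in
theorem exists_card_le_numSpanningTrees (k : ℕ) (hk : 3 ≤ k) :
    ∃ C N : ℕ, ∀ (V : Type*) [Fintype V] (G : SimpleGraph V) (r : ℕ), G.Connected →
      (∀ v, (Finset.univ.filter (fun u => G.Adj v u)).card = r) →
      Fintype.card V ≤ (k + 1) * r → N ≤ Fintype.card V →
      ∃ m : ℕ, (m : ℝ) ≤ g (max k 4) * Fintype.card V ∧
        (r : ℝ) ^ Fintype.card V * slack k ^ m ≤
          numSpanningTrees G k * (((Fintype.card V : ℝ) ^ 2 + 1) ^ (C * Nat.sqrt (Fintype.card V)) *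
            (100 * (Fintype.card V + 1)) * ((Fintype.card V).choose m : ℝ)) := by
  set σ := slack k with hσ
  have hσ0 : 0 < σ := slack_pos k hk
  -- Chosen so that `C₂ * s` bounds the redirected vertices on short cycles for at least half of the
  -- pairs, by Markov's inequality with `a' ≥ σ * r`.
  obtain ⟨C₂, hC₂'⟩ : ∃ C : ℕ, 2 * ((k : ℝ) + 1) ≤ C * σ :=
    ⟨⌈2 * ((k : ℝ) + 1) / σ⌉₊, by rw [← div_le_iff₀ hσ0]; exact Nat.le_ceil _⟩
  -- The greedy merge leaves components of size at least `a' / 2 ≥ σ * r / 4`, so at most `C₁` of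
  -- them; the `2 * k` extra units in `M` serve the link ends `S`.
  obtain ⟨C₁, hC₁'⟩ : ∃ C : ℕ, 4 * ((k : ℝ) + 1) ≤ C * σ :=
    ⟨⌈4 * ((k : ℝ) + 1) / σ⌉₊, by rw [← div_le_iff₀ hσ0]; exact Nat.le_ceil _⟩
  obtain ⟨M, hM⟩ : ∃ M, M = C₁ + 2 * k := ⟨_, rfl⟩
  -- `CB * s` bounds the set meeting all orbits: n/s ≤ 3s points for long cycles, then the
  -- redirected and the original short cycles.
  obtain ⟨CB, hCB⟩ : ∃ C, C = 3 + C₂ + 100 * (k + 1) := ⟨_, rfl⟩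
  obtain ⟨CQ, hCQ⟩ : ∃ C, C = 2 * k + M * (k + 1) + 2 * M := ⟨_, rfl⟩
  obtain ⟨β, hβ⟩ : ∃ β : ℝ, β = 1 / (4 * ((k : ℝ) + 2) ^ 3) := ⟨_, rfl⟩
  have hβ0 : 0 < β := by rw [hβ]; positivity
  have hβ1 : β ≤ 1 := by
    rw [hβ, div_le_one (by positivity)]
    have : (1 : ℝ) ≤ ((k : ℝ) + 2) ^ 3 := one_le_pow₀ (by linarith [Nat.cast_nonneg (α := ℝ) k])
    linarith
  have hr : ∀ᶠ r : ℕ in atTop, (2 ≤ σ * (r : ℝ)) ∧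
      ((2 * k + M : ℕ) : ℝ) ≤ (r : ℝ) / (2 * ((k : ℝ) + 1)) := by
    have hlin := tendsto_natCast_atTop_atTop (R := ℝ)
    exact ((hlin.const_mul_atTop hσ0).eventually_ge_atTop 2).and
      ((hlin.atTop_div_const (by positivity)).eventually_ge_atTop _)
  have hs : ∀ᶠ s : ℕ in atTop,
      ((1 - β) ^ s * (((2 * (k + 1) + 4 : ℕ) : ℝ) * (((s : ℝ) + 1) ^ 2) ^ 2) < 1) ∧
      ((CQ : ℝ) ≤ β * s) ∧ (2 * (CB + (k + 1) * CQ : ℝ) * (k + 1) ≤ σ * s) ∧ 1 ≤ s := by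
    have hlin := tendsto_natCast_atTop_atTop (R := ℝ)
    exact (eventually_pow_mul_lt β hβ0 hβ1 _).and
      (((hlin.const_mul_atTop hβ0).eventually_ge_atTop _).and
        (((hlin.const_mul_atTop hσ0).eventually_ge_atTop _).and (eventually_ge_atTop 1)))
  obtain ⟨r₀, hr₀⟩ := eventually_atTop.1
    ((eventually_exists_uniform_excess k hk).and (hr.and (eventually_ge_atTop 1)))
  obtain ⟨s₀, hs₀⟩ := eventually_atTop.1 hs
  refine ⟨2 * (2 * CB + 3 * k * CQ + 1) + 2 * CB, max ((k + 1) * r₀) (s₀ * s₀), ?_⟩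
  intro V _ G r hG hreg hn hN
  have hne : Nonempty V := hG.nonempty
  set n := Fintype.card V with hndef
  obtain ⟨s, hsdef⟩ : ∃ s, s = Nat.sqrt n := ⟨_, rfl⟩
  rw [← hsdef]
  have hrr : r₀ ≤ r := Nat.le_of_mul_le_mul_left
    ((le_max_left _ _).trans (hN.trans hn)) (Nat.succ_pos k)
  have hss : s₀ ≤ s := hsdef ▸ Nat.le_sqrt.2 ((le_max_right _ _).trans hN)
  obtain ⟨hA, ⟨hσr, hMr⟩, hr1⟩ := hr₀ r hrr
  obtain ⟨hs1, hs2, hs3, hs4⟩ := hs₀ s hss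
  have hsn : s * s ≤ n := hsdef ▸ Nat.sqrt_le n
  have hsn' : n < (s + 1) * (s + 1) := hsdef ▸ Nat.lt_succ_sqrt n
  have hsnR : (s : ℝ) * s ≤ n := by exact_mod_cast hsn
  have hnR : (n : ℝ) ≤ ((k : ℝ) + 1) * r := by exact_mod_cast hn
  have hs0R : (0 : ℝ) < s := by exact_mod_cast hs4
  have hCQs : 2 * k + M * (k + 1) + 2 * M * s ≤ CQ * s := by
    have := Nat.mul_le_mul_left (2 * k + M * (k + 1)) hs4
    rw [hCQ, add_mul]
    omega
  obtain ⟨R, hR⟩ := exists_reserve_aux G hG k r M s hk (by omega) hr1 hreg hn hMr (by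
      rw [← hβ]
      refine lt_of_le_of_lt ?_ hs1
      have hb : (0 : ℝ) ≤ (1 - β) ^ s := pow_nonneg (by linarith) _
      rw [Nat.cast_mul, Nat.cast_pow]
      have hlt : (n : ℝ) ≤ ((s : ℝ) + 1) ^ 2 := by
        rw [sq]; exact_mod_cast hsn'.le
      gcongr) (by
      have e2 : ((2 * k + M * (k + 1) + 2 * M * s : ℕ) : ℝ) ≤ (CQ * s : ℕ) := Nat.cast_le.2 hCQs
      rw [← hβ]
      refine e2.trans ?_
      push_cast
      calc (CQ : ℝ) * s ≤ β * s * s := by gcongr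
        _ = β * (s * s) := by ring
        _ ≤ β * n := by gcongr)
  have hRq : R.Q.card ≤ CQ * s := hR.trans hCQs
  obtain ⟨m, Γ, hΓ, hm, hcard, hprop⟩ := hA V G s hreg hn hs4
  obtain ⟨a', ha'⟩ : ∃ a, a = ⌈slack k * r⌉₊ := ⟨_, rfl⟩
  have ha'1 : σ * r ≤ a' := ha' ▸ Nat.le_ceil _
  rw [← ha'] at hprop
  have hbig : 2 * (CB * s + (k + 1) * (CQ * s)) ≤ a' := by
    have e1 : (2 * (CB + (k + 1) * CQ : ℝ) * (k + 1)) * s ≤ σ * r * (k + 1) := by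
      calc _ ≤ σ * s * s := by gcongr
        _ = σ * (s * s) := by ring
        _ ≤ σ * (((k : ℝ) + 1) * r) := mul_le_mul_of_nonneg_left (hsnR.trans hnR) hσ0.le
        _ = _ := by ring
    have e2 : (2 * (CB * s + (k + 1) * (CQ * s)) : ℝ) ≤ a' := by
      refine le_trans (le_of_mul_le_mul_right ?_ (by positivity : (0 : ℝ) < (k : ℝ) + 1)) ha'1
      refine le_trans (le_of_eq ?_) e1
      ring
    exact_mod_cast e2
  have hkey := card_mul_pow_le_numSpanningTrees R hk r (a' / 2) a' m s (100 * ((k + 1) * s))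
    (C₂ * s) (CB * s) (CQ * s) hs4 hreg Γ hΓ (fun φ hφ => (hprop φ hφ).1)
    (fun φ hφ => (hprop φ hφ).2.2) (fun φ hφ => (hprop φ hφ).2.1) (by
      have e1 : (2 * (s * n) : ℝ) ≤ a' * (C₂ * s) := by
        calc (2 * (s * n) : ℝ) ≤ 2 * (s * (((k : ℝ) + 1) * r)) := by gcongr
          _ = 2 * ((k : ℝ) + 1) * (s * r) := by ring
          _ ≤ C₂ * σ * (s * r) := by gcongr
          _ = σ * r * (C₂ * s) := by ring
          _ ≤ a' * (C₂ * s) := by gcongr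
      have e2 : 2 * (s * n) ≤ a' * (C₂ * s) := by exact_mod_cast e1
      exact e2.trans (Nat.mul_le_mul_left _ (Nat.le_succ _))) (by
      have e1 : n / s ≤ 3 * s := by
        rw [Nat.div_le_iff_le_mul_add_pred hs4]
        nlinarith
      have e2 : CB * s = 3 * s + C₂ * s + 100 * ((k + 1) * s) := by rw [hCB]; ring
      rw [e2, ← hndef]
      exact Nat.add_le_add_right (Nat.add_le_add_right e1 _) _) hRq (by omega) (by
      intro i hi
      have e1 : i ≤ C₁ := by
        have f1 : ((a' / 2 * i : ℕ) : ℝ) ≤ n := by exact_mod_cast hi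
        push_cast at f1
        have f2 : σ * r / 4 ≤ ((a' / 2 : ℕ) : ℝ) := by
          have : a' ≤ 2 * (a' / 2) + 1 := by omega
          have f3 : (a' : ℝ) ≤ 2 * ((a' / 2 : ℕ) : ℝ) + 1 := by exact_mod_cast this
          linarith
        have hr0 : (0 : ℝ) < r := by exact_mod_cast hr1
        have f4 : σ * r / 4 * i ≤ σ * r / 4 * C₁ := by
          calc σ * r / 4 * i ≤ ((a' / 2 : ℕ) : ℝ) * i := by gcongr
            _ ≤ n := f1
            _ ≤ ((k : ℝ) + 1) * r := hnR
            _ = 4 * ((k : ℝ) + 1) * (r / 4) := by ring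
            _ ≤ C₁ * σ * (r / 4) := by gcongr
            _ = _ := by ring
        exact_mod_cast le_of_mul_le_mul_left f4 (by positivity)
      omega) (by
      have : CQ * s ≤ (k + 1) * (CQ * s) := Nat.le_mul_of_pos_left _ (Nat.succ_pos k)
      omega)
  refine ⟨m, hm, ?_⟩
  rw [← hndef] at hkey
  have hexp : 2 * (2 * (CB * s) + 3 * k * (CQ * s) + 1) + 2 * (CB * s) ≤
      (2 * (2 * CB + 3 * k * CQ + 1) + 2 * CB) * s := by nlinarith
  have hr0 : (0 : ℝ) < (r : ℝ) ^ m := by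
    have : (0 : ℝ) < r := by exact_mod_cast hr1
    positivity
  have hkeyR : ((Γ.card * a' ^ m : ℕ) : ℝ) ≤ ((2 * (numSpanningTrees G k *
      (n ^ 2 + 1) ^ (2 * (2 * (CB * s) + 3 * k * (CQ * s) + 1) + 2 * (CB * s)) *
      (n.choose m * r ^ m)) : ℕ) : ℝ) := Nat.cast_le.2 hkey
  push_cast at hkeyR
  refine le_of_mul_le_mul_right ?_ hr0
  calc (r : ℝ) ^ n * σ ^ m * (r : ℝ) ^ m = (r : ℝ) ^ n * (σ * r) ^ m := by rw [mul_pow]; ring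
    _ ≤ 50 * ((n + 1) * Γ.card) * (a' : ℝ) ^ m := by gcongr
    _ = 50 * ((n : ℝ) + 1) * (Γ.card * (a' : ℝ) ^ m) := by ring
    _ ≤ 50 * ((n : ℝ) + 1) * (2 * (numSpanningTrees G k *
      ((n : ℝ) ^ 2 + 1) ^ (2 * (2 * (CB * s) + 3 * k * (CQ * s) + 1) + 2 * (CB * s)) *
      (n.choose m * (r : ℝ) ^ m))) := by gcongr
    _ ≤ 50 * ((n : ℝ) + 1) * (2 * (numSpanningTrees G k *
      ((n : ℝ) ^ 2 + 1) ^ ((2 * (2 * CB + 3 * k * CQ + 1) + 2 * CB) * s) *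
      (n.choose m * (r : ℝ) ^ m))) := by
        gcongr
        have : (0 : ℝ) ≤ (n : ℝ) ^ 2 := by positivity
        linarith
    _ = _ := by ring
end Count

/-! ### Entropy bound and the constants z_k -/

section Analysis

/-- One term of the binomial expansion of (γ + (1-γ))^n is at most 1. Raising the exponent of
γ/(1-γ) ≤ 1 from m to γ n only decreases it. -/
theorem choose_mul_rpow_le_one (γ : ℝ) (h0 : 0 < γ) (h1 : γ ≤ 1 / 2) (n m : ℕ)
    (hm : (m : ℝ) ≤ γ * n) :
    (n.choose m : ℝ) * (γ ^ γ * (1 - γ) ^ (1 - γ)) ^ n ≤ 1 := by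
  have h2 : 0 < 1 - γ := by linarith
  rcases lt_or_ge n m with hnm | hnm
  · rw [Nat.choose_eq_zero_of_lt hnm, Nat.cast_zero, zero_mul]
    exact zero_le_one
  have h3 : γ ^ m * (1 - γ) ^ (n - m) * (n.choose m : ℝ) ≤ 1 := by
    calc γ ^ m * (1 - γ) ^ (n - m) * (n.choose m : ℝ)
        ≤ ∑ j ∈ Finset.range (n + 1), γ ^ j * (1 - γ) ^ (n - j) * (n.choose j : ℝ) :=
          Finset.single_le_sum (f := fun j => γ ^ j * (1 - γ) ^ (n - j) * (n.choose j : ℝ))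
            (fun j _ => by positivity) (Finset.mem_range.2 (by omega))
      _ = 1 := by rw [← add_pow]; simp
  have h4 : (γ ^ γ * (1 - γ) ^ (1 - γ)) ^ n ≤ γ ^ m * (1 - γ) ^ (n - m) := by
    have e1 : (γ ^ γ * (1 - γ) ^ (1 - γ)) ^ n = (1 - γ) ^ n * (γ / (1 - γ)) ^ (γ * n) := by
      rw [mul_pow, ← Real.rpow_natCast, ← Real.rpow_natCast, ← Real.rpow_mul h0.le,
        ← Real.rpow_mul h2.le, Real.div_rpow h0.le h2.le, sub_mul, one_mul,
        Real.rpow_sub h2, Real.rpow_natCast]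
      field_simp
    have e2 : γ ^ m * (1 - γ) ^ (n - m) = (1 - γ) ^ n * (γ / (1 - γ)) ^ (m : ℝ) := by
      rw [Real.rpow_natCast, div_pow, ← Nat.sub_add_cancel hnm, pow_add, Nat.add_sub_cancel]
      field_simp
    rw [e1, e2]
    have h5 : γ / (1 - γ) ≤ 1 := by rw [div_le_one h2]; linarith
    exact mul_le_mul_of_nonneg_left
      (Real.rpow_le_rpow_of_exponent_ge (div_pos h0 h2) h5 hm) (by positivity)
  calc (n.choose m : ℝ) * (γ ^ γ * (1 - γ) ^ (1 - γ)) ^ n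
      ≤ (n.choose m : ℝ) * (γ ^ m * (1 - γ) ^ (n - m)) := by gcongr
    _ = γ ^ m * (1 - γ) ^ (n - m) * (n.choose m : ℝ) := by ring
    _ ≤ 1 := h3

/-- Entropy is at most log 2: weighted AM-GM for 1/γ and 1/(1-γ) with weights γ and 1-γ. -/
theorem half_le_rpow_mul_rpow (γ : ℝ) (h0 : 0 < γ) (h1 : γ ≤ 1 / 2) :
    1 / 2 ≤ γ ^ γ * (1 - γ) ^ (1 - γ) := by
  have h2 : 0 < 1 - γ := by linarith
  have h3 := Real.geom_mean_le_arith_mean2_weighted h0.le h2.le (inv_pos.2 h0).le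
    (inv_pos.2 h2).le (by ring)
  rw [mul_inv_cancel₀ h0.ne', mul_inv_cancel₀ h2.ne', Real.inv_rpow h0.le, Real.inv_rpow h2.le,
    ← mul_inv] at h3
  have h4 : 0 < γ ^ γ * (1 - γ) ^ (1 - γ) := by positivity
  rw [inv_le_comm₀ h4 (by norm_num)] at h3
  linarith

theorem f_nonneg (k : ℕ) : 0 ≤ f k := by
  have h := Real.sum_le_exp_of_nonneg (zero_le_one (α := ℝ)) (k - 2)
  simp only [one_pow] at h
  rw [f, sub_nonneg, one_div, inv_mul_le_iff₀ (Real.exp_pos 1), mul_one]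
  exact h

theorem f_le (k : ℕ) (hk : 3 ≤ k) :
    f k ≤ ((k : ℝ) - 1) / (Real.exp 1 * (((k - 2).factorial : ℝ) * ((k : ℝ) - 2))) := by
  have h := Real.exp_bound (x := 1) (by simp) (n := k - 2) (by omega)
  simp only [one_pow, abs_one, one_mul] at h
  have h1 := (abs_le.1 h).2
  have h2 : ((k - 2).succ : ℝ) = (k : ℝ) - 1 := by
    rw [Nat.cast_succ, Nat.cast_sub (by omega)]; push_cast; ring
  have h3 : ((k - 2 : ℕ) : ℝ) = (k : ℝ) - 2 := by rw [Nat.cast_sub (by omega)]; push_cast; ring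
  rw [h2, h3] at h1
  have he := Real.exp_pos 1
  have h4 : f k = (Real.exp 1 - ∑ i ∈ Finset.range (k - 2), 1 / (i.factorial : ℝ)) /
      Real.exp 1 := by
    rw [f]; field_simp
  rw [h4, mul_comm (Real.exp 1), ← div_div]
  gcongr

theorem succ_le_factorial_sub_two (k : ℕ) (hk : 5 ≤ k) : k + 1 ≤ (k - 2).factorial := by
  induction k, hk using Nat.le_induction with
  | base => decide
  | succ k hk ih =>
    have h1 : (k + 1 - 2).factorial = (k - 1) * (k - 2).factorial := by
      rw [show k + 1 - 2 = (k - 2) + 1 by omega, Nat.factorial_succ,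
        show k - 2 + 1 = k - 1 by omega]
    rw [h1]
    calc k + 1 + 1 ≤ 2 * (k + 1) := by omega
      _ ≤ (k - 1) * (k - 2).factorial := Nat.mul_le_mul (by omega) ih

theorem base_ge (k : ℕ) (hk : 5 ≤ k) : 0.3 ≤ 1 - ((k : ℝ) + 1) * (f k + g k) := by
  have h1 := f_le k (by omega)
  have hk' : (5 : ℝ) ≤ k := by exact_mod_cast hk
  have h2 : (k : ℝ) + 1 ≤ ((k - 2).factorial : ℝ) := by
    exact_mod_cast succ_le_factorial_sub_two k hk
  have he : 2.7 < Real.exp 1 := lt_trans (by norm_num) Real.exp_one_gt_d9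
  have h3 : ((k - 1).factorial : ℝ) = ((k : ℝ) - 1) * ((k - 2).factorial : ℝ) := by
    rw [show k - 1 = (k - 2) + 1 by omega, Nat.factorial_succ]
    rw [Nat.cast_mul, Nat.cast_succ, Nat.cast_sub (by omega)]
    push_cast
    ring
  set F := ((k - 2).factorial : ℝ)
  have hF : 0 < F := by linarith
  have h4 : f k + g k ≤ 1 / (Real.exp 1 * F) * (11 / 6) := by
    have e1 : ((k : ℝ) - 1) / (Real.exp 1 * (F * ((k : ℝ) - 2))) ≤
        1 / (Real.exp 1 * F) * (4 / 3) := by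
      rw [← mul_assoc, ← div_div, div_le_iff₀ (by linarith), div_mul_eq_mul_div, one_mul,
        div_mul_eq_mul_div]
      gcongr
      linarith
    have e2 : g k ≤ 1 / (Real.exp 1 * F) * (1 / 2) := by
      rw [g, h3]
      calc 2 / (Real.exp 1 * (((k : ℝ) - 1) * F)) ≤ 2 / (Real.exp 1 * (4 * F)) := by
            gcongr; linarith
        _ = _ := by field_simp; norm_num
    linarith
  have h5 : ((k : ℝ) + 1) * (f k + g k) ≤ F * (1 / (Real.exp 1 * F) * (11 / 6)) :=
    mul_le_mul h2 h4 (add_nonneg (f_nonneg k) (g_pos k).le) hF.le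
  have h6 : F * (1 / (Real.exp 1 * F) * (11 / 6)) = 11 / 6 / Real.exp 1 := by field_simp
  have h7 : 11 / 6 / Real.exp 1 ≤ 0.7 := by rw [div_le_iff₀ (Real.exp_pos 1)]; linarith
  linarith

theorem z_of_five_le (k : ℕ) (hk : 5 ≤ k) :
    z k = (1 - ((k : ℝ) + 1) * (f k + g k)) ^ g k * (1 - g k) ^ (1 - g k) * g k ^ g k := by
  rw [z, if_neg (by omega), if_neg (by omega)]

theorem g_le_quarter (k : ℕ) (hk : 4 ≤ k) : g k ≤ 1 / 4 :=
  (g_le_g_four k hk).trans (g_four_le.trans (by norm_num))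

theorem z_pos (k : ℕ) (hk : 3 ≤ k) : 0 < z k := by
  rcases lt_or_ge k 5 with hk5 | hk5
  · interval_cases k <;> norm_num [z]
  · rw [z_of_five_le k hk5]
    have h3 := base_ge k hk5
    have h4 := g_pos k
    have h5 := g_le_quarter k (by omega)
    have h6 : 0 < 1 - g k := by linarith
    have h7 : 0 < 1 - ((k : ℝ) + 1) * (f k + g k) := by linarith
    positivity

/-- Turns the cases k = 3, 4 into a comparison of rationals, using γ ≤ 1/4 and the entropy factor at
least 1/2. -/
theorem le_slack_rpow_mul (k : ℕ) (hk : 3 ≤ k) (c : ℝ) (hc : 0 ≤ c) (h : (2 * c) ^ 4 ≤ slack k) :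
    c ≤ slack k ^ g (max k 4) *
      (g (max k 4) ^ g (max k 4) * (1 - g (max k 4)) ^ (1 - g (max k 4))) := by
  set γ := g (max k 4)
  have h1 : γ ≤ 1 / 4 := g_le_quarter _ (le_max_right _ _)
  have h2 : 1 / 2 ≤ γ ^ γ * (1 - γ) ^ (1 - γ) :=
    half_le_rpow_mul_rpow γ (g_pos _) (h1.trans (by norm_num))
  have h3 : 2 * c ≤ slack k ^ γ := by
    calc 2 * c = ((2 * c) ^ 4) ^ (1 / 4 : ℝ) := by
          rw [← Real.rpow_natCast, ← Real.rpow_mul (by positivity)]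
          norm_num
      _ ≤ slack k ^ (1 / 4 : ℝ) := by gcongr
      _ ≤ slack k ^ γ := Real.rpow_le_rpow_of_exponent_ge (slack_pos k hk) (slack_le_one k) h1
  calc c = 2 * c * (1 / 2) := by ring
    _ ≤ _ := mul_le_mul h3 h2 (by norm_num) (by have := slack_pos k hk; positivity)

/-- For k ≥ 5 the construction loses only 1 - (k+1) g_k per redirection, while the base in `z` also
subtracts (k+1) f_k ≥ 0. For k = 3, 4 the numerical constants leave ample room. -/
theorem z_le (k : ℕ) (hk : 3 ≤ k) :
    z k ≤ slack k ^ g (max k 4) *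
      (g (max k 4) ^ g (max k 4) * (1 - g (max k 4)) ^ (1 - g (max k 4))) := by
  rcases lt_or_ge k 5 with hk5 | hk5
  · apply le_slack_rpow_mul k hk _ (z_pos k hk).le
    interval_cases k
    · norm_num [z, slack]
    · exact le_trans (by norm_num [z]) (le_slack 4 le_rfl)
  · rw [max_eq_left (by omega), z_of_five_le k hk5]
    have h3 := base_ge k hk5
    have h4 := g_pos k
    have h5 := g_le_quarter k (by omega)
    have h6 : 0 < 1 - g k := by linarith
    have h7 : 1 - ((k : ℝ) + 1) * (f k + g k) ≤ slack k := by
      rw [slack, if_neg (by omega)]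
      have := mul_nonneg (by positivity : (0 : ℝ) ≤ (k : ℝ) + 1) (f_nonneg k)
      linarith
    rw [mul_assoc, mul_comm (g k ^ g k)]
    have h8 : (1 - ((k : ℝ) + 1) * (f k + g k)) ^ g k ≤ slack k ^ g k :=
      Real.rpow_le_rpow (by linarith) h7 h4.le
    exact mul_le_mul_of_nonneg_right h8 (by positivity)

/-- The entropy bound on the loss incurred by redirecting at most `γ n` edges. -/
theorem pow_z_mul_choose_le (k n m : ℕ) (hk : 3 ≤ k) (hm : (m : ℝ) ≤ g (max k 4) * n) :
    z k ^ n * (n.choose m : ℝ) ≤ slack k ^ m := by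
  set γ := g (max k 4) with hγ
  have h1 : γ ≤ 1 / 4 := g_le_quarter _ (le_max_right _ _)
  have h2 := choose_mul_rpow_le_one γ (g_pos _) (h1.trans (by norm_num)) n m hm
  have hσ := slack_pos k hk
  have h3 : (slack k ^ γ) ^ n ≤ slack k ^ m := by
    rw [← Real.rpow_natCast, ← Real.rpow_mul hσ.le, ← Real.rpow_natCast (slack k) m]
    exact Real.rpow_le_rpow_of_exponent_ge hσ (slack_le_one k) hm
  have hz := z_pos k hk
  calc z k ^ n * (n.choose m : ℝ)
      ≤ (slack k ^ γ * (γ ^ γ * (1 - γ) ^ (1 - γ))) ^ n * (n.choose m : ℝ) := by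
        gcongr
        exact z_le k hk
    _ = (slack k ^ γ) ^ n * ((n.choose m : ℝ) * (γ ^ γ * (1 - γ) ^ (1 - γ)) ^ n) := by
        rw [mul_pow]; ring
    _ ≤ (slack k ^ γ) ^ n * 1 := by gcongr
    _ ≤ slack k ^ m := by rw [mul_one]; exact h3

theorem z_le_one (k : ℕ) (hk : 5 ≤ k) : z k ≤ 1 := by
  rw [z_of_five_le k hk]
  have h3 := base_ge k hk
  have h4 := g_pos k
  have h5 := g_le_quarter k (by omega)
  have h6 : 0 ≤ ((k : ℝ) + 1) * (f k + g k) :=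
    mul_nonneg (by positivity) (add_nonneg (f_nonneg k) h4.le)
  refine mul_le_one₀ (mul_le_one₀ (Real.rpow_le_one ?_ ?_ ?_) (Real.rpow_nonneg ?_ _)
    (Real.rpow_le_one ?_ ?_ ?_)) (Real.rpow_nonneg ?_ _) (Real.rpow_le_one ?_ ?_ ?_) <;> linarith

/-- From 1 - z ≤ -log z. The base is at least 0.3, so its logarithm contributes at most 7g/3, and
the middle factor at most g. The main term is -g log g ≤ g (1 + k log k), by (k-1)! ≤ k^k. -/
theorem one_sub_z_le (k : ℕ) (hk : 5 ≤ k) :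
    1 - z k ≤ 7 * ((k : ℝ) * Real.log k / ((k - 1).factorial : ℝ)) := by
  have hz := z_pos k (by omega)
  have h1 : 1 - z k ≤ -Real.log (z k) := by linarith [Real.log_le_sub_one_of_pos hz]
  refine h1.trans ?_
  have h3 := base_ge k hk
  have h4 := g_pos k
  have h5 := g_le_quarter k (by omega)
  have h6 : 0 < 1 - g k := by linarith
  set B := 1 - ((k : ℝ) + 1) * (f k + g k) with hB
  have hB0 : 0 < B := by linarith
  have hlog : Real.log (z k) = g k * Real.log B + (1 - g k) * Real.log (1 - g k) +
      g k * Real.log (g k) := by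
    rw [z_of_five_le k hk, Real.log_mul (by positivity) (by positivity),
      Real.log_mul (by positivity) (by positivity), Real.log_rpow hB0, Real.log_rpow h6,
      Real.log_rpow h4]
  have e1 : -(7 / 3) ≤ Real.log B := by
    have h7 := Real.one_sub_inv_le_log_of_pos hB0
    have h8 : B⁻¹ ≤ (0.3 : ℝ)⁻¹ := inv_anti₀ (by norm_num) h3
    norm_num at h8
    linarith
  have e2 : -g k ≤ (1 - g k) * Real.log (1 - g k) := by
    have h7 := Real.one_sub_inv_le_log_of_pos h6
    calc -g k = (1 - g k) * (1 - (1 - g k)⁻¹) := by field_simp; ring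
      _ ≤ _ := by gcongr
  have hk' : (5 : ℝ) ≤ k := by exact_mod_cast hk
  have hk0 : (0 : ℝ) < k := by linarith
  have hlk : 1 ≤ Real.log k := by
    rw [Real.le_log_iff_exp_le hk0]
    exact (Real.exp_one_lt_d9.le.trans (by norm_num)).trans hk'
  have hF : (0 : ℝ) < ((k - 1).factorial : ℝ) := by positivity
  have e3 : -(1 + k * Real.log k) ≤ Real.log (g k) := by
    rw [g, Real.log_div (by norm_num) (by positivity), Real.log_mul (Real.exp_pos 1).ne' hF.ne',
      Real.log_exp]
    have h7 : Real.log ((k - 1).factorial : ℝ) ≤ k * Real.log k := by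
      rw [← Real.log_pow]
      apply Real.log_le_log hF
      exact_mod_cast (Nat.factorial_le (Nat.sub_le k 1)).trans (Nat.factorial_le_pow k)
    have h8 : 0 ≤ Real.log 2 := Real.log_nonneg (by norm_num)
    linarith
  have hg : g k ≤ 1 / ((k - 1).factorial : ℝ) := by
    rw [g, ← div_div]
    have := Real.exp_one_gt_d9
    gcongr
    rw [div_le_one (Real.exp_pos 1)]
    linarith
  have hkl : 5 ≤ (k : ℝ) * Real.log k := by nlinarith
  have e4 : -Real.log (z k) ≤ g k * (7 * (k * Real.log k)) := by
    rw [hlog]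
    have h7 := mul_le_mul_of_nonneg_left e1 h4.le
    have h8 := mul_le_mul_of_nonneg_left e3 h4.le
    have h9 := mul_le_mul_of_nonneg_left hkl h4.le
    linarith
  refine e4.trans ?_
  calc g k * (7 * (k * Real.log k)) ≤ 1 / ((k - 1).factorial : ℝ) * (7 * (k * Real.log k)) := by
        gcongr
    _ = _ := by ring

theorem one_sub_z_isBigO : (fun k : ℕ => 1 - z k) =O[atTop]
    (fun k : ℕ => (k : ℝ) * Real.log (k : ℝ) / ((k - 1).factorial : ℝ)) := by
  apply IsBigO.of_bound 7
  filter_upwards [eventually_ge_atTop 5] with k hk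
  have h1 := one_sub_z_le k hk
  have h2 := z_le_one k hk
  rw [Real.norm_of_nonneg (by linarith), Real.norm_of_nonneg (by positivity)]
  exact h1

theorem tendsto_mul_log_div_factorial :
    Tendsto (fun k : ℕ => (k : ℝ) * Real.log (k : ℝ) / ((k - 1).factorial : ℝ)) atTop (𝓝 0) := by
  have h1 : Tendsto (fun k : ℕ => ((k : ℝ) ^ 3 / 2 ^ k) * (2 ^ k / (k.factorial : ℝ))) atTop
      (𝓝 (0 * 0)) :=
    (tendsto_pow_const_div_const_pow_of_one_lt 3 (by norm_num)).mul
      (FloorSemiring.tendsto_pow_div_factorial_atTop 2)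
  rw [mul_zero] at h1
  refine squeeze_zero' ?_ ?_ h1
  · filter_upwards with k
    positivity
  · filter_upwards [eventually_ge_atTop 1] with k hk
    have hk0 : (0 : ℝ) < k := by exact_mod_cast hk
    have h2 : (k.factorial : ℝ) = k * ((k - 1).factorial : ℝ) := by
      rw [← Nat.mul_factorial_pred (by omega)]; push_cast; ring
    have h3 : Real.log (k : ℝ) ≤ k := (Real.log_le_sub_one_of_pos hk0).trans (by linarith)
    rw [h2]
    calc (k : ℝ) * Real.log (k : ℝ) / ((k - 1).factorial : ℝ)
        ≤ (k : ℝ) * k / ((k - 1).factorial : ℝ) := by gcongr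
      _ = _ := by field_simp

theorem tendsto_z : Tendsto z atTop (𝓝 1) := by
  have h : Tendsto (fun k : ℕ => 1 - z k) atTop (𝓝 0) :=
    one_sub_z_isBigO.trans_tendsto tendsto_mul_log_div_factorial
  have := (tendsto_const_nhds (x := (1 : ℝ))).sub h
  simpa using this
end Analysis

/-! ### The error function and the n-th root -/

section ErrorFunction

theorem tendsto_subexponential (C : ℕ) :
    Tendsto (fun n : ℕ => ((C * Nat.sqrt n : ℕ) * Real.log ((n : ℝ) ^ 2 + 1) +
      Real.log (100 * ((n : ℝ) + 1))) / n) atTop (𝓝 0) := by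
  have h1 : Tendsto (fun n : ℕ => Real.log ((n : ℝ) + 1) / ((n : ℝ) + 1) ^ (1 / 2 : ℝ)) atTop
      (𝓝 0) := by
    have h := (isLittleO_log_rpow_atTop (r := 1 / 2) (by norm_num)).tendsto_div_nhds_zero
    exact h.comp (tendsto_natCast_atTop_atTop.atTop_add tendsto_const_nhds)
  have h2 : Tendsto (fun n : ℕ => Real.log 100 / (n : ℝ)) atTop (𝓝 0) :=
    tendsto_const_div_atTop_nhds_zero_nat _
  have h3 := (h1.const_mul (2 * (2 * (C : ℝ) + 1))).add h2
  rw [mul_zero, zero_add] at h3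
  refine squeeze_zero' ?_ ?_ h3
  · filter_upwards with n
    have e1 : 0 ≤ Real.log ((n : ℝ) ^ 2 + 1) := Real.log_nonneg (by nlinarith)
    have e2 : 0 ≤ Real.log (100 * ((n : ℝ) + 1)) := Real.log_nonneg (by
      linarith [Nat.cast_nonneg (α := ℝ) n])
    positivity
  · filter_upwards [eventually_ge_atTop 1] with n hn
    have hn1 : (1 : ℝ) ≤ n := by exact_mod_cast hn
    have hn0 : (0 : ℝ) < n := by linarith
    set y := ((n : ℝ) + 1) ^ (1 / 2 : ℝ) with hy
    have hy0 : 0 < y := by positivity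
    have hyy : y * y = n + 1 := by
      rw [hy, ← Real.rpow_add (by positivity)]; norm_num
    set l := Real.log ((n : ℝ) + 1) with hl
    have hl0 : 0 ≤ l := Real.log_nonneg (by linarith)
    have e1 : Real.log ((n : ℝ) ^ 2 + 1) ≤ 2 * l := by
      have h : Real.log (((n : ℝ) + 1) ^ 2) = 2 * l := by rw [Real.log_pow]; norm_num [hl]
      rw [← h]
      apply Real.log_le_log (by positivity)
      nlinarith
    have e2 : Real.log (100 * ((n : ℝ) + 1)) = Real.log 100 + l :=
      Real.log_mul (by norm_num) (by positivity)
    have hy1 : 1 ≤ y := by nlinarith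
    have e3 : ((Nat.sqrt n : ℕ) : ℝ) ≤ y := by
      have h : ((Nat.sqrt n * Nat.sqrt n : ℕ) : ℝ) ≤ n := by exact_mod_cast Nat.sqrt_le n
      push_cast at h
      nlinarith
    have e4 : y * l / n ≤ 2 * (l / y) := by
      rw [← mul_div_assoc, div_le_div_iff₀ hn0 hy0]
      calc y * l * y = (y * y) * l := by ring
        _ ≤ (2 * n) * l := by
          rw [hyy]
          exact mul_le_mul_of_nonneg_right (by linarith) hl0
        _ = _ := by ring
    have e5 : ((C * Nat.sqrt n : ℕ) : ℝ) * Real.log ((n : ℝ) ^ 2 + 1) ≤ C * y * (2 * l) := by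
      rw [Nat.cast_mul]
      exact mul_le_mul (by gcongr) e1 (Real.log_nonneg (by nlinarith)) (by positivity)
    have e6 : l ≤ y * l := le_mul_of_one_le_left hl0 hy1
    rw [e2]
    calc (((C * Nat.sqrt n : ℕ) : ℝ) * Real.log ((n : ℝ) ^ 2 + 1) + (Real.log 100 + l)) / n
        ≤ ((2 * C + 1) * (y * l) + Real.log 100) / n :=
          div_le_div_of_nonneg_right (by linarith) hn0.le
      _ = (2 * C + 1) * (y * l / n) + Real.log 100 / n := by ring
      _ ≤ (2 * C + 1) * (2 * (l / y)) + Real.log 100 / n := by gcongr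
      _ = _ := by ring

open Classical in
theorem exists_error_function (k : ℕ) (hk : 3 ≤ k) :
    ∃ ε : ℕ → ℝ, Tendsto ε atTop (𝓝 0) ∧
      ∀ (V : Type*) [Fintype V] (G : SimpleGraph V) (r : ℕ), G.Connected →
        (∀ v, (Finset.univ.filter (fun u => G.Adj v u)).card = r) →
        Fintype.card V ≤ (k + 1) * r →
        (1 - ε (Fintype.card V)) * (r : ℝ) * z k ≤
          (numSpanningTrees G k : ℝ) ^ (1 / (Fintype.card V : ℝ)) := by
  obtain ⟨C, N, h⟩ := exists_card_le_numSpanningTrees k hk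
  let L : ℕ → ℝ := fun n => ((C * Nat.sqrt n : ℕ) * Real.log ((n : ℝ) ^ 2 + 1) +
    Real.log (100 * ((n : ℝ) + 1)))
  -- The value 1 makes the claim trivial for small n. For larger n the factor 1 - ε is the n-th root
  -- of the inverse of the subexponential loss `Real.exp (L n)`.
  refine ⟨fun n => if n < N then 1 else 1 - Real.exp (-(L n / n)), ?_, ?_⟩
  · have h1 : Tendsto (fun n : ℕ => 1 - Real.exp (-(L n / n))) atTop (𝓝 (1 - Real.exp (-0))) :=
      tendsto_const_nhds.sub
        ((Real.continuous_exp.tendsto _).comp (tendsto_subexponential C).neg)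
    rw [neg_zero, Real.exp_zero, sub_self] at h1
    refine h1.congr' ?_
    filter_upwards [eventually_ge_atTop N] with n hn
    rw [if_neg (by omega)]
  · intro V _ G r hG hreg hn
    by_cases hN : Fintype.card V < N
    · simp only [hN, if_true, sub_self, zero_mul]
      positivity
    · simp only [hN, if_false, sub_sub_cancel]
      have hne : Nonempty V := hG.nonempty
      obtain ⟨m, hm, hcount⟩ := h V G r hG hreg hn (by omega)
      have hn0 : 0 < Fintype.card V := Fintype.card_pos
      have hent := pow_z_mul_choose_le k (Fintype.card V) m hk hm
      set n := Fintype.card V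
      have hn0R : (0 : ℝ) < n := by exact_mod_cast hn0
      have hz := z_pos k hk
      rcases Nat.eq_zero_or_pos (n.choose m) with h0 | h0
      · rw [h0] at hcount
        have hr0 : (r : ℝ) ^ n * slack k ^ m ≤ 0 := by simpa using hcount
        have hσ := pow_pos (slack_pos k hk) m
        have hr1 : (r : ℝ) ^ n ≤ 0 := by
          by_contra hcon
          push Not at hcon
          linarith [mul_pos hcon hσ]
        have hr2 : (r : ℝ) = 0 :=
          pow_eq_zero_iff hn0.ne' |>.1 (le_antisymm hr1 (by positivity))
        rw [hr2, mul_zero, zero_mul]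
        positivity
      · have h0R : (0 : ℝ) < n.choose m := by exact_mod_cast h0
        have hP : ((n : ℝ) ^ 2 + 1) ^ (C * Nat.sqrt n) * (100 * ((n : ℝ) + 1)) =
            Real.exp (L n) := by
          simp only [L]
          rw [Real.exp_add, Real.exp_nat_mul, Real.exp_log (by positivity),
            Real.exp_log (by positivity)]
        rw [hP] at hcount
        have h2 : ((r : ℝ) * z k) ^ n ≤ numSpanningTrees G k * Real.exp (L n) := by
          refine le_of_mul_le_mul_right ?_ h0R
          calc ((r : ℝ) * z k) ^ n * (n.choose m : ℝ)
              = (r : ℝ) ^ n * (z k ^ n * (n.choose m : ℝ)) := by rw [mul_pow]; ring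
            _ ≤ (r : ℝ) ^ n * slack k ^ m := by gcongr
            _ ≤ _ := hcount
            _ = _ := by ring
        have h3 : (Real.exp (-(L n / n)) * r * z k) ^ n ≤ numSpanningTrees G k := by
          have h4 : Real.exp (-(L n / n)) ^ n = Real.exp (-(L n)) := by
            rw [← Real.exp_nat_mul]
            congr 1
            field_simp
          calc (Real.exp (-(L n / n)) * r * z k) ^ n
              = Real.exp (-(L n)) * ((r : ℝ) * z k) ^ n := by rw [mul_assoc, mul_pow, h4]
            _ ≤ Real.exp (-(L n)) * (numSpanningTrees G k * Real.exp (L n)) := by gcongr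
            _ = (Real.exp (-(L n)) * Real.exp (L n)) * numSpanningTrees G k := by ring
            _ = _ := by rw [← Real.exp_add, neg_add_cancel, Real.exp_zero, one_mul]
        calc Real.exp (-(L n / n)) * r * z k
            = ((Real.exp (-(L n / n)) * r * z k) ^ n) ^ ((n : ℝ)⁻¹) :=
              (Real.pow_rpow_inv_natCast (by positivity) hn0.ne').symm
          _ ≤ (numSpanningTrees G k : ℝ) ^ ((n : ℝ)⁻¹) :=
              Real.rpow_le_rpow (by positivity) h3 (by positivity)
          _ = _ := by rw [one_div]
end ErrorFunction
end BoundedDegreeTrees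

theorem theorem1 :
    (∀ k : ℕ, 3 ≤ k →
      0 < BoundedDegreeTrees.z k ∧
      ∃ ε : ℕ → ℝ, Tendsto ε atTop (𝓝 0) ∧
        ∀ (V : Type*) [Fintype V] (G : SimpleGraph V) [DecidableRel G.Adj] (r : ℕ),
          G.Connected → G.IsRegularOfDegree r →
          (Fintype.card V : ℝ) / ((k : ℝ) + 1) ≤ (r : ℝ) →
          (1 - ε (Fintype.card V)) * (r : ℝ) * BoundedDegreeTrees.z k ≤
            (BoundedDegreeTrees.numSpanningTrees G k : ℝ) ^ (1 / (Fintype.card V : ℝ))) ∧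
    (∀ k : ℕ, 5 ≤ k →
      0 < 1 - ((k : ℝ) + 1) * (BoundedDegreeTrees.f k + BoundedDegreeTrees.g k)) ∧
    Tendsto BoundedDegreeTrees.z atTop (𝓝 1) ∧
    (fun k : ℕ => 1 - BoundedDegreeTrees.z k) =O[atTop]
      (fun k : ℕ => (k : ℝ) * Real.log (k : ℝ) / ((k - 1).factorial : ℝ)) := by
  refine ⟨fun k hk => ⟨BoundedDegreeTrees.z_pos k hk, ?_⟩, ?_, BoundedDegreeTrees.tendsto_z,
    BoundedDegreeTrees.one_sub_z_isBigO⟩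
  · obtain ⟨ε, hε, h⟩ := BoundedDegreeTrees.exists_error_function k hk
    refine ⟨ε, hε, fun V _ G _ r hG hreg hr => h V G r hG (fun v => ?_) ?_⟩
    · rw [← hreg v, ← G.card_neighborFinset_eq_degree, G.neighborFinset_eq_filter]
      congr
    · rw [div_le_iff₀ (by positivity), mul_comm] at hr
      exact_mod_cast hr
  · intro k hk
    exact lt_of_lt_of_le (by norm_num) (BoundedDegreeTrees.base_ge k hk)
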